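/- **Setting.** Let $T:[0,1)\to[0,1)$ be an interval translation mapping on $r$ intervals: $0=\beta_0<\beta_1<\dots<\beta_r=1$ and $T(x)=x+\gamma_s$ on $I_s=[\beta_{s-1},\beta_s)$, with $T(I_s)\subseteq[0,1)$. Put $X=\bigcap_{n\ge0}T^n([0,1))$. Call $\beta_1,\dots,\beta_{r-1}$ the discontinuities. A signed point $x^{+}$ (resp. $x^-$) is the germ of the intervals $[x,x+\varepsilon)$ (resp. $[x-\varepsilon,x)$), and $T$ acts on signed points through one-sided limits, preserving the sign. Thus the signed points of $[x,y)$ are those of $[x^+,y^-]$, and $x^\pm\in X$ means that some interval of the germ is contained in $X$. Let $W=\mathbb R^r\oplus\mathbb R^{r-1}$ with canonical bases $(e_s)$, $(f_i)$, let $k_s(p,n)=\#\{0\le t<n: T^tp\in I_s\}$, $E(p,n)=\sum_s k_s(p,n)e_s$, and write $f_\beta=f_i$ if $\beta=\beta_i$ (also for $\beta=\beta_i^\pm$). All intervals are half-open $[x,y)$ with $x<y$. The return time of a signed point to an interval $J$ is the first $n\ge1$ at which it lands in $J$; landings on discontinuities "before returning" are at times $0\le t<n$. **Vectors of an interval.**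 For an interval $J=[x,y)\subseteq X$ let $a_1<\dots<a_{N-1}$ be the (finitely many) points of the interior of $J$ that land on a discontinuity before returning to $J$, and let $a_0=x$, $a_N=y$. For a signed point $a_j^{+}$ ($0\le j\le N-1$) or $a_j^-$ ($1\le j\le N$), let $m_j^\pm$ be the number of its landings on discontinuities before it returns to $J$ and $\beta^\pm(j,1),\dots,\beta^\pm(j,m_j^\pm)$ the successive signed discontinuities it lands on. Define * $L_j=(E(a_j,l),-f_{\beta(j,1)})$, with $l$ the time of the first landing of $a_j$ (of $a_0^+$, resp. $a_N^-$, at the boundary), whenever there is such a landing (always so for $0<j<N$); * $C^\pm(j,k)=(E(\beta^\pm(j,k),q),\,f_{\beta^\pm(j,k)}-f_{\beta^\pm(j,k+1)})$ for $1\le k<m_j^\pm$, with $q$ the landing time of $\beta^\pm(j,k)$ on $\beta^\pm(j,k+1)$; * $R_j^\pm=(E(b,\rho),f_b)$, with $b=\beta^\pm(j,m_j^\pm)$ and $\rho$ the return time of $b$ to $J$; if $m_j^\pm=0$ (possible only for $a_0^+$, $a_N^-$), $R_j^\pm=(E(a_j^\pm,\rho),0)$ with $\rho$ the return time of $a_j^\pm$.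 A maximal periodic interval is a maximal interval of $[0,1)$ consisting of periodic points with the same itinerary $(s_n)$, $T^nx\in I_{s_n}$. For it $N=1$, and for its boundary points $a_0^+$ and $a_1^-$ one also puts $C^{+}(0,m_0^{+})=R_0^{+}+L_0$ if $m_0^+\geq 1$ and $C^{-}(1,m_1^{-})=R_1^{-}+L_1$ if $m_1^-\ge1$. Let $\mathcal C_{\neg X}$ be the set of signed discontinuities $\beta\notin X$ that land on a discontinuity at some time $\ge1$. For such $\beta$ let $q(\beta)$ be the first such time, $\beta'=T^{q(\beta)}\beta$, and $C_\beta=(E(\beta,q(\beta)),f_\beta-f_{\beta'})$. **Theorem.** Let $J_0$ be a component interval of $X$ (a maximal interval contained in $X$) and let $J_1,\dots,J_n$ ($n\ge0$) be maximal periodic intervals, such that the orbits of $J_0,J_1,\dots,J_n$ are pairwise disjoint. An upper index $i$ marks the objects of $J_i$. Let real coefficients satisfy $$\begin{aligned}&\sum_{i=1}^n\sum_{k=1}^{m_0^{i,+}}\alpha^{i,+}(0,k)C^{i,+}(0,k)+\sum_{i=1}^n\sum_{k=1}^{m_1^{i,-}}\alpha^{i,-}(1,k)C^{i,-}(1,k)\\&+\sum_{j=0}^{N_0-1}\Big(\sum_{1\le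 k<m_j^{0,+}}\alpha^{0,+}(j,k)C^{0,+}(j,k)+\alpha_j^{0,+}R_j^{0,+}\Big)+\sum_{j=1}^{N_0}\Big(\sum_{1\le k<m_j^{0,-}}\alpha^{0,-}(j,k)C^{0,-}(j,k)+\alpha_j^{0,-}R_j^{0,-}\Big)\\&+\sum_{j}\alpha_j^0L_j^0+\sum_{\beta\in\mathcal C_{\neg X}}\alpha_\beta C_\beta=0,\end{aligned}$$ where the sum of the $\alpha^0_jL^0_j$ is over those $0\le j\le N_0$ for which $L_j^0$ is defined. Then: 1. for $1\le i\le n$: $\alpha^{i,+}(0,1)=\dots=\alpha^{i,+}(0,m_0^{i,+})=-\alpha^{i,-}(1,1)=\dots=-\alpha^{i,-}(1,m_1^{i,-})$; 2. for $0\le j\le N_0-1$: $\alpha^{0,+}(j,1)=\dots=\alpha^{0,+}(j,m_j^{0,+}-1)=\alpha_j^{0,+}=-\alpha^{0,-}(j+1,1)=\dots=-\alpha^{0,-}(j+1,m_{j+1}^{0,-}-1)=-\alpha_{j+1}^{0,-}$; 3. $\alpha_0^0=\alpha^{0,+}(0,1)$ and $\alpha_{N_0}^0=\alpha^{0,-}(N_0,1)$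 (each if the corresponding $L^0_j$ is defined), and $\alpha_j^0=\alpha^{0,+}(j,1)+\alpha^{0,-}(j,1)$ for $1\le j\le N_0-1$, where $\alpha^{0,\pm}(j,1)$ stands for $\alpha_j^{0,\pm}$ when $m_j^{0,\pm}=1$; 4. $\alpha_\beta=0$ for all $\beta\in\mathcal C_{\neg X}$. Moreover, the following family of vectors is linearly independent: all $L_j^0$ that are defined; $R_j^{0,+}$ for $0\le j<N_0$; $C^{0,+}(j,k)$ for $0\le j<N_0$, $1\le k<m_j^{0,+}$; $C^{0,-}(j,k)$ for $1\le j\le N_0$, $1\le k<m_j^{0,-}$; for $1\le i\le n$, $C^{i,+}(0,k)$ for $1\le k\le m_0^{i,+}$ and $C^{i,-}(1,k)$ for $1\le k<m_1^{i,-}$; and $C_\beta$ for $\beta\in\mathcal C_{\neg X}$. -/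

import Mathlib

open Finset Function

/-- The side of a signed point: `plus` for `x⁺` (the germ of intervals `[x, x + ε)`), `minus` for
`x⁻` (the germ of intervals `[x - ε, x)`). -/
inductive Side where
  | plus
  | minus
  deriving DecidableEq

instance : Fintype Side where
  elems := {.plus, .minus}
  complete := by rintro (_ | _) <;> decide

/-- A nonempty half-open interval `[left, right)`. In terms of signed points it is
`[left⁺, right⁻]`. -/
structure HOInterval where
  left : ℝ
  right : ℝ
  left_lt_right : left < right

namespace HOInterval

/-- The geometric points of the interval. -/
def toSet (J : HOInterval) : Set ℝ := Set.Ico J.left J.right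

/-- The signed point `z^σ` belongs to `J = [left⁺, right⁻]`. -/
def MemSigned (J : HOInterval) : Side → ℝ → Prop
  | .plus, z => J.left ≤ z ∧ z < J.right
  | .minus, z => J.left < z ∧ z ≤ J.right

/-- The two signed boundary points `left⁺` and `right⁻`. -/
def endpoint (J : HOInterval) : Side → ℝ
  | .plus => J.left
  | .minus => J.right

end HOInterval

/-- An interval translation mapping on `r` intervals `I_s = [β_{s-1}, β_s)` of `[0,1)`, where
`0 = β_0 < β_1 < ⋯ < β_r = 1`: on `I_s` it is the translation by `γ_s`, and it maps `I_s` into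
`[0,1)`. The piece `I_s` of the text has the index `s - 1 : Fin r` here. -/
structure ITM (r : ℕ) where
  β : Fin (r + 1) → ℝ
  γ : Fin r → ℝ
  strictMono : StrictMono β
  β_zero : β 0 = 0
  β_last : β (Fin.last r) = 1
  nonneg : ∀ s, 0 ≤ β s.castSucc + γ s
  le_one : ∀ s, β s.succ + γ s ≤ 1

namespace ITM

variable {r : ℕ}

/-- The signed point `x^σ` lies in the piece `I_s = [β_{s-1}⁺, β_s⁻]`. For `σ = plus` this is also
the condition `x ∈ I_s` for a geometric point `x`. -/
def InPiece (T : ITM r) : Side → Fin r → ℝ → Prop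
  | .plus, s, x => T.β s.castSucc ≤ x ∧ x < T.β s.succ
  | .minus, s, x => T.β s.castSucc < x ∧ x ≤ T.β s.succ

open Classical in
/-- The map on signed points: `T (x^σ) = (T.step σ x)^σ`. On the piece containing `x^σ` it is the
translation by the corresponding `γ_s`, so `T.step .plus x` is the limit of `T y` as `y ↓ x` and
`T.step .minus x` is the limit of `T y` as `y ↑ x`. -/
noncomputable def step (T : ITM r) (σ : Side) (x : ℝ) : ℝ :=
  x + ∑ s, if T.InPiece σ s x then T.γ s else 0

/-- The map `T : [0,1) → [0,1)` on geometric points (extended by the identity off `[0,1)`). -/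
noncomputable def map (T : ITM r) : ℝ → ℝ := T.step .plus

/-- The point underlying `T^n (x^σ)`. -/
noncomputable def orbit (T : ITM r) (σ : Side) (x : ℝ) (n : ℕ) : ℝ := (T.step σ)^[n] x

/-- The attractor `X = ⋂ₙ T^n [0,1)`. -/
def attractor (T : ITM r) : Set ℝ := ⋂ n : ℕ, T.map^[n] '' Set.Ico 0 1

/-- The signed point `x^σ` is contained in `X`: some representative of its germ is. -/
def SignedMemX (T : ITM r) : Side → ℝ → Prop
  | .plus, x => ∃ ε > 0, Set.Ico x (x + ε) ⊆ T.attractor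
  | .minus, x => ∃ ε > 0, Set.Ico (x - ε) x ⊆ T.attractor

/-- The points `β_1, …, β_{r-1}`. -/
def disc (T : ITM r) (i : Fin (r - 1)) : ℝ := T.β ⟨i + 1, by omega⟩

/-- `x` is one of `β_1, …, β_{r-1}`. -/
def IsDisc (T : ITM r) (x : ℝ) : Prop := ∃ i, T.disc i = x

/-- The space `W(r) = ℝ^r ⊕ ℝ^(r-1)` of coefficient vectors. -/
abbrev W (r : ℕ) : Type := (Fin r → ℝ) × (Fin (r - 1) → ℝ)

open Classical in
/-- The vector `f_{ind(b)}` for a discontinuity `b` (and `0` for any other point). -/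
noncomputable def fvec (T : ITM r) (b : ℝ) : Fin (r - 1) → ℝ :=
  fun i => if T.disc i = b then 1 else 0

open Classical in
/-- The vector `∑ₛ k_s(x^σ, n) e_s`, where `k_s(x^σ, n)` is the number of `0 ≤ t < n` with
`T^t (x^σ) ∈ I_s`. -/
noncomputable def visits (T : ITM r) (σ : Side) (x : ℝ) (n : ℕ) : Fin r → ℝ :=
  fun s => (Nat.count (fun t => T.InPiece σ s (T.orbit σ x t)) n : ℝ)

/-! ### Landings and returns -/

/-- The first time `n ≥ 1` with `T^n (a^σ) ∈ J`. -/
noncomputable def returnTime (T : ITM r) (J : HOInterval) (σ : Side) (a : ℝ) : ℕ :=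
  sInf {n : ℕ | 0 < n ∧ J.MemSigned σ (T.orbit σ a n)}

open Classical in
/-- The number `m` of discontinuities on which `a^σ` lands (at times `t ≥ 0`) before returning
to `J`. -/
noncomputable def numLandings (T : ITM r) (J : HOInterval) (σ : Side) (a : ℝ) : ℕ :=
  Nat.count (fun t => T.IsDisc (T.orbit σ a t)) (T.returnTime J σ a)

open Classical in
/-- The time of the `k`-th landing of `a^σ` on a discontinuity, `k ≥ 1`. -/
noncomputable def landTime (T : ITM r) (σ : Side) (a : ℝ) (k : ℕ) : ℕ :=
  Nat.nth (fun t => T.IsDisc (T.orbit σ a t)) (k - 1)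

/-- The `k`-th discontinuity along the orbit of `a^σ`, `k ≥ 1`. -/
noncomputable def landPt (T : ITM r) (σ : Side) (a : ℝ) (k : ℕ) : ℝ :=
  T.orbit σ a (T.landTime σ a k)

/-- The landing vector of `a^σ`: from `a^σ` to its first discontinuity. -/
noncomputable def landVec (T : ITM r) (σ : Side) (a : ℝ) : W r :=
  (T.visits σ a (T.landTime σ a 1), - T.fvec (T.landPt σ a 1))

/-- The critical connection vector from the `k`-th to the `(k+1)`-st discontinuity along the orbit
of `a^σ`. -/
noncomputable def connVec (T : ITM r) (σ : Side) (a : ℝ) (k : ℕ) : W r :=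
  (T.visits σ (T.landPt σ a k) (T.landTime σ a (k + 1) - T.landTime σ a k),
    T.fvec (T.landPt σ a k) - T.fvec (T.landPt σ a (k + 1)))

open Classical in
/-- The return vector of `a^σ` to `J`: from the last discontinuity on which `a^σ` lands before
returning to `J`, up to the return to `J`; if there is no such discontinuity, from `a^σ` itself and
without an `f`-part. -/
noncomputable def returnVec (T : ITM r) (J : HOInterval) (σ : Side) (a : ℝ) : W r :=
  if T.numLandings J σ a = 0 then (T.visits σ a (T.returnTime J σ a), 0)
  else
    let b := T.landPt σ a (T.numLandings J σ a)
    (T.visits σ b (T.returnTime J σ b), T.fvec b)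

/-! ### The points `a_0 < a_1 < ⋯ < a_N` of an interval -/

/-- `z` is a point in the interior of `J` that lands on a discontinuity before returning to `J`. -/
def IsBranchPoint (T : ITM r) (J : HOInterval) (z : ℝ) : Prop :=
  J.left < z ∧ z < J.right ∧ 0 < T.numLandings J .plus z

/-- The number `N_J`, which is one more than the number of branch points in the interior. -/
noncomputable def branchCount (T : ITM r) (J : HOInterval) : ℕ :=
  {z | T.IsBranchPoint J z}.ncard + 1

/-- The points `a_0 < a_1 < ⋯ < a_N`: `a_0` is the left endpoint of `J`, and each next one is the
smallest larger point that is a branch point or the right endpoint of `J`. -/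
noncomputable def branchPt (T : ITM r) (J : HOInterval) : ℕ → ℝ
  | 0 => J.left
  | j + 1 => sInf {z | branchPt T J j < z ∧ (T.IsBranchPoint J z ∨ z = J.right)}

/-- `m_j^{J,σ}`. -/
noncomputable def m (T : ITM r) (J : HOInterval) (σ : Side) (j : ℕ) : ℕ :=
  T.numLandings J σ (T.branchPt J j)

/-- The side from which the first landing of `a_j` is taken. It matters only at the boundary points
`a_0⁺` and `a_N⁻`, since an interior `a_j`, `a_j⁺` and `a_j⁻` move together up to that landing. -/
noncomputable def landSide (T : ITM r) (J : HOInterval) (j : ℕ) : Side :=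
  if j < T.branchCount J then .plus else .minus

/-- `a_j` lands on a discontinuity before returning to `J` (automatic for `0 < j < N_J`). -/
def Lands (T : ITM r) (J : HOInterval) (j : ℕ) : Prop := 0 < T.m J (T.landSide J j) j

/-- The landing vector `L_j^J`. -/
noncomputable def L (T : ITM r) (J : HOInterval) (j : ℕ) : W r :=
  T.landVec (T.landSide J j) (T.branchPt J j)

/-- The critical connection vector `C^{J,σ}(j,k)`, `1 ≤ k < m_j^{J,σ}`. -/
noncomputable def C (T : ITM r) (J : HOInterval) (σ : Side) (j k : ℕ) : W r :=
  T.connVec σ (T.branchPt J j) k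

/-- The return vector `R_j^{J,σ}`. -/
noncomputable def R (T : ITM r) (J : HOInterval) (σ : Side) (j : ℕ) : W r :=
  T.returnVec J σ (T.branchPt J j)

/-! ### Maximal periodic intervals -/

/-- The number of discontinuities on which the signed boundary point of `J` on the side `σ`
lands before returning to `J`. -/
noncomputable def perM (T : ITM r) (J : HOInterval) (σ : Side) : ℕ :=
  T.numLandings J σ (J.endpoint σ)

/-- The critical connection vectors of the boundary points of a maximal periodic interval,
`1 ≤ k ≤ m`: `C(k)` for `k < m`, while `C(m)` is the sum of the return and the landing vector. -/
noncomputable def perC (T : ITM r) (J : HOInterval) (σ : Side) (k : ℕ) : W r :=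
  if k = T.perM J σ then T.returnVec J σ (J.endpoint σ) + T.landVec σ (J.endpoint σ)
  else T.connVec σ (J.endpoint σ) k

/-- `J ⊆ [0,1)` consists of periodic points with the same itinerary. -/
def IsPeriodicInterval (T : ITM r) (J : HOInterval) : Prop :=
  J.toSet ⊆ Set.Ico 0 1 ∧ (∀ z ∈ J.toSet, z ∈ periodicPts T.map) ∧
    ∀ z ∈ J.toSet, ∀ w ∈ J.toSet, ∀ n s,
      T.InPiece .plus s (T.map^[n] z) ↔ T.InPiece .plus s (T.map^[n] w)

/-- `J` is a maximal periodic interval. -/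
def IsMaxPeriodic (T : ITM r) (J : HOInterval) : Prop :=
  T.IsPeriodicInterval J ∧
    ∀ K : HOInterval, T.IsPeriodicInterval K → J.toSet ⊆ K.toSet → K.toSet ⊆ J.toSet

/-- `J` is a component interval of `X`: a maximal half-open interval contained in `X`. -/
def IsComponent (T : ITM r) (J : HOInterval) : Prop :=
  J.toSet ⊆ T.attractor ∧
    ∀ K : HOInterval, K.toSet ⊆ T.attractor → J.toSet ⊆ K.toSet → K.toSet ⊆ J.toSet

/-- The orbit `O(S) = ⋃ₙ T^n S`. -/
def orbitSet (T : ITM r) (S : Set ℝ) : Set ℝ := ⋃ n : ℕ, T.map^[n] '' S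

/-! ### Discontinuities outside `X` -/

/-- A signed discontinuity `β_{i+1}^σ`. -/
abbrev SDisc (r : ℕ) : Type := Side × Fin (r - 1)

/-- The signed discontinuity `b` lands on a discontinuity at some time `n ≥ 1`; that is,
`b ∈ 𝒞₁`. -/
def EventuallyLands (T : ITM r) (b : SDisc r) : Prop :=
  ∃ n, 0 < n ∧ T.IsDisc (T.orbit b.1 (T.disc b.2) n)

/-- The landing time `q(b)` of `b` on the first discontinuity in its forward orbit. -/
noncomputable def firstLanding (T : ITM r) (b : SDisc r) : ℕ :=
  sInf {n : ℕ | 0 < n ∧ T.IsDisc (T.orbit b.1 (T.disc b.2) n)}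

/-- The critical connection vector `C_b` of `b ∈ 𝒞₁`. -/
noncomputable def genC (T : ITM r) (b : SDisc r) : W r :=
  (T.visits b.1 (T.disc b.2) (T.firstLanding b),
    T.fvec (T.disc b.2) - T.fvec (T.orbit b.1 (T.disc b.2) (T.firstLanding b)))

open Classical in
/-- The set of all signed discontinuities in `𝒞₁` that are not contained in `X`. -/
noncomputable def outside (T : ITM r) : Finset (SDisc r) :=
  univ.filter fun b => T.EventuallyLands b ∧ ¬ T.SignedMemX b.1 (T.disc b.2)

/-! ### Coefficients and the independent subfamily -/

/-- Coefficients for the vectors `L_j`, `R_j^σ`, `C^σ(j,k)` of the interval `J_0`, the vectors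
`C^{i,σ}(k)` of the intervals `J_i` (with `i : Fin n`), and the vectors `C_b` of the
discontinuities outside `X`. -/
structure Coeffs (n r : ℕ) where
  aL : ℕ → ℝ
  aR : Side → ℕ → ℝ
  aC : Side → ℕ → ℕ → ℝ
  aP : Side → Fin n → ℕ → ℝ
  aX : SDisc r → ℝ

open Classical in
/-- The linear combination of all the vectors with the given coefficients. -/
noncomputable def lincomb {n : ℕ} (T : ITM r) (J₀ : HOInterval) (J : Fin n → HOInterval)
    (a : Coeffs n r) : W r :=
  (∑ i, ∑ k ∈ Icc 1 (T.perM (J i) .plus), a.aP .plus i k • T.perC (J i) .plus k)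
  + (∑ i, ∑ k ∈ Icc 1 (T.perM (J i) .minus), a.aP .minus i k • T.perC (J i) .minus k)
  + (∑ j ∈ range (T.branchCount J₀),
      ((∑ k ∈ Ico 1 (T.m J₀ .plus j), a.aC .plus j k • T.C J₀ .plus j k)
        + a.aR .plus j • T.R J₀ .plus j))
  + (∑ j ∈ Icc 1 (T.branchCount J₀),
      ((∑ k ∈ Ico 1 (T.m J₀ .minus j), a.aC .minus j k • T.C J₀ .minus j k)
        + a.aR .minus j • T.R J₀ .minus j))
  + (∑ j ∈ (range (T.branchCount J₀ + 1)).filter (fun j => T.Lands J₀ j), a.aL j • T.L J₀ j)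
  + ∑ b ∈ T.outside, a.aX b • T.genC b

/-- The coefficient of the vector that starts at the first discontinuity `β^{0,σ}(j,1)` on which
`a_j^σ` lands: it is `α^{0,σ}(j,1)`, the coefficient of `C^{0,σ}(j,1)`, if there are at least two
landings before the return, and the coefficient of `R_j^{0,σ}` if there is only one. -/
noncomputable def headCoeff {n : ℕ} (T : ITM r) (J₀ : HOInterval) (a : Coeffs n r)
    (σ : Side) (j : ℕ) : ℝ :=
  if 1 < T.m J₀ σ j then a.aC σ j 1 else a.aR σ j

/-- Index set of the independent subfamily: all `L_j`, `R_j⁺`, `C^±(j,k)` of `J₀`; for each `J_i`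
the vectors `C^{i,+}(k)` for `1 ≤ k ≤ m` and `C^{i,-}(k)` for `1 ≤ k < m`; and all `C_b`. -/
inductive SubIndex {n : ℕ} (T : ITM r) (J₀ : HOInterval) (J : Fin n → HOInterval) : Type
  | landing (j : ℕ) (hj : j ≤ T.branchCount J₀) (h : T.Lands J₀ j)
  | ret (j : ℕ) (hj : j < T.branchCount J₀)
  | connPlus (j k : ℕ) (hj : j < T.branchCount J₀) (hk : 1 ≤ k ∧ k < T.m J₀ .plus j)
  | connMinus (j k : ℕ) (hj : 1 ≤ j ∧ j ≤ T.branchCount J₀) (hk : 1 ≤ k ∧ k < T.m J₀ .minus j)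
  | perPlus (i : Fin n) (k : ℕ) (hk : 1 ≤ k ∧ k ≤ T.perM (J i) .plus)
  | perMinus (i : Fin n) (k : ℕ) (hk : 1 ≤ k ∧ k < T.perM (J i) .minus)
  | out (b : SDisc r) (hb : b ∈ T.outside)

/-- The vectors of the independent subfamily. -/
noncomputable def subfamily {n : ℕ} (T : ITM r) (J₀ : HOInterval) (J : Fin n → HOInterval) :
    SubIndex T J₀ J → W r
  | .landing j _ _ => T.L J₀ j
  | .ret j _ => T.R J₀ .plus j
  | .connPlus j k _ _ => T.C J₀ .plus j k
  | .connMinus j k _ _ => T.C J₀ .minus j k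
  | .perPlus i k _ => T.perC (J i) .plus k
  | .perMinus i k _ => T.perC (J i) .minus k
  | .out b _ => T.genC b

end ITM

/-! Each vector is the image under `toW` of a formal vector `(w, d)`: `w` puts weight on the signed
points visited, `d` on the signed discontinuities at the two ends. If a combination vanishes in `W
r`, its formal counterpart satisfies two kinds of relations: `w` has total weight zero on every
piece `I_s`, and the `d`-weights at `β⁺` and `β⁻` cancel for every discontinuity `β`. Moreover `w -
T_* w - d` (`sources`) telescopes along orbit segments, so that only sources and sinks inside the
given intervals survive. The structure `Flow` records this.

Let `φ = cum` be the step function whose jumps are the weights of `w`. The zero totals on the pieces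
turn the balance into a transfer equation: outside the given intervals `φ(y)` is the sum of `φ` over
the preimages of `y` (`Flow.cum_eq_sum`), as for a signed invariant density. Following preimages
backwards, `φ` is supported in `X` (`Flow.signedMemX_of_cum_ne_zero`). On signed points of `X` the
map is injective, because an overlap would cost a fixed amount of length at each iteration
(`SignedMemX.step_inj`). So the sum has a single relevant term, and `φ` is constant along the orbit
of a signed point of `X` as long as it avoids the given intervals (`Flow.cum_orbit`).

At a signed discontinuity `φ(β^±)` equals `±w(β^±)` (`Flow.cum_disc`), and this weight is the
coefficient of the unique vector that starts at `β^±`. Hence all coefficients along one orbit agree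
up to the sign of the side. Outside `X` both `φ` and the coefficient are zero. Between consecutive
branch points there is no weight, which links `a_j⁺` with `a_{j+1}⁻`. The jump of `φ` at `a_j` gives
the coefficient of `L_j`; if `a_j` is itself a discontinuity, the cancellation of `d` gives it
instead.

The indexing needs two facts on the dynamics: every signed point of a component interval returns
(`IsComponent.returnTime_pos`), and the return to a periodic interval is the identity
(`IsPeriodicInterval.isPeriodicPt`). For independence, the omitted vectors have coefficient zero,
which forces `φ` to vanish at all the germs that determine the other coefficients. -/

namespace ITM
variable {r : ℕ}

/-! ### Signed points, pieces and germs -/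

/-- The signed points of `[0,1) = [0⁺, 1⁻]`. -/
def Valid : Side → ℝ → Prop
  | .plus, x => 0 ≤ x ∧ x < 1
  | .minus, x => 0 < x ∧ x ≤ 1

/-- The representative of length `ε` of the germ `x^σ`. -/
def germ : Side → ℝ → ℝ → Set ℝ
  | .plus, x, ε => Set.Ico x (x + ε)
  | .minus, x, ε => Set.Ico (x - ε) x

lemma signedMemX_iff (T : ITM r) (σ : Side) (x : ℝ) :
    T.SignedMemX σ x ↔ ∃ ε > 0, germ σ x ε ⊆ T.attractor := by
  cases σ <;> rfl

lemma germ_mono (σ : Side) (x : ℝ) {ε δ : ℝ} (h : ε ≤ δ) : germ σ x ε ⊆ germ σ x δ := by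
  cases σ
  · exact Set.Ico_subset_Ico le_rfl (by linarith)
  · exact Set.Ico_subset_Ico (by linarith) le_rfl

lemma add_mem_germ {σ : Side} {x y ε : ℝ} (c : ℝ) :
    y + c ∈ germ σ (x + c) ε ↔ y ∈ germ σ x ε := by
  cases σ <;> simp only [germ, Set.mem_Ico] <;> constructor <;> rintro ⟨h₁, h₂⟩ <;>
    constructor <;> linarith

lemma germ_nonempty (σ : Side) (x : ℝ) {ε : ℝ} (h : 0 < ε) : (germ σ x ε).Nonempty := by
  cases σ
  · exact ⟨x, le_rfl, by linarith⟩
  · exact ⟨x - ε, le_rfl, by linarith⟩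

lemma measurableSet_germ (σ : Side) (x ε : ℝ) : MeasurableSet (germ σ x ε) := by
  cases σ <;> exact measurableSet_Ico

lemma volume_germ (σ : Side) (x ε : ℝ) : MeasureTheory.volume (germ σ x ε) = ENNReal.ofReal ε := by
  cases σ <;> simp [germ]

lemma disjoint_germ {σ : Side} {x y ε : ℝ} (h : ε ≤ |x - y|) :
    Disjoint (germ σ x ε) (germ σ y ε) := by
  rw [Set.disjoint_left]
  intro z hz hz'
  cases σ <;> simp only [germ, Set.mem_Ico] at hz hz' <;>
    rcases abs_cases (x - y) with ⟨h', _⟩ | ⟨h', _⟩ <;> linarith [hz.1, hz.2, hz'.1, hz'.2]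

lemma Valid.germ {σ : Side} {x : ℝ} (h : Valid σ x) :
    ∃ ε > 0, ITM.germ σ x ε ⊆ Set.Ico 0 1 := by
  cases σ
  · exact ⟨1 - x, by linarith [h.2], Set.Ico_subset_Ico h.1 (by linarith)⟩
  · exact ⟨x, h.1, Set.Ico_subset_Ico (by linarith) h.2⟩

lemma Valid.of_germ {σ : Side} {x ε : ℝ} (hε : 0 < ε) (h : ITM.germ σ x ε ⊆ Set.Ico 0 1) :
    Valid σ x := by
  cases σ
  · exact h ⟨le_rfl, by linarith⟩
  · have h₁ := h (show x - ε ∈ _ from ⟨le_rfl, by linarith⟩)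
    refine ⟨by linarith [h₁.1], ?_⟩
    by_contra! hx
    -- If `x > 1`, the germ contains `max 1 (x - ε)`, which is at least `1`.
    have := h (show max 1 (x - ε) ∈ _ from ⟨le_max_right _ _, max_lt hx (by linarith)⟩)
    exact absurd this.2 (not_lt.2 (le_max_left _ _))

lemma exists_inPiece (T : ITM r) {σ : Side} {x : ℝ} (h : Valid σ x) : ∃ s, T.InPiece σ s x := by
  by_contra! hc
  cases σ
  -- If no piece contained the point, induction would place every breakpoint, including the last one
  -- `1`, to its left.
  · have : ∀ i, T.β i ≤ x := by
      intro i
      induction i using Fin.induction with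
      | zero => rw [T.β_zero]; exact h.1
      | succ i ih =>
        by_contra! hi
        exact hc i ⟨ih, hi⟩
    have := this (Fin.last r)
    rw [T.β_last] at this
    exact absurd h.2 (not_lt.2 this)
  · have : ∀ i, T.β i < x := by
      intro i
      induction i using Fin.induction with
      | zero => rw [T.β_zero]; exact h.1
      | succ i ih =>
        by_contra! hi
        exact hc i ⟨ih, hi⟩
    have := this (Fin.last r)
    rw [T.β_last] at this
    exact absurd h.2 (not_le.2 this)

lemma β_succ_le (T : ITM r) {s s' : Fin r} (h : s < s') : T.β s.succ ≤ T.β s'.castSucc :=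
  T.strictMono.monotone (by rw [Fin.le_def]; simpa using h)

lemma inPiece_unique (T : ITM r) {σ : Side} {x : ℝ} {s s' : Fin r} (h : T.InPiece σ s x)
    (h' : T.InPiece σ s' x) : s = s' := by
  rcases lt_trichotomy s s' with hs | hs | hs
  · have := T.β_succ_le hs
    cases σ <;> linarith [h.1, h.2, h'.1, h'.2]
  · exact hs
  · have := T.β_succ_le hs
    cases σ <;> linarith [h.1, h.2, h'.1, h'.2]

lemma β_nonneg (T : ITM r) (i : Fin (r + 1)) : 0 ≤ T.β i := by
  rw [← T.β_zero]; exact T.strictMono.monotone (Fin.zero_le _)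

lemma β_le_one (T : ITM r) (i : Fin (r + 1)) : T.β i ≤ 1 := by
  rw [← T.β_last]; exact T.strictMono.monotone (Fin.le_last _)

lemma InPiece.valid {T : ITM r} {σ : Side} {s : Fin r} {x : ℝ} (h : T.InPiece σ s x) :
    Valid σ x := by
  have h₀ := T.β_nonneg s.castSucc
  have h₁ := T.β_le_one s.succ
  cases σ
  · exact ⟨by linarith [h.1], by linarith [h.2]⟩
  · exact ⟨by linarith [h.1], by linarith [h.2]⟩

lemma InPiece.step_eq {T : ITM r} {σ : Side} {s : Fin r} {x : ℝ} (h : T.InPiece σ s x) :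
    T.step σ x = x + T.γ s := by
  classical
  unfold step
  rw [Finset.sum_eq_single s]
  · rw [if_pos h]
  · intro s' _ hs'
    exact if_neg fun h' => hs' (T.inPiece_unique h' h)
  · simp

lemma InPiece.valid_add {T : ITM r} {σ : Side} {s : Fin r} {x : ℝ} (h : T.InPiece σ s x) :
    Valid σ (x + T.γ s) := by
  have h₀ := T.nonneg s
  have h₁ := T.le_one s
  cases σ
  · exact ⟨by linarith [h.1], by linarith [h.2]⟩
  · exact ⟨by linarith [h.1], by linarith [h.2]⟩

lemma Valid.step (T : ITM r) {σ : Side} {x : ℝ} (h : Valid σ x) : Valid σ (T.step σ x) := by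
  obtain ⟨s, hs⟩ := T.exists_inPiece h
  rw [hs.step_eq]
  exact hs.valid_add

lemma orbit_zero (T : ITM r) (σ : Side) (x : ℝ) : T.orbit σ x 0 = x := rfl

lemma orbit_succ (T : ITM r) (σ : Side) (x : ℝ) (n : ℕ) :
    T.orbit σ x (n + 1) = T.step σ (T.orbit σ x n) :=
  Function.iterate_succ_apply' _ _ _

lemma orbit_add (T : ITM r) (σ : Side) (x : ℝ) (m n : ℕ) :
    T.orbit σ x (m + n) = T.orbit σ (T.orbit σ x m) n := by
  unfold orbit
  rw [add_comm, Function.iterate_add_apply]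

lemma Valid.orbit (T : ITM r) {σ : Side} {x : ℝ} (h : Valid σ x) (n : ℕ) :
    Valid σ (T.orbit σ x n) := by
  induction n with
  | zero => exact h
  | succ n ih => rw [orbit_succ]; exact ih.step T

lemma InPiece.germ {T : ITM r} {σ : Side} {s : Fin r} {x : ℝ} (h : T.InPiece σ s x) :
    ∃ ε > 0, ∀ y ∈ ITM.germ σ x ε, T.InPiece .plus s y := by
  cases σ
  · refine ⟨T.β s.succ - x, by linarith [h.2], fun y hy => ?_⟩
    exact ⟨h.1.trans hy.1, by linarith [hy.2]⟩
  · refine ⟨x - T.β s.castSucc, by linarith [h.1], fun y hy => ?_⟩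
    exact ⟨by linarith [hy.1], hy.2.trans_le h.2⟩

/-- On a small germ, the first `n` iterates are translations with the itinerary of the signed
point. -/
lemma germ_orbit (T : ITM r) {σ : Side} {x : ℝ} (h : Valid σ x) (n : ℕ) :
    ∃ ε > 0, ∀ y ∈ germ σ x ε, ∀ t ≤ n,
      T.orbit .plus y t = y + (T.orbit σ x t - x) ∧
      ∀ s, T.InPiece .plus s (T.orbit .plus y t) ↔ T.InPiece σ s (T.orbit σ x t) := by
  induction n with
  | zero =>
    obtain ⟨s, hs⟩ := T.exists_inPiece h
    obtain ⟨ε, hε, H⟩ := hs.germ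
    refine ⟨ε, hε, fun y hy t ht => ?_⟩
    obtain rfl : t = 0 := by omega
    refine ⟨by simp [orbit_zero], fun s' => ?_⟩
    constructor
    · intro h'
      rw [T.inPiece_unique h' (H y hy)]; exact hs
    · intro h'
      rw [T.inPiece_unique h' hs]; exact H y hy
  | succ n ih =>
    obtain ⟨ε, hε, H⟩ := ih
    obtain ⟨s₀, hs₀⟩ := T.exists_inPiece (h.orbit T n)
    obtain ⟨s, hs⟩ := T.exists_inPiece (h.orbit T (n + 1))
    obtain ⟨ε', hε', H'⟩ := hs.germ
    refine ⟨min ε ε', lt_min hε hε', fun y hy t ht => ?_⟩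
    have hy₁ := germ_mono σ x (min_le_left ε ε') hy
    have hy₂ := germ_mono σ x (min_le_right ε ε') hy
    rcases ht.lt_or_eq with ht | rfl
    · exact H y hy₁ t (by omega)
    · obtain ⟨h₁, h₂⟩ := H y hy₁ n le_rfl
      have h₃ : T.orbit .plus y (n + 1) = y + (T.orbit σ x (n + 1) - x) := by
        rw [orbit_succ, ((h₂ s₀).2 hs₀).step_eq, orbit_succ, hs₀.step_eq, h₁]; ring
      have h₄ : T.InPiece .plus s (T.orbit .plus y (n + 1)) := by
        apply H'
        rw [h₃]
        have := (add_mem_germ (σ := σ) (x := x) (y := y) (ε := ε') (T.orbit σ x (n + 1) - x)).2 hy₂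
        rwa [add_sub_cancel] at this
      refine ⟨h₃, fun s' => ?_⟩
      constructor
      · intro h'
        rw [T.inPiece_unique h' h₄]; exact hs
      · intro h'
        rw [T.inPiece_unique h' hs]; exact h₄

/-! ### The attractor -/

lemma attractor_subset (T : ITM r) : T.attractor ⊆ Set.Ico 0 1 := by
  intro x hx
  have := Set.mem_iInter.1 hx 0
  simpa using this

lemma mapsTo_map (T : ITM r) : Set.MapsTo T.map (Set.Ico 0 1) (Set.Ico 0 1) :=
  fun _ hx => Valid.step (σ := .plus) T hx

lemma map_mem_attractor (T : ITM r) {x : ℝ} (h : x ∈ T.attractor) : T.map x ∈ T.attractor := by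
  refine Set.mem_iInter.2 fun n => ?_
  obtain ⟨z, hz, rfl⟩ := Set.mem_iInter.1 h n
  exact ⟨T.map z, T.mapsTo_map hz,
    (Function.iterate_succ_apply T.map n z).symm.trans
      (Function.iterate_succ_apply' T.map n z)⟩

lemma orbit_mem_attractor (T : ITM r) {x : ℝ} (h : x ∈ T.attractor) (n : ℕ) :
    T.orbit .plus x n ∈ T.attractor := by
  induction n with
  | zero => exact h
  | succ n ih => rw [orbit_succ]; exact T.map_mem_attractor ih

lemma SignedMemX.valid {T : ITM r} {σ : Side} {x : ℝ} (h : T.SignedMemX σ x) : Valid σ x := by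
  rw [signedMemX_iff] at h
  obtain ⟨ε, hε, h⟩ := h
  exact Valid.of_germ hε (h.trans T.attractor_subset)

/-- On a short germ the iterate is a translation, and it carries points of `X` into `X`. -/
lemma SignedMemX.orbit {T : ITM r} {σ : Side} {x : ℝ} (h : T.SignedMemX σ x) (n : ℕ) :
    T.SignedMemX σ (T.orbit σ x n) := by
  obtain ⟨ε, hε, H⟩ := T.germ_orbit h.valid n
  rw [signedMemX_iff] at h ⊢
  obtain ⟨ε', hε', H'⟩ := h
  refine ⟨min ε ε', lt_min hε hε', fun y hy => ?_⟩
  have hz : y - (T.orbit σ x n - x) ∈ germ σ x (min ε ε') := by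
    rw [← add_mem_germ (T.orbit σ x n - x)]; simpa using hy
  have := T.orbit_mem_attractor (H' (germ_mono σ x (min_le_right ε ε') hz)) n
  rw [(H _ (germ_mono σ x (min_le_left ε ε') hz) n le_rfl).1] at this
  simpa using this

lemma SignedMemX.step {T : ITM r} {σ : Side} {x : ℝ} (h : T.SignedMemX σ x) :
    T.SignedMemX σ (T.step σ x) := h.orbit 1

/-- Translations preserve length and the pieces are disjoint, so length can only be lost, through
overlapping images. -/
lemma volume_map_image_le (T : ITM r) {A : Set ℝ} (hA : A ⊆ Set.Ico 0 1) :
    MeasureTheory.volume (T.map '' A) ≤ MeasureTheory.volume A := by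
  have hI : ∀ s : Fin r, {x | T.InPiece .plus s x} = Set.Ico (T.β s.castSucc) (T.β s.succ) :=
    fun s => rfl
  have h₁ : T.map '' A ⊆ ⋃ s, (fun x => x + T.γ s) '' ({x | T.InPiece .plus s x} ∩ A) := by
    rintro _ ⟨x, hx, rfl⟩
    obtain ⟨s, hs⟩ := T.exists_inPiece (σ := .plus) (hA hx)
    exact Set.mem_iUnion.2 ⟨s, x, ⟨hs, hx⟩, hs.step_eq.symm⟩
  calc MeasureTheory.volume (T.map '' A)
      ≤ ∑ s, MeasureTheory.volume ((fun x => x + T.γ s) '' ({x | T.InPiece .plus s x} ∩ A)) :=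
        (MeasureTheory.measure_mono h₁).trans (MeasureTheory.measure_iUnion_fintype_le _ _)
    _ = ∑ s, MeasureTheory.volume.restrict A {x | T.InPiece .plus s x} := by
        refine Finset.sum_congr rfl fun s _ => ?_
        rw [MeasureTheory.Measure.restrict_apply (by rw [hI]; exact measurableSet_Ico)]
        rw [Set.image_add_right, MeasureTheory.measure_preimage_add_right]
    _ = MeasureTheory.volume.restrict A (⋃ s, {x | T.InPiece .plus s x}) := by
        rw [MeasureTheory.measure_iUnion, tsum_fintype]
        · intro s s' hs
          rw [Function.onFun, Set.disjoint_left]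
          intro x hx hx'
          exact hs (T.inPiece_unique (σ := .plus) (x := x) hx hx')
        · intro s
          rw [hI]; exact measurableSet_Ico
    _ ≤ MeasureTheory.volume A := by
        refine (MeasureTheory.measure_mono (Set.subset_univ _)).trans ?_
        simp

/-- `T` is injective on the signed points of the attractor. -/
lemma SignedMemX.step_inj {T : ITM r} {σ : Side} {x y : ℝ} (hx : T.SignedMemX σ x)
    (hy : T.SignedMemX σ y) (h : T.step σ x = T.step σ y) : x = y := by
  by_contra hne
  obtain ⟨ε₁, hε₁, H₁⟩ := T.germ_orbit hx.valid 1
  obtain ⟨ε₂, hε₂, H₂⟩ := T.germ_orbit hy.valid 1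
  rw [signedMemX_iff] at hx hy
  obtain ⟨ε₃, hε₃, H₃⟩ := hx
  obtain ⟨ε₄, hε₄, H₄⟩ := hy
  have hxy : 0 < |x - y| := abs_pos.2 (sub_ne_zero.2 hne)
  obtain ⟨ε, hε, h₁, h₂, h₃, h₄, h₅⟩ : ∃ ε > 0, ε ≤ ε₁ ∧ ε ≤ ε₂ ∧ ε ≤ ε₃ ∧ ε ≤ ε₄ ∧
      ε ≤ |x - y| := by
    refine ⟨min (min ε₁ ε₂) (min (min ε₃ ε₄) |x - y|), by positivity, ?_, ?_, ?_, ?_, ?_⟩ <;> simp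
  -- Both germs have the same image, so the one at `y` can be removed from a set containing both
  -- without changing the image of the set.
  have key : ∀ z ∈ germ σ y ε, ∃ w ∈ germ σ x ε, T.map w = T.map z := by
    intro z hz
    have hw : z + (x - y) ∈ germ σ x ε := by
      rw [← add_mem_germ (x - y)] at hz
      simpa using hz
    refine ⟨z + (x - y), hw, ?_⟩
    have e₁ := (H₁ _ (germ_mono _ _ h₁ hw) 1 le_rfl).1
    have e₂ := (H₂ _ (germ_mono _ _ h₂ hz) 1 le_rfl).1
    have e₃ : T.orbit σ x 1 = T.orbit σ y 1 := h
    change T.orbit .plus _ 1 = T.orbit .plus _ 1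
    rw [e₁, e₂, e₃]; ring
  set X : ℕ → Set ℝ := fun n => T.map^[n] '' Set.Ico 0 1 with hX
  have hXsub : ∀ n, X n ⊆ Set.Ico 0 1 := by
    rintro n _ ⟨z, hz, rfl⟩
    exact T.mapsTo_map.iterate n hz
  have hXfin : ∀ n, MeasureTheory.volume (X n) ≠ ⊤ := fun n =>
    ((MeasureTheory.measure_mono (hXsub n)).trans_lt (by simp)).ne
  -- Each iterate of `[0,1)` contains both germs and therefore loses length at least `ε` at the next
  -- step, while the initial length is only `1`.
  have hsucc : ∀ n, MeasureTheory.volume (X (n + 1)) + ENNReal.ofReal ε ≤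
      MeasureTheory.volume (X n) := by
    intro n
    have hV : germ σ y ε ⊆ X n := fun z hz => Set.mem_iInter.1 (H₄ (germ_mono _ _ h₄ hz)) n
    have hU : germ σ x ε ⊆ X n := fun z hz => Set.mem_iInter.1 (H₃ (germ_mono _ _ h₃ hz)) n
    have h₆ : X (n + 1) ⊆ T.map '' (X n \ germ σ y ε) := by
      rintro _ ⟨z, hz, rfl⟩
      rw [Function.iterate_succ_apply']
      by_cases hz' : T.map^[n] z ∈ germ σ y ε
      · obtain ⟨w, hw, hw'⟩ := key _ hz'
        exact ⟨w, ⟨hU hw, fun hw'' => Set.disjoint_left.1 (disjoint_germ h₅) hw hw''⟩, hw'⟩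
      · exact ⟨_, ⟨⟨z, hz, rfl⟩, hz'⟩, rfl⟩
    have h₇ := (MeasureTheory.measure_mono h₆).trans
      (T.volume_map_image_le (Set.sdiff_subset.trans (hXsub n)))
    calc _ ≤ MeasureTheory.volume (X n \ germ σ y ε) + MeasureTheory.volume (germ σ y ε) := by
          rw [volume_germ]; gcongr
      _ = MeasureTheory.volume (X n) :=
          by
            rw [add_comm]
            conv_rhs => rw [← MeasureTheory.measure_inter_add_sdiff (X n) (measurableSet_germ σ y ε),
              Set.inter_eq_right.2 hV]
  have hn : ∀ n : ℕ, (n : ENNReal) * ENNReal.ofReal ε + MeasureTheory.volume (X n) ≤ 1 := by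
    intro n
    induction n with
    | zero => simp [hX]
    | succ n ih =>
      refine le_trans ?_ ih
      push_cast
      rw [add_mul, one_mul, add_assoc]
      gcongr
      rw [add_comm]; exact hsucc n
  obtain ⟨n, hn'⟩ := exists_nat_gt (1 / ε)
  have := (self_le_add_right _ _).trans (hn n)
  rw [← ENNReal.ofReal_natCast, ← ENNReal.ofReal_mul (by positivity), ← ENNReal.ofReal_one,
    ENNReal.ofReal_le_ofReal_iff zero_le_one] at this
  rw [div_lt_iff₀ hε] at hn'
  linarith

/-- The common `s` steps are cancelled one at a time by `SignedMemX.step_inj`. -/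
lemma SignedMemX.orbit_inj {T : ITM r} {σ : Side} {x y : ℝ} (hx : T.SignedMemX σ x)
    (hy : T.SignedMemX σ y) {s t : ℕ} (hst : s ≤ t) (h : T.orbit σ x s = T.orbit σ y t) :
    x = T.orbit σ y (t - s) := by
  induction s generalizing t with
  | zero => exact h
  | succ s ih =>
    obtain ⟨t, rfl⟩ : ∃ t', t = t' + 1 := ⟨t - 1, by omega⟩
    rw [orbit_succ, orbit_succ] at h
    have := ih (t := t) (by omega) ((hx.orbit s).step_inj (hy.orbit t) h)
    rw [this]; congr 1; omega

/-! ### Weights on signed points -/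

/-- Signed points. -/
abbrev SP : Type := Side × ℝ

/-- `T` as a map of signed points. -/
noncomputable def stepP (T : ITM r) (q : SP) : SP := (q.1, T.step q.1 q.2)

open Classical in
/-- The total weight of the signed points with the property `P`. -/
noncomputable def massOn (P : SP → Prop) : (SP →₀ ℝ) →ₗ[ℝ] ℝ :=
  Finsupp.linearCombination ℝ fun q => if P q then (1 : ℝ) else 0

open Classical in
lemma massOn_apply (P : SP → Prop) (w : SP →₀ ℝ) :
    massOn P w = ∑ q ∈ w.support, if P q then w q else 0 := by
  simp [massOn, Finsupp.linearCombination_apply, Finsupp.sum]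

open Classical in
lemma massOn_single (P : SP → Prop) (q : SP) (c : ℝ) :
    massOn P (Finsupp.single q c) = if P q then c else 0 := by
  simp [massOn]

lemma massOn_congr {P Q : SP → Prop} {w : SP →₀ ℝ} (h : ∀ q, w q ≠ 0 → (P q ↔ Q q)) :
    massOn P w = massOn Q w := by
  classical
  rw [massOn_apply, massOn_apply]
  refine Finset.sum_congr rfl fun q hq => ?_
  rw [Finsupp.mem_support_iff] at hq
  simp [h q hq]

lemma massOn_eq_zero {P : SP → Prop} {w : SP →₀ ℝ} (h : ∀ q, P q → w q = 0) :
    massOn P w = 0 := by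
  classical
  rw [massOn_apply]
  refine Finset.sum_eq_zero fun q _ => ?_
  split_ifs with hq
  · exact h q hq
  · rfl

lemma massOn_eq_apply {P : SP → Prop} {w : SP →₀ ℝ} {q₀ : SP} (h₀ : P q₀)
    (h : ∀ q, P q → w q ≠ 0 → q = q₀) : massOn P w = w q₀ := by
  classical
  rw [massOn_apply, Finset.sum_eq_single q₀]
  · rw [if_pos h₀]
  · intro q hq hne
    rw [Finsupp.mem_support_iff] at hq
    exact if_neg fun hP => hne (h q hP hq)
  · intro hq
    rw [Finsupp.notMem_support_iff] at hq
    rw [if_pos h₀, hq]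

lemma massOn_split (P Q : SP → Prop) (w : SP →₀ ℝ) :
    massOn P w = massOn (fun q => P q ∧ Q q) w + massOn (fun q => P q ∧ ¬ Q q) w := by
  classical
  simp only [massOn_apply, ← Finset.sum_add_distrib]
  refine Finset.sum_congr rfl fun q _ => ?_
  by_cases hP : P q <;> by_cases hQ : Q q <;> simp [hP, hQ]

/-- Additivity over a partition; it is applied to the pieces and to the discontinuities. -/
lemma massOn_sum_fintype {ι : Type*} [Fintype ι] (P : SP → Prop) (Q : ι → SP → Prop)
    {w : SP →₀ ℝ} (h : ∀ q, w q ≠ 0 → P q → ∃ i, ∀ j, Q j q ↔ j = i) :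
    massOn P w = ∑ i, massOn (fun q => P q ∧ Q i q) w := by
  classical
  simp only [massOn_apply]
  rw [Finset.sum_comm]
  refine Finset.sum_congr rfl fun q hq => ?_
  rw [Finsupp.mem_support_iff] at hq
  by_cases hP : P q
  · obtain ⟨i, hi⟩ := h q hq hP
    simp [hP, hi]
  · simp [hP]

lemma massOn_mapDomain (P : SP → Prop) (f : SP → SP) (w : SP →₀ ℝ) :
    massOn P (Finsupp.mapDomain f w) = massOn (fun q => P (f q)) w := by
  classical
  rw [massOn, Finsupp.linearCombination_mapDomain]
  rfl

/-- `q^±` lies to the left of the germ `y^σ`. -/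
def Below : Side → ℝ → ℝ → Prop
  | .plus, y, x => x ≤ y
  | .minus, y, x => x < y

/-- The value at the germ `y^σ` of the step function whose jumps are given by the weights. -/
noncomputable def cum (σ : Side) (y : ℝ) : (SP →₀ ℝ) →ₗ[ℝ] ℝ := massOn fun q => Below σ y q.2

lemma below_add {σ : Side} {x y c : ℝ} : Below σ y (x + c) ↔ Below σ (y - c) x := by
  cases σ <;> simp only [Below]
  · exact le_sub_iff_add_le.symm
  · exact lt_sub_iff_add_lt.symm

/-- The weights `w` of signed points and `d` of discontinuities satisfy the relations that come
from a vanishing linear combination; the sources and sinks lie in `U`. -/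
structure Flow (T : ITM r) (U : Set SP) (w d : SP →₀ ℝ) : Prop where
  valid : ∀ q, w q ≠ 0 → Valid q.1 q.2
  mass : ∀ s, massOn (fun q => T.InPiece q.1 s q.2) w = 0
  disc : ∀ q, d q ≠ 0 → T.IsDisc q.2
  cons : ∀ i, massOn (fun q => T.disc i = q.2) d = 0
  bal : ∀ σ y, (σ, y) ∉ U → cum σ y (w - Finsupp.mapDomain T.stepP w - d) = 0
  attr : ∀ y, ((.plus, y) : SP) ∈ U → y ∈ T.attractor

variable {T : ITM r} {U : Set SP} {w d : SP →₀ ℝ}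

lemma disc_injective (T : ITM r) : Injective T.disc := by
  intro i j h
  have := T.strictMono.injective h
  simp only [Fin.mk.injEq, add_left_inj] at this
  exact Fin.ext this

/-- `P` only sees the underlying point, and at each discontinuity the weights of the two sides
cancel. Thus `d` contributes nothing to the step function. -/
lemma cum_eq_zero_of_disc (hd : ∀ q, d q ≠ 0 → T.IsDisc q.2)
    (hc : ∀ i, massOn (fun q => T.disc i = q.2) d = 0) (P : ℝ → Prop) :
    massOn (fun q => P q.2) d = 0 := by
  rw [massOn_sum_fintype (Q := fun i q => T.disc i = q.2)]
  · refine Finset.sum_eq_zero fun i _ => ?_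
    by_cases hP : P (T.disc i)
    · rw [← hc i]
      refine massOn_congr fun q _ => ⟨fun h => h.2, fun h => ⟨h ▸ hP, h⟩⟩
    · refine massOn_eq_zero fun q hq => ?_
      rw [hq.2] at hP
      exact absurd hq.1 hP
  · intro q hq _
    obtain ⟨i, hi⟩ := hd q hq
    exact ⟨i, fun j => by rw [← hi]; exact (T.disc_injective).eq_iff⟩

lemma piece_cases (T : ITM r) {q : SP} (h : Valid q.1 q.2) :
    ∃ i, ∀ j, T.InPiece q.1 j q.2 ↔ j = i := by
  obtain ⟨i, hi⟩ := T.exists_inPiece h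
  exact ⟨i, fun j => ⟨fun hj => T.inPiece_unique hj hi, fun hj => hj ▸ hi⟩⟩

lemma InPiece.le_right {σ : Side} {s : Fin r} {x : ℝ} (h : T.InPiece σ s x) : x ≤ T.β s.succ := by
  cases σ
  · exact h.2.le
  · exact h.2

lemma InPiece.left_le {σ : Side} {s : Fin r} {x : ℝ} (h : T.InPiece σ s x) :
    T.β s.castSucc ≤ x := by
  cases σ
  · exact h.1
  · exact h.1.le

lemma below_of_right_le {σ : Side} {s : Fin r} {x y : ℝ} (hx : x ≤ T.β s.castSucc)
    (hy : T.InPiece σ s y) : Below σ y x := by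
  cases σ
  · exact hx.trans hy.1
  · exact hx.trans_lt hy.1

lemma not_below_of_le_left {σ : Side} {s : Fin r} {x y : ℝ} (hx : T.β s.succ ≤ x)
    (hy : T.InPiece σ s y) : ¬ Below σ y x := by
  cases σ
  · exact not_le.2 (hy.2.trans_le hx)
  · exact not_lt.2 (hy.2.trans hx)

/-! ### The transfer equation and the support of the step function. -/

namespace Flow

/-- Pieces to the left of `x` are counted entirely and have total weight zero, pieces to the right
are not counted at all. -/
lemma cum_eq_piece (h : Flow T U w d) {σ : Side} {s : Fin r} {x : ℝ} (hx : T.InPiece σ s x) :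
    cum σ x w = massOn (fun q => Below σ x q.2 ∧ T.InPiece q.1 s q.2) w := by
  rw [cum, massOn_sum_fintype (Q := fun s q => T.InPiece q.1 s q.2),
    Finset.sum_eq_single s]
  · intro s' _ hs'
    rcases lt_or_gt_of_ne hs' with hlt | hlt
    · rw [← h.mass s']
      refine massOn_congr fun q _ => ⟨fun h => h.2, fun hq => ⟨?_, hq⟩⟩
      exact below_of_right_le (hq.le_right.trans (T.β_succ_le hlt)) hx
    · refine massOn_eq_zero fun q hq => ?_
      exact absurd hq.1 (not_below_of_le_left ((T.β_succ_le hlt).trans hq.2.left_le) hx)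
  · simp
  · exact fun q hq _ => T.piece_cases (h.valid q hq)

-- The weights of the piece `s` are pushed forward by the translation `γ s`. If `y - γ s` lies
-- outside the piece, the piece is counted as a whole or not at all, and both give zero.
open Classical in
lemma sum_cum (h : Flow T U w d) (σ : Side) (y : ℝ) :
    ∑ s, (if T.InPiece σ s (y - T.γ s) then cum σ (y - T.γ s) w else 0) =
      cum σ y (Finsupp.mapDomain T.stepP w) := by
  rw [cum, massOn_mapDomain, massOn_sum_fintype (Q := fun s q => T.InPiece q.1 s q.2)]
  · refine Finset.sum_congr rfl fun s _ => ?_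
    have e : massOn (fun q => Below σ y (T.stepP q).2 ∧ T.InPiece q.1 s q.2) w =
        massOn (fun q => Below σ (y - T.γ s) q.2 ∧ T.InPiece q.1 s q.2) w := by
      refine massOn_congr fun q _ => and_congr_left fun hq => ?_
      rw [← below_add, stepP, hq.step_eq]
    rw [e]
    split_ifs with hs
    · exact h.cum_eq_piece hs
    · have : T.β s.castSucc < T.β s.succ := T.strictMono Fin.castSucc_lt_succ
      set z := y - T.γ s
      rcases le_or_gt z (T.β s.castSucc) with h₁ | h₁
      · refine (massOn_eq_zero fun q hq => ?_).symm
        exfalso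
        obtain ⟨hq, hq'⟩ := hq
        have hl := hq'.left_le
        cases σ
        · have h₂ : q.2 ≤ z := hq
          exact hs ⟨by linarith, by linarith⟩
        · have h₂ : q.2 < z := hq
          linarith
      · rw [← h.mass s]
        refine massOn_congr fun q _ => ⟨fun hq => ⟨?_, hq⟩, fun hq => hq.2⟩
        have hl := hq.le_right
        cases σ
        · have : T.β s.succ ≤ z := by
            by_contra! h₂
            exact hs ⟨h₁.le, h₂⟩
          exact hl.trans this
        · have : T.β s.succ < z := by
            by_contra! h₂
            exact hs ⟨h₁, h₂⟩
          exact hl.trans_lt this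
  · exact fun q hq _ => T.piece_cases (h.valid q hq)

-- Off `U` the sources contribute nothing to the left of `y`, and neither does `d`; so `w` and its
-- push-forward have the same step function there.
open Classical in
lemma cum_eq_sum (h : Flow T U w d) {σ : Side} {y : ℝ} (hy : (σ, y) ∉ U) :
    cum σ y w = ∑ s, (if T.InPiece σ s (y - T.γ s) then cum σ (y - T.γ s) w else 0) := by
  have h₁ := h.bal σ y hy
  have h₂ : cum σ y d = 0 := cum_eq_zero_of_disc h.disc h.cons (Below σ y)
  rw [map_sub, map_sub, h₂, sub_zero, sub_eq_zero] at h₁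
  rw [h₁, h.sum_cum]

/-- The left end is the only signed point of its piece that is counted. -/
lemma cum_left (h : Flow T U w d) (s : Fin r) :
    cum .plus (T.β s.castSucc) w = w (.plus, T.β s.castSucc) := by
  have hs : T.β s.castSucc < T.β s.succ := T.strictMono Fin.castSucc_lt_succ
  have hP : T.InPiece .plus s (T.β s.castSucc) := ⟨le_rfl, hs⟩
  rw [h.cum_eq_piece hP]
  refine massOn_eq_apply ⟨le_rfl, hP⟩ ?_
  rintro ⟨σ, x⟩ ⟨h₁, h₂⟩ _
  have h₁ : x ≤ T.β s.castSucc := h₁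
  cases σ
  · exact Prod.ext rfl (le_antisymm h₁ h₂.1)
  · exact absurd h₂.1 (not_lt.2 h₁)

/-- Every signed point of the piece other than its right end is counted, and the piece has total
weight zero; hence the minus sign. -/
lemma cum_right (h : Flow T U w d) (s : Fin r) :
    cum .minus (T.β s.succ) w = - w (.minus, T.β s.succ) := by
  have hs : T.β s.castSucc < T.β s.succ := T.strictMono Fin.castSucc_lt_succ
  have hP : T.InPiece .minus s (T.β s.succ) := ⟨hs, le_rfl⟩
  have h₀ := h.mass s
  rw [massOn_split _ (fun q => Below .minus (T.β s.succ) q.2)] at h₀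
  rw [h.cum_eq_piece hP, eq_neg_iff_add_eq_zero]
  refine Eq.trans ?_ h₀
  congr 1
  · exact massOn_congr fun q _ => and_comm
  · refine (massOn_eq_apply ⟨hP, lt_irrefl _⟩ ?_).symm
    rintro ⟨σ, x⟩ ⟨h₁, h₂⟩ _
    have h₃ : T.β s.succ ≤ x := not_lt.1 h₂
    cases σ
    · exact absurd h₁.2 (not_lt.2 h₃)
    · exact Prod.ext rfl (le_antisymm h₁.2 h₃)

lemma valid_of_cum_ne_zero (h : Flow T U w d) {y : ℝ} (hy : cum .plus y w ≠ 0) :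
    y ∈ Set.Ico (0 : ℝ) 1 := by
  constructor
  · by_contra! hlt
    refine hy (massOn_eq_zero fun q hq => ?_)
    by_contra hne
    have := h.valid q hne
    have hq : q.2 ≤ y := hq
    rcases q with ⟨_ | _, x⟩ <;> linarith [this.1]
  · by_contra! hlt
    refine hy ?_
    have : cum .plus y w = massOn (fun _ => True) w := by
      refine massOn_congr fun q hq => ⟨fun _ => trivial, fun _ => ?_⟩
      have := h.valid q hq
      change q.2 ≤ y
      rcases q with ⟨_ | _, x⟩
      · exact this.2.le.trans hlt
      · exact this.2.trans hlt
    rw [this, massOn_sum_fintype (Q := fun s q => T.InPiece q.1 s q.2)]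
    · refine Finset.sum_eq_zero fun s _ => ?_
      rw [← h.mass s]
      exact massOn_congr fun q _ => (true_and _).to_iff
    · exact fun q hq _ => T.piece_cases (h.valid q hq)

/-- A nonzero value forces a nonzero term in the transfer equation, that is, a preimage with nonzero
value; iterating backwards produces preimages of every order. The iteration may stop in `U`, which
lies in the attractor. -/
lemma mem_attractor_of_cum_ne_zero (h : Flow T U w d) {y : ℝ} (hy : cum .plus y w ≠ 0) :
    y ∈ T.attractor := by
  classical
  refine Set.mem_iInter.2 fun n => ?_
  induction n generalizing y with
  | zero => simpa using h.valid_of_cum_ne_zero hy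
  | succ n ih =>
    by_cases hU : ((.plus, y) : SP) ∈ U
    · exact Set.mem_iInter.1 (h.attr y hU) _
    · rw [h.cum_eq_sum hU] at hy
      obtain ⟨s, _, hs⟩ := Finset.exists_ne_zero_of_sum_ne_zero hy
      split_ifs at hs with hP
      · obtain ⟨z, hz, hz'⟩ := ih hs
        refine ⟨z, hz, ?_⟩
        rw [Function.iterate_succ_apply', hz', map, hP.step_eq]
        ring
      · exact absurd rfl hs

end Flow

/-- The step function given by the weights is constant on germs. -/
lemma cum_germ (w : SP →₀ ℝ) (σ : Side) (x : ℝ) :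
    ∃ ε > 0, ∀ y ∈ germ σ x ε, cum .plus y w = cum σ x w := by
  classical
  -- `ε` is chosen below the distance from `x` to every other point that carries weight.
  have hfin : ∃ ε > 0, ∀ q ∈ w.support, q.2 = x ∨ ε < |q.2 - x| := by
    induction w.support using Finset.induction_on with
    | empty => exact ⟨1, one_pos, by simp⟩
    | insert q S _ ih =>
      obtain ⟨ε, hε, H⟩ := ih
      by_cases hq : q.2 = x
      · refine ⟨ε, hε, fun q' hq' => ?_⟩
        rcases Finset.mem_insert.1 hq' with rfl | hq'
        · exact Or.inl hq
        · exact H q' hq'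
      · have hpos : 0 < |q.2 - x| := abs_pos.2 (sub_ne_zero.2 hq)
        refine ⟨min ε (|q.2 - x| / 2), by positivity, fun q' hq' => ?_⟩
        rcases Finset.mem_insert.1 hq' with rfl | hq'
        · exact Or.inr ((min_le_right _ _).trans_lt (by linarith))
        · exact (H q' hq').imp_right fun h => (min_le_left _ _).trans_lt h
  obtain ⟨ε, hε, H⟩ := hfin
  refine ⟨ε, hε, fun y hy => massOn_congr fun q hq => ?_⟩
  have := H q (Finsupp.mem_support_iff.2 hq)
  cases σ
  · change q.2 ≤ y ↔ q.2 ≤ x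
    have h₁ : x ≤ y := hy.1
    have h₂ : y < x + ε := hy.2
    refine ⟨fun h => ?_, fun h => h.trans h₁⟩
    by_contra! hlt
    rcases this with h | h
    · linarith
    · rw [abs_of_pos (by linarith)] at h; linarith
  · change q.2 ≤ y ↔ q.2 < x
    have h₁ : x - ε ≤ y := hy.1
    have h₂ : y < x := hy.2
    refine ⟨fun h => h.trans_lt h₂, fun h => ?_⟩
    by_contra! hlt
    rcases this with h' | h'
    · linarith
    · rw [abs_of_neg (by linarith)] at h'; linarith

lemma Flow.signedMemX_of_cum_ne_zero (h : Flow T U w d) {σ : Side} {x : ℝ}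
    (hx : cum σ x w ≠ 0) : T.SignedMemX σ x := by
  rw [signedMemX_iff]
  obtain ⟨ε, hε, H⟩ := cum_germ w σ x
  refine ⟨ε, hε, fun y hy => h.mem_attractor_of_cum_ne_zero ?_⟩
  rwa [H y hy]

/-- Another preimage with nonzero value would be a signed point of `X` with the same image as `x^σ`,
against injectivity. So the transfer sum reduces to the term of `x^σ`. -/
lemma Flow.cum_step (h : Flow T U w d) {σ : Side} {x : ℝ} (hx : T.SignedMemX σ x)
    (hU : (σ, T.step σ x) ∉ U) : cum σ (T.step σ x) w = cum σ x w := by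
  classical
  obtain ⟨s, hs⟩ := T.exists_inPiece hx.valid
  rw [h.cum_eq_sum hU, Finset.sum_eq_single s]
  · have : T.step σ x - T.γ s = x := by rw [hs.step_eq]; ring
    rw [this, if_pos hs]
  · intro s' _ hs'
    split_ifs with hP
    · by_contra hne
      have := h.signedMemX_of_cum_ne_zero hne
      have e : T.step σ (T.step σ x - T.γ s') = T.step σ x := by
        rw [hP.step_eq]; ring
      have e' := this.step_inj hx e
      rw [e'] at hP
      exact hs' (T.inPiece_unique hP hs)
    · rfl
  · simp

lemma Flow.cum_orbit (h : Flow T U w d) {σ : Side} {x : ℝ} (hx : T.SignedMemX σ x) (n : ℕ)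
    (hU : ∀ t, 0 < t → t ≤ n → (σ, T.orbit σ x t) ∉ U) : cum σ (T.orbit σ x n) w = cum σ x w := by
  induction n with
  | zero => rfl
  | succ n ih =>
    have h₁ := hU (n + 1) (by omega) le_rfl
    rw [orbit_succ] at h₁ ⊢
    rw [h.cum_step (hx.orbit n) h₁]
    exact ih fun t ht ht' => hU t ht (by omega)

/-- The jump of the step function at `x`. -/
lemma cum_jump (w : SP →₀ ℝ) (x : ℝ) :
    cum .plus x w - cum .minus x w = w (.plus, x) + w (.minus, x) := by
  have h₁ : cum .plus x w = massOn (fun q => Below .plus x q.2 ∧ Below .minus x q.2) w +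
      massOn (fun q => Below .plus x q.2 ∧ ¬ Below .minus x q.2) w := massOn_split _ _ w
  have h₂ : massOn (fun q => Below .plus x q.2 ∧ Below .minus x q.2) w = cum .minus x w := by
    refine massOn_congr fun q _ => ⟨fun h => h.2, fun h => ⟨le_of_lt h, h⟩⟩
  rw [h₁, h₂, add_sub_cancel_left, massOn_split _ (fun q => q.1 = Side.plus)]
  congr 1
  · refine massOn_eq_apply ⟨⟨le_rfl, lt_irrefl _⟩, rfl⟩ ?_
    rintro ⟨σ, y⟩ ⟨⟨h₁, h₂⟩, rfl⟩ _
    exact Prod.ext rfl (le_antisymm h₁ (not_lt.1 h₂))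
  · refine massOn_eq_apply ⟨⟨le_rfl, lt_irrefl _⟩, by simp⟩ ?_
    rintro ⟨σ, y⟩ ⟨⟨h₁, h₂⟩, h₃⟩ _
    cases σ
    · exact absurd rfl h₃
    · exact Prod.ext rfl (le_antisymm h₁ (not_lt.1 h₂))

lemma cum_eq_of_no_weight (w : SP →₀ ℝ) {x y : ℝ} (hxy : x < y)
    (h : ∀ σ z, x < z → z < y → w (σ, z) = 0) : cum .plus x w = cum .minus y w := by
  refine massOn_congr fun q hq => ?_
  change q.2 ≤ x ↔ q.2 < y
  refine ⟨fun h' => h'.trans_lt hxy, fun h' => ?_⟩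
  by_contra! hlt
  exact hq (h q.1 q.2 hlt h')

/-! ### Landing and return times -/

section NatNth

open Classical in
lemma nth_mem_of_lt_count {p : ℕ → Prop} {k n : ℕ} (h : k < Nat.count p n) : p (Nat.nth p k) :=
  Nat.nth_mem k fun hf => h.trans_le (Nat.count_le_card hf n)

open Classical in
lemma nth_lt_nth_of_lt_count {p : ℕ → Prop} {k k' n : ℕ} (hk : k < k') (h : k' < Nat.count p n) :
    Nat.nth p k < Nat.nth p k' :=
  Nat.nth_lt_nth' hk fun hf => h.trans_le (Nat.count_le_card hf n)

open Classical in
lemma exists_nth_eq {p : ℕ → Prop} {t n : ℕ} (ht : p t) (h : t < n) :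
    ∃ k < Nat.count p n, Nat.nth p k = t :=
  ⟨Nat.count p t, Nat.count_strict_mono ht h, Nat.nth_count ht⟩

end NatNth

section Landing

variable {T : ITM r} {J : HOInterval} {σ : Side} {a : ℝ}

/-- Since `sInf ∅ = 0`, the value `0` encodes the absence of a return. -/
lemma returnTime_pos_iff :
    0 < T.returnTime J σ a ↔ ∃ n, 0 < n ∧ J.MemSigned σ (T.orbit σ a n) := by
  constructor
  · intro h
    have := Nat.sInf_mem (Nat.nonempty_of_pos_sInf h)
    exact ⟨_, this⟩
  · rintro ⟨n, hn⟩
    exact (Nat.sInf_mem (s := {n : ℕ | 0 < n ∧ J.MemSigned σ (T.orbit σ a n)}) ⟨n, hn⟩).1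

lemma memSigned_returnTime (h : 0 < T.returnTime J σ a) :
    J.MemSigned σ (T.orbit σ a (T.returnTime J σ a)) :=
  (Nat.sInf_mem (Nat.nonempty_of_pos_sInf h)).2

lemma not_memSigned_of_lt {t : ℕ} (h₀ : 0 < t) (h : t < T.returnTime J σ a) :
    ¬ J.MemSigned σ (T.orbit σ a t) :=
  fun hm => Nat.notMem_of_lt_sInf h ⟨h₀, hm⟩

lemma returnTime_orbit {l : ℕ} (h : l < T.returnTime J σ a) :
    T.returnTime J σ (T.orbit σ a l) = T.returnTime J σ a - l := by
  refine le_antisymm (Nat.sInf_le ⟨by omega, ?_⟩) ?_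
  · rw [← orbit_add, Nat.add_sub_cancel' h.le]
    exact memSigned_returnTime (by omega)
  · have h₁ : 0 < T.returnTime J σ (T.orbit σ a l) := by
      refine returnTime_pos_iff.2 ⟨T.returnTime J σ a - l, by omega, ?_⟩
      rw [← orbit_add, Nat.add_sub_cancel' h.le]
      exact memSigned_returnTime (by omega)
    have h₂ := memSigned_returnTime h₁
    rw [← orbit_add] at h₂
    by_contra! hlt
    exact not_memSigned_of_lt (by omega) (by omega) h₂

lemma returnTime_pos_of_numLandings (h : 0 < T.numLandings J σ a) : 0 < T.returnTime J σ a := by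
  by_contra! h'
  simp [numLandings, Nat.le_zero.1 h'] at h

lemma numLandings_pos_iff :
    0 < T.numLandings J σ a ↔ ∃ t < T.returnTime J σ a, T.IsDisc (T.orbit σ a t) := by
  classical
  constructor
  · intro h
    exact ⟨Nat.nth (fun t => T.IsDisc (T.orbit σ a t)) 0, Nat.nth_lt_of_lt_count h,
      nth_mem_of_lt_count h⟩
  · rintro ⟨t, ht, hd⟩
    obtain ⟨k, hk, _⟩ := exists_nth_eq (p := fun t => T.IsDisc (T.orbit σ a t)) hd ht
    exact lt_of_le_of_lt (Nat.zero_le k) hk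

lemma landTime_lt {k : ℕ} (h₁ : 1 ≤ k) (h : k ≤ T.numLandings J σ a) :
    T.landTime σ a k < T.returnTime J σ a := by
  classical
  exact Nat.nth_lt_of_lt_count (show k - 1 < T.numLandings J σ a by omega)

lemma isDisc_landPt {k : ℕ} (h₁ : 1 ≤ k) (h : k ≤ T.numLandings J σ a) :
    T.IsDisc (T.landPt σ a k) :=
  nth_mem_of_lt_count (show k - 1 < T.numLandings J σ a by omega)

lemma landTime_lt_landTime {k k' : ℕ} (h₁ : 1 ≤ k) (hk : k < k') (h : k' ≤ T.numLandings J σ a) :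
    T.landTime σ a k < T.landTime σ a k' :=
  nth_lt_nth_of_lt_count (by omega) (show k' - 1 < T.numLandings J σ a by omega)

lemma exists_landTime_eq {t : ℕ} (ht : t < T.returnTime J σ a)
    (hd : T.IsDisc (T.orbit σ a t)) : ∃ k, 1 ≤ k ∧ k ≤ T.numLandings J σ a ∧ T.landTime σ a k = t := by
  obtain ⟨k, hk, hk'⟩ := exists_nth_eq (p := fun t => T.IsDisc (T.orbit σ a t)) hd ht
  exact ⟨k + 1, by omega, hk, hk'⟩

lemma landTime_inj {k k' : ℕ} (h₁ : 1 ≤ k) (h : k ≤ T.numLandings J σ a) (h₁' : 1 ≤ k')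
    (h' : k' ≤ T.numLandings J σ a) (e : T.landTime σ a k = T.landTime σ a k') : k = k' := by
  rcases lt_trichotomy k k' with hlt | rfl | hlt
  · exact absurd e (landTime_lt_landTime h₁ hlt h').ne
  · rfl
  · exact absurd e (landTime_lt_landTime h₁' hlt h).ne'

lemma not_isDisc_before {t : ℕ} (h : 0 < T.numLandings J σ a) (ht : t < T.landTime σ a 1) :
    ¬ T.IsDisc (T.orbit σ a t) := by
  intro hd
  obtain ⟨k, hk, hk', rfl⟩ := exists_landTime_eq (ht.trans (landTime_lt le_rfl h)) hd
  rcases hk.lt_or_eq with hlt | rfl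
  · exact absurd ht (landTime_lt_landTime le_rfl hlt hk').not_gt
  · exact lt_irrefl _ ht

lemma not_isDisc_between {k t : ℕ} (hk : 1 ≤ k) (h : k < T.numLandings J σ a)
    (ht : T.landTime σ a k < t) (ht' : t < T.landTime σ a (k + 1)) :
    ¬ T.IsDisc (T.orbit σ a t) := by
  intro hd
  obtain ⟨l, hl, hl', rfl⟩ := exists_landTime_eq (ht'.trans (landTime_lt (by omega) h)) hd
  have h₁ : k < l := by
    by_contra! hlt
    rcases hlt.lt_or_eq with hlt | rfl
    · exact absurd ht (landTime_lt_landTime hl hlt h.le).not_gt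
    · exact lt_irrefl _ ht
  have h₂ : l < k + 1 := by
    by_contra! hlt
    rcases hlt.lt_or_eq with hlt | rfl
    · exact absurd ht' (landTime_lt_landTime (by omega) hlt hl').not_gt
    · exact lt_irrefl _ ht'
  omega

lemma not_isDisc_after {t : ℕ}
    (ht : T.landTime σ a (T.numLandings J σ a) < t) (ht' : t < T.returnTime J σ a) :
    ¬ T.IsDisc (T.orbit σ a t) := by
  intro hd
  obtain ⟨l, hl, hl', rfl⟩ := exists_landTime_eq ht' hd
  rcases hl'.lt_or_eq with hlt | rfl
  · exact absurd ht (landTime_lt_landTime hl hlt le_rfl).not_gt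
  · exact lt_irrefl _ ht

lemma orbit_landTime_add {k t : ℕ} :
    T.orbit σ (T.landPt σ a k) t = T.orbit σ a (T.landTime σ a k + t) := by
  rw [orbit_add]; rfl

end Landing

/-! ### Formal vectors -/

/-- The formal sum of the first `n` signed points of the orbit of `a^σ`. -/
noncomputable def seg (T : ITM r) (σ : Side) (a : ℝ) (n : ℕ) : SP →₀ ℝ :=
  ∑ t ∈ range n, Finsupp.single (σ, T.orbit σ a t) 1

lemma seg_apply_ne_zero {T : ITM r} {σ : Side} {a : ℝ} {n : ℕ} {q : SP}
    (h : T.seg σ a n q ≠ 0) : ∃ t < n, q = (σ, T.orbit σ a t) := by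
  rw [seg, Finsupp.finsetSum_apply] at h
  obtain ⟨t, ht, h⟩ := Finset.exists_ne_zero_of_sum_ne_zero h
  refine ⟨t, Finset.mem_range.1 ht, ?_⟩
  by_contra hne
  exact h (Finsupp.single_eq_of_ne hne)

open Classical in
/-- The weight at `q ∈ S` of a segment that can meet `S` only at its start. -/
lemma seg_apply {T : ITM r} {σ : Side} {a : ℝ} {n : ℕ} {S : Set SP}
    (hS : ∀ t, 0 < t → t < n → (σ, T.orbit σ a t) ∉ S) {q : SP} (hq : q ∈ S) :
    T.seg σ a n q = if 0 < n ∧ (σ, a) = q then 1 else 0 := by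
  rcases Nat.eq_zero_or_pos n with rfl | hn
  · simp [seg]
  rw [seg, Finsupp.finsetSum_apply, Finset.sum_eq_single 0]
  · simp only [orbit_zero, Finsupp.single_apply, hn, true_and]
  · intro t ht h0
    refine Finsupp.single_eq_of_ne ?_
    rintro rfl
    exact hS t (by omega) (Finset.mem_range.1 ht) hq
  · intro h0
    exact absurd (Finset.mem_range.2 hn) h0

lemma massOn_seg (T : ITM r) (σ : Side) (a : ℝ) (n : ℕ) (s : Fin r) :
    massOn (fun q => T.InPiece q.1 s q.2) (T.seg σ a n) = T.visits σ a n s := by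
  classical
  rw [seg, map_sum, visits, Nat.count_eq_card_filter_range, Finset.card_filter]
  push_cast
  refine Finset.sum_congr rfl fun t _ => ?_
  rw [massOn_single]

/-- Formal vectors: weights of signed points and of discontinuities. -/
abbrev FV : Type := (SP →₀ ℝ) × (SP →₀ ℝ)

/-- The coefficient vector of a formal vector. -/
noncomputable def toW (T : ITM r) : FV →ₗ[ℝ] W r :=
  LinearMap.prodMap (LinearMap.pi fun s => massOn fun q => T.InPiece q.1 s q.2)
    (LinearMap.pi fun i => massOn fun q => T.disc i = q.2)

/-- The sources and sinks of a formal vector. -/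
noncomputable def sources (T : ITM r) : FV →ₗ[ℝ] (SP →₀ ℝ) :=
  (LinearMap.id - Finsupp.lmapDomain ℝ ℝ T.stepP) ∘ₗ LinearMap.fst ℝ _ _ - LinearMap.snd ℝ _ _

lemma sources_apply (T : ITM r) (v : FV) :
    T.sources v = v.1 - Finsupp.mapDomain T.stepP v.1 - v.2 := rfl

lemma toW_seg (T : ITM r) (σ : Side) (a : ℝ) (n : ℕ) (d : SP →₀ ℝ) :
    T.toW (T.seg σ a n, d) = (T.visits σ a n, fun i => massOn (fun q => T.disc i = q.2) d) := by
  refine Prod.ext (funext fun s => T.massOn_seg σ a n s) rfl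

lemma massOn_disc_single (T : ITM r) (q : SP) :
    (fun i => massOn (fun q => T.disc i = q.2) (Finsupp.single q 1)) = T.fvec q.2 := by
  classical
  ext i
  rw [massOn_single]; rfl

/-- `w - T_* w` telescopes along a segment, leaving its start minus its end. -/
lemma sources_seg (T : ITM r) (σ : Side) (a : ℝ) (n : ℕ) (d : SP →₀ ℝ) :
    T.sources (T.seg σ a n, d) =
      Finsupp.single (σ, a) 1 - Finsupp.single (σ, T.orbit σ a n) 1 - d := by
  rw [sources_apply]
  congr 1
  change T.seg σ a n - Finsupp.mapDomain T.stepP (T.seg σ a n) = _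
  rw [seg, Finsupp.mapDomain_finsetSum, ← Finset.sum_sub_distrib]
  have : ∀ t, Finsupp.single (σ, T.orbit σ a t) (1 : ℝ) -
      Finsupp.mapDomain T.stepP (Finsupp.single (σ, T.orbit σ a t) 1) =
      Finsupp.single (σ, T.orbit σ a t) 1 - Finsupp.single (σ, T.orbit σ a (t + 1)) 1 := by
    intro t
    rw [Finsupp.mapDomain_single, stepP, orbit_succ]
  rw [Finset.sum_congr rfl fun t _ => this t, Finset.sum_range_sub']
  rfl

/-- The formal landing vector. -/
noncomputable def landF (T : ITM r) (σ : Side) (a : ℝ) : FV :=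
  (T.seg σ a (T.landTime σ a 1), - Finsupp.single (σ, T.landPt σ a 1) 1)

/-- The formal critical connection vector. -/
noncomputable def connF (T : ITM r) (σ : Side) (a : ℝ) (k : ℕ) : FV :=
  (T.seg σ (T.landPt σ a k) (T.landTime σ a (k + 1) - T.landTime σ a k),
    Finsupp.single (σ, T.landPt σ a k) 1 - Finsupp.single (σ, T.landPt σ a (k + 1)) 1)

open Classical in
/-- The formal return vector. -/
noncomputable def returnF (T : ITM r) (J : HOInterval) (σ : Side) (a : ℝ) : FV :=
  if T.numLandings J σ a = 0 then (T.seg σ a (T.returnTime J σ a), 0)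
  else
    (T.seg σ (T.landPt σ a (T.numLandings J σ a))
      (T.returnTime J σ (T.landPt σ a (T.numLandings J σ a))),
      Finsupp.single (σ, T.landPt σ a (T.numLandings J σ a)) 1)

/-- The formal critical connection vectors of a periodic interval. -/
noncomputable def perF (T : ITM r) (J : HOInterval) (σ : Side) (k : ℕ) : FV :=
  if k = T.perM J σ then T.returnF J σ (J.endpoint σ) + T.landF σ (J.endpoint σ)
  else T.connF σ (J.endpoint σ) k

/-- The formal critical connection vector of a signed discontinuity. -/
noncomputable def genF (T : ITM r) (b : SDisc r) : FV :=
  (T.seg b.1 (T.disc b.2) (T.firstLanding b),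
    Finsupp.single (b.1, T.disc b.2) 1 -
      Finsupp.single (b.1, T.orbit b.1 (T.disc b.2) (T.firstLanding b)) 1)

lemma massOn_disc_sub (T : ITM r) (d d' : SP →₀ ℝ) :
    (fun i => massOn (fun q => T.disc i = q.2) (d - d')) =
      (fun i => massOn (fun q => T.disc i = q.2) d) -
        fun i => massOn (fun q => T.disc i = q.2) d' := by
  ext i; simp

lemma toW_landF (T : ITM r) (σ : Side) (a : ℝ) : T.toW (T.landF σ a) = T.landVec σ a := by
  rw [landF, toW_seg, ← zero_sub, massOn_disc_sub, massOn_disc_single, landVec, ← zero_sub]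
  congr 2

lemma toW_connF (T : ITM r) (σ : Side) (a : ℝ) (k : ℕ) :
    T.toW (T.connF σ a k) = T.connVec σ a k := by
  rw [connF, toW_seg, massOn_disc_sub, massOn_disc_single, massOn_disc_single, connVec]

lemma toW_returnF (T : ITM r) (J : HOInterval) (σ : Side) (a : ℝ) :
    T.toW (T.returnF J σ a) = T.returnVec J σ a := by
  rw [returnF, returnVec]
  split_ifs
  · rw [toW_seg]
    congr 1
  · rw [toW_seg, massOn_disc_single]

lemma toW_perF (T : ITM r) (J : HOInterval) (σ : Side) (k : ℕ) :
    T.toW (T.perF J σ k) = T.perC J σ k := by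
  rw [perF, perC]
  split_ifs
  · rw [map_add, toW_returnF, toW_landF]
  · rw [toW_connF]

lemma toW_genF (T : ITM r) (b : SDisc r) : T.toW (T.genF b) = T.genC b := by
  rw [genF, toW_seg, massOn_disc_sub, massOn_disc_single, massOn_disc_single, genC]

/-! ### Position of the formal vectors -/

/-- The signed points of `J`. -/
def signed (J : HOInterval) : Set SP := {q | J.MemSigned q.1 q.2}

/-- The signed points of the orbit of `J`. -/
def signedOrbit (T : ITM r) (J : HOInterval) : Set SP :=
  {q | ∃ a t, J.MemSigned q.1 a ∧ T.orbit q.1 a t = q.2}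

/-- The formal vectors carried by the orbit of `J`, with sources and sinks in `J`. -/
noncomputable def carried (T : ITM r) (J : HOInterval) : Submodule ℝ FV :=
  (Finsupp.supported ℝ ℝ (T.signedOrbit J)).comap (LinearMap.fst ℝ _ _) ⊓
    (Finsupp.supported ℝ ℝ (T.signedOrbit J ∩ {q | T.IsDisc q.2})).comap (LinearMap.snd ℝ _ _) ⊓
    (Finsupp.supported ℝ ℝ (signed J)).comap T.sources

lemma mem_supported_iff_apply {S : Set SP} {w : SP →₀ ℝ} :
    w ∈ Finsupp.supported ℝ ℝ S ↔ ∀ q, w q ≠ 0 → q ∈ S := by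
  rw [Finsupp.mem_supported]
  exact ⟨fun h q hq => h (by simpa using hq), fun h q hq => h q (by simpa using hq)⟩

lemma mem_carried {T : ITM r} {J : HOInterval} {v : FV}
    (h₁ : v.1 ∈ Finsupp.supported ℝ ℝ (T.signedOrbit J))
    (h₂ : v.2 ∈ Finsupp.supported ℝ ℝ (T.signedOrbit J ∩ {q | T.IsDisc q.2}))
    (h₃ : T.sources v ∈ Finsupp.supported ℝ ℝ (signed J)) : v ∈ T.carried J :=
  ⟨⟨h₁, h₂⟩, h₃⟩

section Carried

variable {T : ITM r} {J : HOInterval} {σ : Side} {a : ℝ}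

lemma seg_mem_supported (ha : J.MemSigned σ a) (l n : ℕ) :
    T.seg σ (T.orbit σ a l) n ∈ Finsupp.supported ℝ ℝ (T.signedOrbit J) := by
  rw [mem_supported_iff_apply]
  intro q hq
  obtain ⟨t, -, rfl⟩ := seg_apply_ne_zero hq
  exact ⟨a, l + t, ha, T.orbit_add σ a l t⟩

lemma single_mem_supported_disc (ha : J.MemSigned σ a) {l : ℕ} (h : T.IsDisc (T.orbit σ a l)) :
    Finsupp.single (σ, T.orbit σ a l) (1 : ℝ) ∈
      Finsupp.supported ℝ ℝ (T.signedOrbit J ∩ {q | T.IsDisc q.2}) :=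
  Finsupp.single_mem_supported _ _ ⟨⟨a, l, ha, rfl⟩, h⟩

/-- The `f`-parts are designed to cancel ends of segments at discontinuities: a landing vector keeps
only its start, a connection vector nothing, a return vector with a landing only its end in `J`. -/
lemma sources_landF : T.sources (T.landF σ a) = Finsupp.single (σ, a) 1 := by
  rw [landF, sources_seg, landPt]; abel

lemma sources_connF {k : ℕ} (hk : 1 ≤ k) (h : k < T.numLandings J σ a) :
    T.sources (T.connF σ a k) = 0 := by
  rw [connF, sources_seg, orbit_landTime_add,
    Nat.add_sub_cancel' (landTime_lt_landTime hk (Nat.lt_add_one k) h).le, ← landPt]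
  abel

lemma orbit_returnTime_landPt (h : 0 < T.numLandings J σ a) :
    T.orbit σ (T.landPt σ a (T.numLandings J σ a))
      (T.returnTime J σ (T.landPt σ a (T.numLandings J σ a))) =
      T.orbit σ a (T.returnTime J σ a) := by
  have h₁ := landTime_lt (T := T) (J := J) (σ := σ) (a := a) h le_rfl
  have h₂ : T.returnTime J σ (T.landPt σ a (T.numLandings J σ a)) = _ := returnTime_orbit h₁
  rw [h₂, orbit_landTime_add, Nat.add_sub_cancel' h₁.le]

lemma sources_returnF_of_pos (h : 0 < T.numLandings J σ a) :
    T.sources (T.returnF J σ a) = - Finsupp.single (σ, T.orbit σ a (T.returnTime J σ a)) 1 := by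
  rw [returnF, if_neg h.ne', sources_seg, orbit_returnTime_landPt h]
  abel

lemma landF_mem_carried (ha : J.MemSigned σ a) (h : 0 < T.numLandings J σ a) :
    T.landF σ a ∈ T.carried J := by
  refine mem_carried (seg_mem_supported ha 0 _) (neg_mem ?_) ?_
  · exact single_mem_supported_disc ha (isDisc_landPt le_rfl h)
  · rw [sources_landF]
    exact Finsupp.single_mem_supported _ _ ha

lemma connF_mem_carried (ha : J.MemSigned σ a) {k : ℕ} (hk : 1 ≤ k)
    (h : k < T.numLandings J σ a) : T.connF σ a k ∈ T.carried J := by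
  refine mem_carried (seg_mem_supported ha _ _) (sub_mem ?_ ?_) ?_
  · exact single_mem_supported_disc ha (isDisc_landPt hk h.le)
  · exact single_mem_supported_disc ha (isDisc_landPt (by omega) h)
  · rw [sources_connF hk h]
    exact zero_mem _

lemma returnF_mem_carried (ha : J.MemSigned σ a) (h : 0 < T.returnTime J σ a) :
    T.returnF J σ a ∈ T.carried J := by
  rcases Nat.eq_zero_or_pos (T.numLandings J σ a) with h₀ | h₀
  · rw [returnF, if_pos h₀]
    refine mem_carried (seg_mem_supported ha 0 _) (zero_mem _) ?_
    rw [sources_seg, sub_zero]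
    exact sub_mem (Finsupp.single_mem_supported _ _ ha)
      (Finsupp.single_mem_supported _ _ (memSigned_returnTime h))
  · refine mem_carried ?_ ?_ ?_
    · rw [returnF, if_neg h₀.ne']
      exact seg_mem_supported ha _ _
    · rw [returnF, if_neg h₀.ne']
      exact single_mem_supported_disc ha (isDisc_landPt h₀ le_rfl)
    · rw [sources_returnF_of_pos h₀]
      exact neg_mem (Finsupp.single_mem_supported _ _ (memSigned_returnTime h))

/-! ### Weights at discontinuities and in the interval -/

-- Orbits are cut at their landings, so a segment can meet a discontinuity only at its start.
-- Therefore the weight of a combination at a landing point will be the coefficient of the one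
-- vector starting there.
open Classical in
lemma landF_apply_disc (h : 0 < T.numLandings J σ a) {q : SP} (hq : T.IsDisc q.2) :
    (T.landF σ a).1 q = 0 := by
  by_contra hne
  obtain ⟨t, ht, rfl⟩ := seg_apply_ne_zero hne
  exact not_isDisc_before h ht hq

open Classical in
lemma connF_apply_disc {k : ℕ} (hk : 1 ≤ k) (h : k < T.numLandings J σ a) {q : SP}
    (hq : T.IsDisc q.2) :
    (T.connF σ a k).1 q = if (σ, T.landPt σ a k) = q then 1 else 0 := by
  have h₁ := landTime_lt_landTime hk (Nat.lt_add_one k) h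
  have h₂ : 0 < T.landTime σ a (k + 1) - T.landTime σ a k := by omega
  rw [connF, seg_apply (S := {q | T.IsDisc q.2}) _ hq]
  · simp only [h₂, true_and]
  · intro t ht ht'
    rw [orbit_landTime_add]
    exact not_isDisc_between hk h (by omega) (by omega)

open Classical in
lemma returnF_apply_disc {q : SP} (hq : T.IsDisc q.2) :
    (T.returnF J σ a).1 q = if 0 < T.numLandings J σ a ∧
      (σ, T.landPt σ a (T.numLandings J σ a)) = q then 1 else 0 := by
  rcases Nat.eq_zero_or_pos (T.numLandings J σ a) with h₀ | h₀
  · rw [returnF, if_pos h₀, if_neg (by omega)]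
    by_contra hne
    obtain ⟨t, ht, rfl⟩ := seg_apply_ne_zero hne
    exact h₀.not_gt (numLandings_pos_iff.2 ⟨t, ht, hq⟩)
  · have h₁ := landTime_lt (T := T) (J := J) (σ := σ) (a := a) h₀ le_rfl
    have h₂ : T.returnTime J σ (T.landPt σ a (T.numLandings J σ a)) = _ := returnTime_orbit h₁
    rw [returnF, if_neg h₀.ne', seg_apply (S := {q | T.IsDisc q.2}) _ hq]
    · simp only [h₀, true_and]
      rw [h₂]
      simp only [Nat.sub_pos_of_lt h₁, true_and]
    · intro t ht ht'
      rw [orbit_landTime_add]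
      exact not_isDisc_after (J := J) (by omega) (by omega)

-- No segment re-enters `J` before its end, so at a point of `J` that is not a discontinuity only a
-- segment starting there has weight. Connection vectors never do; return vectors do only when there
-- is no landing.
open Classical in
lemma landF_apply_signed (h : 0 < T.numLandings J σ a) {q : SP} (hq : q ∈ signed J)
    (hd : ¬ T.IsDisc q.2) : (T.landF σ a).1 q = if (σ, a) = q then 1 else 0 := by
  have h₁ := landTime_lt (T := T) (J := J) (σ := σ) (a := a) le_rfl h
  rw [landF, seg_apply (S := signed J) _ hq]
  · by_cases e : (σ, a) = q
    · have : 0 < T.landTime σ a 1 := by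
        by_contra! h₀
        have h₂ := isDisc_landPt (T := T) (J := J) (σ := σ) (a := a) le_rfl h
        rw [landPt, Nat.le_zero.1 h₀, orbit_zero] at h₂
        exact hd (by rw [← e]; exact h₂)
      simp [e, this]
    · simp [e]
  · exact fun t ht ht' => not_memSigned_of_lt ht (ht'.trans h₁)

lemma seg_landPt_apply_signed {k n : ℕ} (hk : 1 ≤ k) (hk' : k ≤ T.numLandings J σ a)
    (hn : T.landTime σ a k + n ≤ T.returnTime J σ a) {q : SP} (hq : q ∈ signed J)
    (hd : ¬ T.IsDisc q.2) : T.seg σ (T.landPt σ a k) n q = 0 := by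
  classical
  rw [seg_apply (S := signed J) _ hq, if_neg]
  · rintro ⟨_, rfl⟩
    exact hd (isDisc_landPt hk hk')
  · intro t ht ht'
    rw [orbit_landTime_add]
    exact not_memSigned_of_lt (T := T) (J := J) (σ := σ) (a := a) (by omega) (by omega)

lemma connF_apply_signed {k : ℕ} (hk : 1 ≤ k) (h : k < T.numLandings J σ a) {q : SP}
    (hq : q ∈ signed J) (hd : ¬ T.IsDisc q.2) : (T.connF σ a k).1 q = 0 := by
  have h₁ := landTime_lt_landTime hk (Nat.lt_add_one k) h
  have h₂ := landTime_lt (T := T) (J := J) (σ := σ) (a := a) (k := k + 1) (by omega) h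
  exact seg_landPt_apply_signed hk h.le (by omega) hq hd

open Classical in
lemma returnF_apply_signed (hρ : 0 < T.returnTime J σ a) {q : SP}
    (hq : q ∈ signed J) (hd : ¬ T.IsDisc q.2) :
    (T.returnF J σ a).1 q = if T.numLandings J σ a = 0 ∧ (σ, a) = q then 1 else 0 := by
  rcases Nat.eq_zero_or_pos (T.numLandings J σ a) with h₀ | h₀
  · rw [returnF, if_pos h₀, seg_apply (S := signed J) _ hq]
    · simp [hρ, h₀]
    · exact fun t ht ht' => not_memSigned_of_lt ht ht'
  · have h₁ := landTime_lt (T := T) (J := J) (σ := σ) (a := a) h₀ le_rfl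
    have h₂ : T.returnTime J σ (T.landPt σ a (T.numLandings J σ a)) = _ := returnTime_orbit h₁
    rw [returnF, if_neg h₀.ne', if_neg (by omega)]
    exact seg_landPt_apply_signed h₀ le_rfl (by omega) hq hd

end Carried

/-! ### Intervals contained in the attractor -/

lemma memSigned_germ {J : HOInterval} {σ : Side} {x : ℝ} (h : J.MemSigned σ x) :
    ∃ ε > 0, germ σ x ε ⊆ J.toSet := by
  cases σ
  · exact ⟨J.right - x, by linarith [h.2], Set.Ico_subset_Ico h.1 (by linarith)⟩
  · exact ⟨x - J.left, by linarith [h.1], Set.Ico_subset_Ico (by linarith) h.2⟩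

lemma memSigned_endpoint (J : HOInterval) (σ : Side) : J.MemSigned σ (J.endpoint σ) := by
  cases σ
  · exact ⟨le_rfl, J.left_lt_right⟩
  · exact ⟨J.left_lt_right, le_rfl⟩

lemma valid_of_memSigned {J : HOInterval} (hJ : J.toSet ⊆ Set.Ico 0 1) {σ : Side} {x : ℝ}
    (h : J.MemSigned σ x) : Valid σ x := by
  obtain ⟨ε, hε, H⟩ := memSigned_germ h
  exact Valid.of_germ hε (H.trans hJ)

lemma signedMemX_of_memSigned {T : ITM r} {J : HOInterval} (hJ : J.toSet ⊆ T.attractor)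
    {σ : Side} {x : ℝ} (h : J.MemSigned σ x) : T.SignedMemX σ x := by
  obtain ⟨ε, hε, H⟩ := memSigned_germ h
  exact (T.signedMemX_iff σ x).2 ⟨ε, hε, H.trans hJ⟩

lemma signedMemX_of_signedOrbit {T : ITM r} {J : HOInterval} (hJ : J.toSet ⊆ T.attractor)
    {q : SP} (h : q ∈ T.signedOrbit J) : T.SignedMemX q.1 q.2 := by
  obtain ⟨a, t, ha, h⟩ := h
  rw [← h]
  exact (signedMemX_of_memSigned hJ ha).orbit t

lemma signed_subset_signedOrbit (T : ITM r) (J : HOInterval) : signed J ⊆ T.signedOrbit J :=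
  fun q hq => ⟨q.2, 0, hq, rfl⟩

/-- The orbits of the signed points of `J` up to their return to `J` are disjoint. -/
lemma orbit_unique {T : ITM r} {J : HOInterval} (hJ : J.toSet ⊆ T.attractor) {σ : Side}
    {a b : ℝ} (ha : J.MemSigned σ a) (hb : J.MemSigned σ b) {s t : ℕ}
    (hs : ∀ u, 0 < u → u ≤ s → ¬ J.MemSigned σ (T.orbit σ a u))
    (ht : ∀ u, 0 < u → u ≤ t → ¬ J.MemSigned σ (T.orbit σ b u))
    (h : T.orbit σ a s = T.orbit σ b t) : s = t ∧ a = b := by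
  wlog hst : s ≤ t generalizing a b s t
  · obtain ⟨h₁, h₂⟩ := this hb ha ht hs h.symm (by omega)
    exact ⟨h₁.symm, h₂.symm⟩
  -- After cancelling `s` steps, `a` lies on the orbit of `b`; a positive remaining time would be a
  -- forbidden visit of `b` to `J`.
  have e := (signedMemX_of_memSigned hJ ha).orbit_inj (signedMemX_of_memSigned hJ hb) hst h
  have hst' : t - s = 0 := by
    by_contra hne
    exact ht (t - s) (by omega) (by omega) (e ▸ ha)
  rw [hst'] at e
  exact ⟨by omega, e⟩

lemma orbit_unique_of_lt_returnTime {T : ITM r} {J : HOInterval} (hJ : J.toSet ⊆ T.attractor)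
    {σ : Side} {a b : ℝ} (ha : J.MemSigned σ a) (hb : J.MemSigned σ b) {s t : ℕ}
    (hs : s < T.returnTime J σ a) (ht : t < T.returnTime J σ b)
    (h : T.orbit σ a s = T.orbit σ b t) : s = t ∧ a = b :=
  orbit_unique hJ ha hb (fun _ h₀ hu => not_memSigned_of_lt h₀ (by omega))
    (fun _ h₀ hu => not_memSigned_of_lt h₀ (by omega)) h

lemma landPt_unique {T : ITM r} {J : HOInterval} (hJ : J.toSet ⊆ T.attractor)
    {σ : Side} {a b : ℝ} (ha : J.MemSigned σ a) (hb : J.MemSigned σ b) {k l : ℕ}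
    (hk : 1 ≤ k) (hk' : k ≤ T.numLandings J σ a) (hl : 1 ≤ l) (hl' : l ≤ T.numLandings J σ b)
    (h : T.landPt σ a k = T.landPt σ b l) : a = b ∧ k = l := by
  obtain ⟨h₁, rfl⟩ := orbit_unique_of_lt_returnTime hJ ha hb (landTime_lt hk hk')
    (landTime_lt hl hl') h
  exact ⟨rfl, landTime_inj hk hk' hl hl' h₁⟩

/-- Around a common signed point of the two orbits, short germs of both intervals are translated
onto the same germ, so the geometric orbits share a point. -/
lemma disjoint_signedOrbit {T : ITM r} {J K : HOInterval} (hJ : J.toSet ⊆ Set.Ico 0 1)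
    (hK : K.toSet ⊆ Set.Ico 0 1) (h : Disjoint (T.orbitSet J.toSet) (T.orbitSet K.toSet)) :
    Disjoint (T.signedOrbit J) (T.signedOrbit K) := by
  rw [Set.disjoint_left]
  rintro ⟨σ, x⟩ ⟨a, s, ha, hx⟩ ⟨b, t, hb, hx'⟩
  obtain ⟨ε₁, hε₁, H₁⟩ := memSigned_germ ha
  obtain ⟨ε₂, hε₂, H₂⟩ := memSigned_germ hb
  obtain ⟨ε₃, hε₃, H₃⟩ := T.germ_orbit (valid_of_memSigned hJ ha) s
  obtain ⟨ε₄, hε₄, H₄⟩ := T.germ_orbit (valid_of_memSigned hK hb) t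
  simp only at hx hx' H₁ H₂ H₃ H₄
  obtain ⟨ε, hε, h₁, h₂, h₃, h₄⟩ : ∃ ε > 0, ε ≤ ε₁ ∧ ε ≤ ε₂ ∧ ε ≤ ε₃ ∧ ε ≤ ε₄ := by
    refine ⟨min (min ε₁ ε₂) (min ε₃ ε₄), by positivity, ?_, ?_, ?_, ?_⟩ <;> simp
  obtain ⟨z, hz⟩ := germ_nonempty σ x hε
  have ha' : z + (a - x) ∈ germ σ a ε := by
    have := (add_mem_germ (a - x)).2 hz
    rwa [add_sub_cancel] at this
  have hb' : z + (b - x) ∈ germ σ b ε := by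
    have := (add_mem_germ (b - x)).2 hz
    rwa [add_sub_cancel] at this
  have e₁ := (H₃ _ (germ_mono _ _ h₃ ha') s le_rfl).1
  have e₂ := (H₄ _ (germ_mono _ _ h₄ hb') t le_rfl).1
  rw [hx] at e₁
  rw [hx'] at e₂
  have e : T.orbit .plus (z + (a - x)) s = T.orbit .plus (z + (b - x)) t := by
    rw [e₁, e₂]; ring
  refine Set.disjoint_left.1 h (Set.mem_iUnion.2 ⟨s, _, H₁ (germ_mono _ _ h₁ ha'), rfl⟩)
    (Set.mem_iUnion.2 ⟨t, _, H₂ (germ_mono _ _ h₂ hb'), ?_⟩)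
  exact e.symm

/-- Points of the interior of `J` that land on a discontinuity before they return to `J`, if they
return at all. -/
def preBranch (T : ITM r) (J : HOInterval) : Set ℝ :=
  {z | (J.left < z ∧ z < J.right) ∧ ∃ t, T.IsDisc (T.orbit .plus z t) ∧
    ∀ u, 0 < u → u ≤ t → ¬ J.MemSigned .plus (T.orbit .plus z u)}

/-- By `orbit_unique` a point is determined by a discontinuity it reaches before any return, and
there are finitely many discontinuities. No return is presupposed, so this is available for proving
recurrence. -/
lemma finite_preBranch {T : ITM r} {J : HOInterval} (hJ : J.toSet ⊆ T.attractor) :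
    (T.preBranch J).Finite := by
  have h : ∀ z : T.preBranch J, ∃ i t, T.disc i = T.orbit .plus z.1 t ∧
      ∀ u, 0 < u → u ≤ t → ¬ J.MemSigned .plus (T.orbit .plus z.1 u) := by
    rintro ⟨z, -, t, ⟨i, hi⟩, ht⟩
    exact ⟨i, t, hi, ht⟩
  choose i t h₁ h₂ using h
  refine Set.finite_coe_iff.1 (Finite.of_injective i fun z z' hz => ?_)
  have e : T.orbit .plus z.1 (t z) = T.orbit .plus z'.1 (t z') := by rw [← h₁, ← h₁, hz]
  exact Subtype.ext (orbit_unique hJ (σ := .plus) ⟨z.2.1.1.le, z.2.1.2⟩ ⟨z'.2.1.1.le, z'.2.1.2⟩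
    (h₂ z) (h₂ z') e).2

lemma finite_isBranchPoint {T : ITM r} {J : HOInterval} (hJ : J.toSet ⊆ T.attractor) :
    {z | T.IsBranchPoint J z}.Finite := by
  refine (finite_preBranch hJ).subset ?_
  rintro z ⟨h₁, h₂, h₃⟩
  obtain ⟨t, ht, hd⟩ := numLandings_pos_iff.1 h₃
  exact ⟨⟨h₁, h₂⟩, t, hd, fun u hu hu' => not_memSigned_of_lt hu (by omega)⟩

/-! ### Branch points -/

section Branch

variable {T : ITM r} {J : HOInterval}

lemma branchPt_succ (hB : {z | T.IsBranchPoint J z}.Finite) {j : ℕ}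
    (h : T.branchPt J j < J.right) :
    IsLeast {z | T.branchPt J j < z ∧ (T.IsBranchPoint J z ∨ z = J.right)}
      (T.branchPt J (j + 1)) := by
  have hne : {z | T.branchPt J j < z ∧ (T.IsBranchPoint J z ∨ z = J.right)}.Nonempty :=
    ⟨J.right, h, Or.inr rfl⟩
  have hfin : {z | T.branchPt J j < z ∧ (T.IsBranchPoint J z ∨ z = J.right)}.Finite :=
    (hB.union (Set.finite_singleton J.right)).subset fun z hz => hz.2
  exact ⟨hne.csInf_mem hfin, fun z hz => csInf_le hfin.bddBelow hz⟩

/-- The count in the last clause drives the induction: with exactly `j` branch points up to `a_j`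
and more than `j` in all, the next point is again a branch point rather than the right endpoint. -/
lemma branchPt_spec (hB : {z | T.IsBranchPoint J z}.Finite) {j : ℕ} (hj : j < T.branchCount J) :
    T.branchPt J j < J.right ∧ (0 < j → T.IsBranchPoint J (T.branchPt J j)) ∧
      J.left ≤ T.branchPt J j ∧
      {z | T.IsBranchPoint J z ∧ z ≤ T.branchPt J j}.ncard = j := by
  induction j with
  | zero =>
    refine ⟨J.left_lt_right, fun h => absurd h (lt_irrefl _), le_rfl, ?_⟩
    rw [Set.ncard_eq_zero (hB.subset fun z hz => hz.1)]
    refine Set.eq_empty_of_forall_notMem fun z hz => ?_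
    exact absurd hz.1.1 (not_lt.2 hz.2)
  | succ j ih =>
    obtain ⟨h₁, -, h₂, h₃⟩ := ih (by omega)
    have hL := branchPt_succ hB h₁
    have hz : ∃ z, T.IsBranchPoint J z ∧ T.branchPt J j < z := by
      by_contra! hc
      have : {z | T.IsBranchPoint J z ∧ z ≤ T.branchPt J j} = {z | T.IsBranchPoint J z} :=
        Set.ext fun z => ⟨fun h => h.1, fun h => ⟨h, hc z h⟩⟩
      rw [this] at h₃
      unfold branchCount at hj
      omega
    obtain ⟨z, hz, hz'⟩ := hz
    have h₄ : T.branchPt J (j + 1) < J.right := (hL.2 ⟨hz', Or.inl hz⟩).trans_lt hz.2.1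
    have h₅ : T.IsBranchPoint J (T.branchPt J (j + 1)) := hL.1.2.resolve_right h₄.ne
    refine ⟨h₄, fun _ => h₅, h₂.trans hL.1.1.le, ?_⟩
    have : {z | T.IsBranchPoint J z ∧ z ≤ T.branchPt J (j + 1)} =
        insert (T.branchPt J (j + 1)) {z | T.IsBranchPoint J z ∧ z ≤ T.branchPt J j} := by
      ext y
      simp only [Set.mem_ofPred_eq, Set.mem_insert_iff]
      constructor
      · rintro ⟨hy, hy'⟩
        by_cases hlt : y ≤ T.branchPt J j
        · exact Or.inr ⟨hy, hlt⟩
        · exact Or.inl (le_antisymm hy' (hL.2 ⟨not_le.1 hlt, Or.inl hy⟩))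
      · rintro (rfl | ⟨hy, hy'⟩)
        · exact ⟨h₅, le_rfl⟩
        · exact ⟨hy, hy'.trans hL.1.1.le⟩
    rw [this, Set.ncard_insert_of_notMem _ (hB.subset fun z hz => hz.1), h₃]
    rintro ⟨-, h⟩
    exact absurd hL.1.1 (not_lt.2 h)

lemma branchPt_lt_succ (hB : {z | T.IsBranchPoint J z}.Finite) {j : ℕ}
    (hj : j < T.branchCount J) : T.branchPt J j < T.branchPt J (j + 1) :=
  (branchPt_succ hB (branchPt_spec hB hj).1).1.1

lemma branchPt_lt (hB : {z | T.IsBranchPoint J z}.Finite) {i j : ℕ} (hij : i < j)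
    (hj : j ≤ T.branchCount J) : T.branchPt J i < T.branchPt J j := by
  induction j with
  | zero => omega
  | succ j ih =>
    rcases (Nat.lt_succ_iff.1 hij).lt_or_eq with h | rfl
    · exact (ih h (by omega)).trans (branchPt_lt_succ hB hj)
    · exact branchPt_lt_succ hB hj

lemma branchPt_inj (hB : {z | T.IsBranchPoint J z}.Finite) {i j : ℕ}
    (hi : i ≤ T.branchCount J) (hj : j ≤ T.branchCount J)
    (h : T.branchPt J i = T.branchPt J j) : i = j := by
  rcases lt_trichotomy i j with hlt | rfl | hlt
  · exact absurd h (branchPt_lt hB hlt hj).ne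
  · rfl
  · exact absurd h (branchPt_lt hB hlt hi).ne'

lemma branchCount_pos (T : ITM r) (J : HOInterval) : 0 < T.branchCount J := Nat.succ_pos _

lemma branchPt_last (hB : {z | T.IsBranchPoint J z}.Finite) :
    T.branchPt J (T.branchCount J) = J.right := by
  obtain ⟨h₁, -, -, h₃⟩ := branchPt_spec hB (j := T.branchCount J - 1)
    (by have := T.branchCount_pos J; omega)
  have hL := branchPt_succ hB h₁
  rw [show T.branchCount J - 1 + 1 = T.branchCount J from
    Nat.sub_add_cancel (T.branchCount_pos J)] at hL
  refine hL.1.2.resolve_left fun h => ?_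
  have hsub : {z | T.IsBranchPoint J z ∧ z ≤ T.branchPt J (T.branchCount J - 1)} ⊆
      {z | T.IsBranchPoint J z} := fun z hz => hz.1
  have := Set.eq_of_subset_of_ncard_le hsub (by rw [h₃, branchCount]; omega) hB
  have h' : T.branchPt J (T.branchCount J) ∈ {z | T.IsBranchPoint J z} := h
  rw [← this] at h'
  exact absurd hL.1.1 (not_lt.2 h'.2)

lemma branchPt_le_right (hB : {z | T.IsBranchPoint J z}.Finite) {j : ℕ}
    (hj : j ≤ T.branchCount J) : T.branchPt J j ≤ J.right := by
  rcases hj.lt_or_eq with h | rfl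
  · exact (branchPt_spec hB h).1.le
  · exact (branchPt_last hB).le

lemma not_isBranchPoint_between (hB : {z | T.IsBranchPoint J z}.Finite) {j : ℕ}
    (hj : j < T.branchCount J) {z : ℝ} (h₁ : T.branchPt J j < z)
    (h₂ : z < T.branchPt J (j + 1)) : ¬ T.IsBranchPoint J z := fun h =>
  absurd h₂ (not_lt.2 ((branchPt_succ hB (branchPt_spec hB hj).1).2 ⟨h₁, Or.inl h⟩))

lemma memSigned_branchPt_plus (hB : {z | T.IsBranchPoint J z}.Finite) {j : ℕ}
    (hj : j < T.branchCount J) : J.MemSigned .plus (T.branchPt J j) :=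
  ⟨(branchPt_spec hB hj).2.2.1, (branchPt_spec hB hj).1⟩

lemma memSigned_branchPt_minus (hB : {z | T.IsBranchPoint J z}.Finite) {j : ℕ}
    (hj₀ : 1 ≤ j) (hj : j ≤ T.branchCount J) : J.MemSigned .minus (T.branchPt J j) :=
  ⟨branchPt_lt hB (i := 0) hj₀ hj, branchPt_le_right hB hj⟩

end Branch

/-! ### Component intervals -/

lemma isDisc_succ (T : ITM r) {s : Fin r} (h : T.β s.succ < 1) : T.IsDisc (T.β s.succ) := by
  have hs : s.1 + 1 < r := by
    by_contra! hr
    have : s.succ = Fin.last r := Fin.ext (by simp; omega)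
    rw [this, T.β_last] at h
    exact lt_irrefl _ h
  exact ⟨⟨s, by omega⟩, rfl⟩

lemma isDisc_castSucc (T : ITM r) {s : Fin r} (h : 0 < T.β s.castSucc) :
    T.IsDisc (T.β s.castSucc) := by
  have hs : 0 < s.1 := by
    by_contra! hr
    have : s.castSucc = (0 : Fin (r + 1)) := Fin.ext (by simp; omega)
    rw [this, T.β_zero] at h
    exact lt_irrefl _ h
  refine ⟨⟨s - 1, by omega⟩, ?_⟩
  unfold disc
  congr 1
  exact Fin.ext (by simp; omega)

section Component

variable {T : ITM r} {J : HOInterval}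

/-- The union of `J` with an interval of `X` meeting it is again an interval of `X`, so maximality
applies. -/
lemma IsComponent.absorb (hJ : T.IsComponent J) {c d z : ℝ} (h : Set.Ico c d ⊆ T.attractor)
    (hz : z ∈ Set.Ico c d) (hz' : z ∈ J.toSet) : J.left ≤ c ∧ d ≤ J.right := by
  have hlr := J.left_lt_right
  let K : HOInterval := ⟨min J.left c, max J.right d,
    (min_le_left _ _).trans_lt (hlr.trans_le (le_max_left _ _))⟩
  have hK : K.toSet ⊆ J.toSet := by
    refine hJ.2 K ?_ (Set.Ico_subset_Ico (min_le_left _ _) (le_max_left _ _))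
    rintro x ⟨hx₁, hx₂⟩
    simp only [K, min_le_iff, lt_max_iff] at hx₁ hx₂
    by_cases hxz : x < z
    · rcases hx₁ with h₁ | h₁
      · exact hJ.1 ⟨h₁, hxz.trans hz'.2⟩
      · exact h ⟨h₁, hxz.trans hz.2⟩
    · rw [not_lt] at hxz
      rcases hx₂ with h₁ | h₁
      · exact hJ.1 ⟨hz'.1.trans hxz, h₁⟩
      · exact h ⟨hz.1.trans hxz, h₁⟩
  have := (Set.Ico_subset_Ico_iff K.left_lt_right).1 hK
  simpa [K] using this

lemma IsComponent.not_signedMemX_left (hJ : T.IsComponent J) : ¬ T.SignedMemX .minus J.left := by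
  rintro ⟨ε, hε, h⟩
  have hlr := J.left_lt_right
  have hsub : Set.Ico (J.left - ε) J.right ⊆ T.attractor := by
    rintro x ⟨h₁, h₂⟩
    by_cases hx : x < J.left
    · exact h ⟨h₁, hx⟩
    · exact hJ.1 ⟨not_lt.1 hx, h₂⟩
  have := (hJ.absorb hsub (z := J.left) ⟨by linarith, hlr⟩ ⟨le_rfl, hlr⟩).1
  linarith

lemma IsComponent.not_signedMemX_right (hJ : T.IsComponent J) :
    ¬ T.SignedMemX .plus J.right := by
  rintro ⟨ε, hε, h⟩
  have hlr := J.left_lt_right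
  have hsub : Set.Ico J.left (J.right + ε) ⊆ T.attractor := by
    rintro x ⟨h₁, h₂⟩
    by_cases hx : x < J.right
    · exact hJ.1 ⟨h₁, hx⟩
    · exact h ⟨not_lt.1 hx, h₂⟩
  have := (hJ.absorb hsub (z := J.left) ⟨le_rfl, by linarith⟩ ⟨le_rfl, hlr⟩).2
  linarith

/-! ### Recurrence of the signed points of a component interval. -/

lemma exists_Ioo_avoiding {S : Set ℝ} (hS : S.Finite) {σ : Side} {x : ℝ}
    (h : J.MemSigned σ x) :
    ∃ x₁ x₂, x₁ < x₂ ∧ (σ = .plus → x₁ = x) ∧ (σ = .minus → x₂ = x) ∧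
      Set.Ioo x₁ x₂ ⊆ J.toSet ∧ ∀ z ∈ Set.Ioo x₁ x₂, z ∉ S := by
  have : (S \ {x})ᶜ ∈ nhds x :=
    (hS.subset Set.sdiff_subset).isClosed.isOpen_compl.mem_nhds (by simp)
  obtain ⟨ε, hε, hb⟩ := Metric.mem_nhds_iff.1 this
  have hb' : ∀ z, z ≠ x → |z - x| < ε → z ∉ S := fun z hz hz' hzS =>
    hb (show z ∈ Metric.ball x ε from hz') ⟨hzS, hz⟩
  cases σ
  · refine ⟨x, min (x + ε) J.right, lt_min (by linarith) h.2, fun _ => rfl, by simp,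
      fun z hz => ⟨h.1.trans hz.1.le, hz.2.trans_le (min_le_right _ _)⟩, fun z hz => ?_⟩
    have := hz.2.trans_le (min_le_left _ _)
    refine hb' z hz.1.ne' ?_
    rw [abs_of_pos (by linarith [hz.1])]; linarith
  · refine ⟨max (x - ε) J.left, x, max_lt (by linarith) h.1, by simp, fun _ => rfl,
      fun z hz => ⟨(le_max_right _ _).trans hz.1.le, hz.2.trans_le h.2⟩, fun z hz => ?_⟩
    have := (le_max_left _ _).trans_lt hz.1
    refine hb' z hz.2.ne ?_
    rw [abs_of_neg (by linarith [hz.2])]; linarith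

/-- A small interval next to a signed point of a component interval `J` that does not return to `J`
is translated by all iterates and does not meet `J` again. -/
lemma IsComponent.rigid (hJ : T.IsComponent J) {σ : Side} {x x₁ x₂ : ℝ}
    (hx : J.MemSigned σ x) (hlt : x₁ < x₂) (hp : σ = .plus → x₁ = x) (hm : σ = .minus → x₂ = x)
    (hsub : Set.Ioo x₁ x₂ ⊆ J.toSet) (hav : ∀ z ∈ Set.Ioo x₁ x₂, z ∉ T.preBranch J)
    (hno : ∀ n, 0 < n → ¬ J.MemSigned σ (T.orbit σ x n)) (n : ℕ) :
    ∀ z ∈ Set.Ioo x₁ x₂, T.orbit .plus z n = z + (T.orbit σ x n - x) ∧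
      (0 < n → T.orbit .plus z n ∉ J.toSet) := by
  have hJ₁ : J.toSet ⊆ Set.Ico 0 1 := hJ.1.trans T.attractor_subset
  have hint : ∀ z ∈ Set.Ioo x₁ x₂, J.left < z ∧ z < J.right := by
    intro z hz
    obtain ⟨y, hy₁, hy₂⟩ := exists_between hz.1
    exact ⟨(hsub ⟨hy₁, hy₂.trans hz.2⟩).1.trans_lt hy₂, (hsub hz).2⟩
  induction n using Nat.strong_induction_on with
  | _ n ih =>
  rcases Nat.eq_zero_or_pos n with rfl | hn
  · exact fun z _ => ⟨by simp [orbit_zero], fun h => absurd h (lt_irrefl _)⟩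
  obtain ⟨n, rfl⟩ : ∃ k, n = k + 1 := ⟨n - 1, by omega⟩
  -- By induction `z` has not met `J` so far, so a discontinuity reached now would make it a point
  -- of `preBranch`.
  have hnd : ∀ z ∈ Set.Ioo x₁ x₂, ¬ T.IsDisc (z + (T.orbit σ x n - x)) := by
    intro z hz hd
    rw [← (ih n (by omega) z hz).1] at hd
    exact hav z hz ⟨hint z hz, n, hd, fun u hu hu' => (ih u (by omega) z hz).2 hu⟩
  have hval : ∀ z ∈ Set.Ioo x₁ x₂, Valid .plus (z + (T.orbit σ x n - x)) := by
    intro z hz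
    rw [← (ih n (by omega) z hz).1]
    exact Valid.orbit T (σ := .plus) (hJ₁ (hsub hz)) n
  obtain ⟨s, hs⟩ := T.exists_inPiece ((valid_of_memSigned hJ₁ hx).orbit T n)
  have hpiece : ∀ z ∈ Set.Ioo x₁ x₂, T.InPiece .plus s (z + (T.orbit σ x n - x)) := by
    intro z hz
    have hv := hval z hz
    cases σ
    · have e := hp rfl
      refine ⟨by linarith [hs.1, hz.1], ?_⟩
      by_contra! hc
      -- If the translated interval crossed the end of the piece, the point translated onto the
      -- breakpoint would reach a discontinuity.
      have hm : T.β s.succ - (T.orbit .plus x n - x) ∈ Set.Ioo x₁ x₂ :=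
        ⟨by linarith [hs.2], by linarith [hz.2]⟩
      have := hnd _ hm
      rw [sub_add_cancel] at this
      exact this (T.isDisc_succ (hc.trans_lt hv.2))
    · have e := hm rfl
      refine ⟨?_, by linarith [hs.2, hz.2]⟩
      by_contra! hc
      have hm : T.β s.castSucc - (T.orbit .minus x n - x) ∈ Set.Ioo x₁ x₂ :=
        ⟨by linarith [hz.1], by linarith [hs.1]⟩
      have := hnd _ hm
      rw [sub_add_cancel] at this
      exact this (T.isDisc_castSucc (hv.1.trans_lt hc))
  have htr : ∀ z ∈ Set.Ioo x₁ x₂,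
      T.orbit .plus z (n + 1) = z + (T.orbit σ x (n + 1) - x) := by
    intro z hz
    rw [orbit_succ, (ih n (by omega) z hz).1, (hpiece z hz).step_eq, orbit_succ, hs.step_eq]
    ring
  refine fun z hz => ⟨htr z hz, fun _ hzJ => hno (n + 1) hn ?_⟩
  set c := T.orbit σ x (n + 1) - x with hc
  -- The translated interval `[y + c, x₂ + c)` lies in `X` and meets `J` at `z + c`, so `J` absorbs
  -- it. Letting `y` tend to `x₁` puts the whole image into `J`, and with it the signed point
  -- `T^(n+1) (x^σ)`.
  have hX : ∀ y, x₁ < y → y < z → J.left ≤ y + c ∧ x₂ + c ≤ J.right := by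
    intro y hy hyz
    refine hJ.absorb (z := z + c) ?_ ⟨by linarith, by linarith [hz.2]⟩ (htr z hz ▸ hzJ)
    intro y' hy'
    have hm : y' - c ∈ Set.Ioo x₁ x₂ := ⟨by linarith [hy'.1], by linarith [hy'.2]⟩
    have := T.orbit_mem_attractor (hJ.1 (hsub hm)) (n + 1)
    rwa [htr _ hm, sub_add_cancel] at this
  have hl : J.left ≤ x₁ + c := by
    refine le_of_forall_gt_imp_ge_of_dense fun w hw => ?_
    obtain ⟨y, hy₁, hy₂⟩ := exists_between (lt_min hz.1 (show x₁ < w - c by linarith))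
    have := (hX y hy₁ (hy₂.trans_le (min_le_left _ _))).1
    linarith [hy₂.trans_le (min_le_right _ _)]
  have hr : x₂ + c ≤ J.right := by
    obtain ⟨y, hy₁, hy₂⟩ := exists_between hz.1
    exact (hX y hy₁ hy₂).2
  have e : T.orbit σ x (n + 1) = x + c := by rw [hc]; ring
  rw [e]
  cases σ
  · rw [← hp rfl]; exact ⟨hl, by linarith⟩
  · rw [← hm rfl]; exact ⟨by linarith, hr⟩

/-- Pigeonhole on the finitely many boxes of length `d` that meet `[0,1]`. -/
lemma exists_close_pair {f : ℕ → ℝ} (h₀ : ∀ n, 0 ≤ f n) (h₁ : ∀ n, f n ≤ 1) {d : ℝ}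
    (hd : 0 < d) : ∃ n m, n < m ∧ |f n - f m| < d := by
  have hmem : ∀ n, ⌊f n / d⌋ ∈ Set.Icc (0 : ℤ) ⌊1 / d⌋ := fun n =>
    ⟨Int.floor_nonneg.2 (div_nonneg (h₀ n) hd.le),
      Int.floor_le_floor (div_le_div_of_nonneg_right (h₁ n) hd.le)⟩
  obtain ⟨n, m, hne, h⟩ := Finite.exists_ne_map_eq_of_infinite
    fun n => (⟨⌊f n / d⌋, hmem n⟩ : Set.Icc (0 : ℤ) ⌊1 / d⌋)
  have h' : ∀ n m, ⌊f n / d⌋ = ⌊f m / d⌋ → |f n - f m| < d := by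
    intro n m h
    have := Int.abs_sub_lt_one_of_floor_eq_floor h
    rwa [← sub_div, abs_div, abs_of_pos hd, div_lt_one hd] at this
  have e := congrArg Subtype.val h
  rcases lt_or_gt_of_ne hne with hlt | hlt
  · exact ⟨n, m, hlt, h' n m e⟩
  · exact ⟨m, n, hlt, h' m n e.symm⟩

/-- Every signed point of a component interval returns to it. -/
lemma IsComponent.returnTime_pos (hJ : T.IsComponent J) {σ : Side} {x : ℝ}
    (hx : J.MemSigned σ x) : 0 < T.returnTime J σ x := by
  rw [returnTime_pos_iff]
  by_contra! hno
  obtain ⟨x₁, x₂, hlt, hp, hm, hsub, hav⟩ := exists_Ioo_avoiding (finite_preBranch hJ.1) hx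
  have R := hJ.rigid hx hlt hp hm hsub hav hno
  have hv := fun n => (valid_of_memSigned (hJ.1.trans T.attractor_subset) hx).orbit T n
  obtain ⟨n, m, hnm, hd⟩ := exists_close_pair (f := fun n => T.orbit σ x n)
    (fun n => by have := hv n; cases σ; exacts [this.1, this.1.le])
    (fun n => by have := hv n; cases σ; exacts [this.2.le, this.2]) (sub_pos.2 hlt)
  set e := T.orbit σ x n - T.orbit σ x m with he
  obtain ⟨hd₁, hd₂⟩ := abs_lt.1 hd
  -- Two points placed symmetrically about the midpoint at distance `|e|`, so that the difference
  -- `e` of the two translations is compensated and `T^n` of the first equals `T^m` of the second.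
  -- By injectivity the first is then `T^(m-n)` of the second, a return to `J` that rigidity
  -- excludes.
  have hz : (x₁ + x₂) / 2 - e / 2 ∈ Set.Ioo x₁ x₂ := ⟨by linarith, by linarith⟩
  have hz' : (x₁ + x₂) / 2 + e / 2 ∈ Set.Ioo x₁ x₂ := ⟨by linarith, by linarith⟩
  have key : T.orbit .plus ((x₁ + x₂) / 2 - e / 2) n = T.orbit .plus ((x₁ + x₂) / 2 + e / 2) m := by
    rw [(R n _ hz).1, (R m _ hz').1, he]; ring
  have := (signedMemX_of_memSigned hJ.1 (σ := .plus) (hsub hz)).orbit_inj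
    (signedMemX_of_memSigned hJ.1 (σ := .plus) (hsub hz')) hnm.le key
  exact (R (m - n) _ hz').2 (by omega) (this ▸ hsub hz)

/-- The two sides of a point can separate only at a discontinuity. -/
lemma orbit_minus_eq_plus {z : ℝ} (hz₀ : 0 < z) (hz₁ : z < 1) {l : ℕ}
    (h : ∀ t < l, ¬ T.IsDisc (T.orbit .plus z t)) :
    T.orbit .minus z l = T.orbit .plus z l := by
  induction l with
  | zero => rfl
  | succ l ih =>
    have e := ih fun t ht => h t (by omega)
    have hm := Valid.orbit T (σ := .minus) (x := z) ⟨hz₀, hz₁.le⟩ l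
    obtain ⟨s, hs⟩ := T.exists_inPiece (Valid.orbit T (σ := .plus) (x := z) ⟨hz₀.le, hz₁⟩ l)
    have hs' : T.InPiece .minus s (T.orbit .minus z l) := by
      rw [e]
      refine ⟨lt_of_le_of_ne hs.1 fun heq => h l (Nat.lt_add_one l) ?_, hs.2.le⟩
      rw [← heq]
      refine T.isDisc_castSucc ?_
      rw [heq, ← e]
      exact hm.1
    rw [orbit_succ, orbit_succ, hs'.step_eq, hs.step_eq, e]

/-- `z⁻` accompanies `z⁺` up to the first landing of `z⁺`. It could miss this landing only by
returning to `J` earlier at a place where `z⁺` does not return, which can only be `J.right`; but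
then `J.right⁺` would lie in `X`, against maximality. -/
lemma IsComponent.numLandings_minus_pos (hJ : T.IsComponent J) {z : ℝ} (hl : J.left < z)
    (hr : z < J.right) (h : 0 < T.numLandings J .plus z) : 0 < T.numLandings J .minus z := by
  have hv : Valid .plus z := valid_of_memSigned (J := J) (hJ.1.trans T.attractor_subset) ⟨hl.le, hr⟩
  have hz₀ : 0 < z := lt_of_le_of_lt
    (hJ.1.trans T.attractor_subset (⟨le_rfl, J.left_lt_right⟩ : J.left ∈ J.toSet)).1 hl
  have hρ := hJ.returnTime_pos (σ := .minus) (x := z) ⟨hl, hr.le⟩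
  set l := T.landTime .plus z 1 with hl'
  have hlt : l < T.returnTime J .plus z := landTime_lt le_rfl h
  have he : ∀ t ≤ l, T.orbit .minus z t = T.orbit .plus z t := fun t ht =>
    orbit_minus_eq_plus hz₀ hv.2 fun u hu => not_isDisc_before h (hu.trans_le ht)
  have hlρ : l < T.returnTime J .minus z := by
    by_contra! hc
    have h₁ := memSigned_returnTime hρ
    have h₂ := not_memSigned_of_lt (T := T) (J := J) (σ := .plus) (a := z) hρ (hc.trans_lt hlt)
    have h₃ := (signedMemX_of_memSigned hJ.1 (σ := .plus) (x := z) ⟨hl.le, hr⟩).orbit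
      (T.returnTime J .minus z)
    rw [he _ hc] at h₁
    have : T.orbit .plus z (T.returnTime J .minus z) = J.right := by
      refine le_antisymm h₁.2 ?_
      by_contra! hlt'
      exact h₂ ⟨h₁.1.le, hlt'⟩
    rw [this] at h₃
    exact hJ.not_signedMemX_right h₃
  refine numLandings_pos_iff.2 ⟨l, hlρ, ?_⟩
  rw [he l le_rfl]
  exact isDisc_landPt le_rfl h

end Component

/-! ### Periodic intervals -/

section Periodic

variable {T : ITM r} {J : HOInterval}

lemma left_mem (J : HOInterval) : J.left ∈ J.toSet := ⟨le_rfl, J.left_lt_right⟩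

lemma IsPeriodicInterval.subset_attractor (hJ : T.IsPeriodicInterval J) :
    J.toSet ⊆ T.attractor := by
  intro z hz
  refine Set.mem_iInter.2 fun n => ?_
  obtain ⟨p, hp, hz'⟩ := hJ.2.1 z hz
  refine ⟨T.map^[n * p - n] z, T.mapsTo_map.iterate _ (hJ.1 hz), ?_⟩
  rw [← Function.iterate_add_apply, Nat.add_sub_cancel' (Nat.le_mul_of_pos_right n hp)]
  exact hz'.const_mul n

lemma orbit_eq_add_of_itinerary {z w : ℝ} (hz : Valid .plus z)
    (h : ∀ n s, T.InPiece .plus s (T.orbit .plus z n) ↔ T.InPiece .plus s (T.orbit .plus w n))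
    (n : ℕ) : T.orbit .plus w n - w = T.orbit .plus z n - z := by
  induction n with
  | zero => simp [orbit_zero]
  | succ n ih =>
    obtain ⟨s, hs⟩ := T.exists_inPiece (hz.orbit T n)
    rw [orbit_succ, orbit_succ, hs.step_eq, ((h n s).1 hs).step_eq]
    linarith

/-- The common itinerary passes to signed points, the end `right⁻` included, because each of them
has a germ inside `J`. -/
lemma IsPeriodicInterval.orbit_signed (hJ : T.IsPeriodicInterval J) {σ : Side} {x z : ℝ}
    (hx : J.MemSigned σ x) (hz : z ∈ J.toSet) (n : ℕ) :
    T.orbit σ x n - x = T.orbit .plus z n - z ∧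
      ∀ s, T.InPiece σ s (T.orbit σ x n) ↔ T.InPiece .plus s (T.orbit .plus z n) := by
  obtain ⟨ε, hε, H⟩ := T.germ_orbit (valid_of_memSigned hJ.1 hx) n
  obtain ⟨ε', hε', H'⟩ := memSigned_germ hx
  obtain ⟨y, hy⟩ := germ_nonempty σ x (lt_min hε hε')
  have hyJ := H' (germ_mono _ _ (min_le_right _ _) hy)
  obtain ⟨h₁, h₂⟩ := H y (germ_mono _ _ (min_le_left _ _) hy) n le_rfl
  have h₃ := orbit_eq_add_of_itinerary (T := T) (w := y) (hJ.1 hz)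
    (fun n s => hJ.2.2 z hz y hyJ n s) n
  refine ⟨by linarith, fun s => (h₂ s).symm.trans (hJ.2.2 y hyJ z hz n s)⟩

/-- An interior discontinuity would lie in a different piece from the left endpoint, already at time
`0`. -/
lemma IsPeriodicInterval.not_isDisc (hJ : T.IsPeriodicInterval J) {z : ℝ} (hl : J.left < z)
    (hr : z < J.right) : ¬ T.IsDisc z := by
  rintro ⟨i, hi⟩
  have hi' : i.1 + 1 < r := by omega
  have h₁ : T.InPiece .plus ⟨i + 1, hi'⟩ z := by
    have : z = T.β (Fin.castSucc ⟨i + 1, hi'⟩) := hi.symm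
    rw [this]
    exact ⟨le_rfl, T.strictMono Fin.castSucc_lt_succ⟩
  have h₂ := (hJ.2.2 z ⟨hl.le, hr⟩ J.left (left_mem J) 0 ⟨i + 1, hi'⟩).1 h₁
  have h₃ : T.disc i ≤ J.left := h₂.1
  linarith

lemma IsPeriodicInterval.returnTime_pos (hJ : T.IsPeriodicInterval J) {σ : Side} {x : ℝ}
    (hx : J.MemSigned σ x) : 0 < T.returnTime J σ x := by
  obtain ⟨p, hp, hz⟩ := hJ.2.1 J.left (left_mem J)
  refine returnTime_pos_iff.2 ⟨p, hp, ?_⟩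
  have h := (hJ.orbit_signed hx (left_mem J) p).1
  have : T.orbit .plus J.left p = J.left := hz
  rw [this, sub_self, sub_eq_zero] at h
  rwa [h]

/-- The first return to a periodic interval is the identity. -/
lemma IsPeriodicInterval.isPeriodicPt (hJ : T.IsPeriodicInterval J) {σ : Side} {x : ℝ}
    (hx : J.MemSigned σ x) {z : ℝ} (hz : z ∈ J.toSet) :
    T.orbit .plus z (T.returnTime J σ x) = z := by
  set ρ := T.returnTime J σ x with hρ
  have hpos := hJ.returnTime_pos hx
  have hret := memSigned_returnTime hpos
  rw [← hρ] at hret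
  set δ := T.orbit σ x ρ - x with hδ
  obtain ⟨ε₁, hε₁, H₁⟩ := memSigned_germ hx
  obtain ⟨ε₂, hε₂, H₂⟩ := memSigned_germ hret
  obtain ⟨y, hy⟩ := germ_nonempty σ x (lt_min hε₁ hε₂)
  have hyJ := H₁ (germ_mono _ _ (min_le_left _ _) hy)
  have hyδ : T.orbit .plus y ρ = y + δ := by
    have := (hJ.orbit_signed hx hyJ ρ).1
    linarith
  have hyJ' : y + δ ∈ J.toSet := by
    refine H₂ (germ_mono _ _ (min_le_right ε₁ _) ?_)
    have := (add_mem_germ δ).2 hy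
    rwa [hδ, add_sub_cancel, ← hδ] at this
  -- The return shifts `y` by `δ` inside `J`, and `y + δ` has the itinerary of `y`, so the shift
  -- repeats at every multiple of `ρ`. Periodicity of `y` then forces `δ = 0`.
  have hk : ∀ k : ℕ, T.orbit .plus y (ρ * k) = y + k * δ := by
    intro k
    induction k with
    | zero => simp [orbit_zero]
    | succ k ih =>
      have e := orbit_eq_add_of_itinerary (T := T) (w := y + δ) (hJ.1 hyJ)
        (fun n s => hJ.2.2 y hyJ _ hyJ' n s) (ρ * k)
      rw [Nat.mul_succ, add_comm, orbit_add, hyδ]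
      push_cast
      linarith
  obtain ⟨p, hp, hy'⟩ := hJ.2.1 y hyJ
  have h₁ : T.orbit .plus y (ρ * p) = y := hy'.const_mul ρ
  rw [hk] at h₁
  have hδ0 : δ = 0 := by
    have : (p : ℝ) * δ = 0 := by linarith
    exact (mul_eq_zero.1 this).resolve_left (by exact_mod_cast hp.ne')
  have := (hJ.orbit_signed hx hz ρ).1
  linarith

/-- If the right endpoint of a maximal periodic interval does not land on a discontinuity, then it
lands on the right endpoint of `[0,1)`. -/
lemma IsMaxPeriodic.exists_orbit_eq_one (hJ : T.IsMaxPeriodic J) (h : T.perM J .minus = 0) :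
    ∃ t < T.returnTime J .minus J.right, T.orbit .minus J.right t = 1 := by
  by_contra! hne
  obtain ⟨hP, hmax⟩ := hJ
  have hx : J.MemSigned .minus J.right := memSigned_endpoint J .minus
  set ρ := T.returnTime J .minus J.right with hρ
  have hpos : 0 < ρ := hP.returnTime_pos hx
  have hper : ∀ z ∈ J.toSet, T.orbit .plus z ρ = z := fun z hz => hP.isPeriodicPt hx hz
  have hnd : ∀ t < ρ, ¬ T.IsDisc (T.orbit .minus J.right t) := by
    intro t ht hd
    exact (numLandings_pos_iff.2 ⟨t, ht, hd⟩ : 0 < T.perM J .minus).ne' h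
  -- The right end of a piece is a discontinuity or `1`, and both are excluded along this orbit;
  -- hence `J.right⁺` follows the itinerary of `J.right⁻`.
  have hpiece : ∀ t < ρ, ∀ s, T.InPiece .minus s (T.orbit .minus J.right t) →
      T.InPiece .plus s (T.orbit .minus J.right t) := by
    intro t ht s hs
    refine ⟨hs.1.le, lt_of_le_of_ne hs.2 fun heq => ?_⟩
    rcases (T.β_le_one s.succ).lt_or_eq with h₁ | h₁
    · exact hnd t ht (heq ▸ T.isDisc_succ h₁)
    · exact hne t ht (heq.trans h₁)
  have hv := (valid_of_memSigned hP.1 hx).orbit T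
  have horb : ∀ t ≤ ρ, T.orbit .plus J.right t = T.orbit .minus J.right t := by
    intro t ht
    induction t with
    | zero => rfl
    | succ t ih =>
      obtain ⟨s, hs⟩ := T.exists_inPiece (hv t)
      have e := ih (by omega)
      rw [orbit_succ, orbit_succ, hs.step_eq, e, (hpiece t (by omega) s hs).step_eq]
  obtain ⟨s₀, hs₀⟩ := T.exists_inPiece (hv 0)
  have hval : Valid .plus J.right := (hpiece 0 hpos s₀ hs₀).valid
  obtain ⟨ε, hε, H⟩ := T.germ_orbit hval ρ
  have hleft : J.left ∈ J.toSet := left_mem J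
  have hit : ∀ w ∈ germ .plus J.right ε, ∀ t < ρ, ∀ s,
      T.InPiece .plus s (T.orbit .plus J.left t) ↔ T.InPiece .plus s (T.orbit .plus w t) := by
    intro w hw t ht s
    rw [(H w hw t ht.le).2 s, horb t ht.le, ← (hP.orbit_signed hx hleft t).2 s]
    refine ⟨hpiece t ht s, fun hs => ?_⟩
    obtain ⟨s', hs'⟩ := T.exists_inPiece (hv t)
    rw [T.inPiece_unique hs (hpiece t ht s' hs')]
    exact hs'
  have hperw : ∀ w ∈ germ .plus J.right ε, T.orbit .plus w ρ = w := by
    intro w hw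
    have h₁ := (hP.orbit_signed hx hleft ρ).1
    rw [hper _ hleft, sub_self] at h₁
    rw [(H w hw ρ le_rfl).1, horb ρ le_rfl, h₁, add_zero]
  have hmod : ∀ z, T.orbit .plus z ρ = z → ∀ n, T.orbit .plus z n = T.orbit .plus z (n % ρ) := by
    intro z hz n
    exact (Function.IsPeriodicPt.iterate_mod_apply (f := T.map) hz n).symm
  -- The points of the right germ at `J.right` have period `ρ` and the itinerary of `J`, so this
  -- longer periodic interval contradicts maximality.
  let K : HOInterval := ⟨J.left, J.right + ε, by linarith [J.left_lt_right]⟩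
  have hK : ∀ z ∈ K.toSet, z ∈ J.toSet ∨ z ∈ germ .plus J.right ε := by
    rintro z ⟨h₁, h₂⟩
    by_cases hz : z < J.right
    · exact Or.inl ⟨h₁, hz⟩
    · exact Or.inr ⟨not_lt.1 hz, h₂⟩
  have hKper : ∀ z ∈ K.toSet, T.orbit .plus z ρ = z := fun z hz =>
    (hK z hz).elim (hper z) (hperw z)
  have hKit : ∀ z ∈ K.toSet, ∀ n s,
      T.InPiece .plus s (T.orbit .plus J.left n) ↔ T.InPiece .plus s (T.orbit .plus z n) := by
    intro z hz n s
    rcases hK z hz with h₁ | h₁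
    · exact hP.2.2 _ hleft z h₁ n s
    · rw [hmod _ (hper _ hleft) n, hmod z (hKper z hz) n]
      exact hit z h₁ _ (Nat.mod_lt _ hpos) s
  have hsub := hmax K ⟨?_, ?_, ?_⟩ (Set.Ico_subset_Ico_right (by simp [K, hε.le]))
  · have : J.right ∈ J.toSet := hsub ⟨J.left_lt_right.le, by simp [K, hε]⟩
    exact lt_irrefl _ this.2
  · intro z hz
    rcases hK z hz with h₁ | h₁
    · exact hP.1 h₁
    · obtain ⟨s, hs⟩ := T.exists_inPiece (σ := .plus) (hP.1 hleft)
      exact ((hit z h₁ 0 hpos s).1 hs).valid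
  · exact fun z hz => ⟨ρ, hpos, hKper z hz⟩
  · exact fun z hz w hw n s => (hKit z hz n s).symm.trans (hKit w hw n s)

end Periodic

end ITM

namespace ITM
variable {r n : ℕ}

/-! ### Formal linear combinations -/

/-- The indices `j` for which `a_j^σ` is a signed point of `J`. -/
noncomputable def idx (T : ITM r) (J : HOInterval) : Side → Finset ℕ
  | .plus => range (T.branchCount J)
  | .minus => Icc 1 (T.branchCount J)

/-- The formal combination of the vectors `C^σ(j,k)` and `R_j^σ` of `J`. -/
noncomputable def sideF (T : ITM r) (J : HOInterval) (aC : ℕ → ℕ → ℝ) (aR : ℕ → ℝ) (σ : Side) :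
    FV :=
  ∑ j ∈ T.idx J σ, ((∑ k ∈ Ico 1 (T.m J σ j), aC j k • T.connF σ (T.branchPt J j) k) +
    aR j • T.returnF J σ (T.branchPt J j))

open Classical in
/-- The formal combination of the landing vectors of `J`. -/
noncomputable def landsF (T : ITM r) (J : HOInterval) (aL : ℕ → ℝ) : FV :=
  ∑ j ∈ (range (T.branchCount J + 1)).filter (fun j => T.Lands J j),
    aL j • T.landF (T.landSide J j) (T.branchPt J j)

/-- The formal combination of the vectors of a component interval. -/
noncomputable def compF (T : ITM r) (J : HOInterval) (a : Coeffs n r) : FV :=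
  T.sideF J (a.aC .plus) (a.aR .plus) .plus + T.sideF J (a.aC .minus) (a.aR .minus) .minus +
    T.landsF J a.aL

/-- The formal combination of the vectors `C^σ(k)` of a periodic interval. -/
noncomputable def sidePerF (T : ITM r) (J : HOInterval) (aP : ℕ → ℝ) (σ : Side) : FV :=
  ∑ k ∈ Icc 1 (T.perM J σ), aP k • T.perF J σ k

/-- The formal combination of the vectors of the `i`-th periodic interval. -/
noncomputable def perComb (T : ITM r) (J : HOInterval) (a : Coeffs n r) (i : Fin n) : FV :=
  T.sidePerF J (a.aP .plus i) .plus + T.sidePerF J (a.aP .minus i) .minus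

/-- The formal combination of the vectors of the discontinuities outside the attractor. -/
noncomputable def outF (T : ITM r) (aX : SDisc r → ℝ) : FV := ∑ b ∈ T.outside, aX b • T.genF b

lemma toW_total (T : ITM r) (J₀ : HOInterval) (J : Fin n → HOInterval) (a : Coeffs n r) :
    T.toW (T.compF J₀ a + (∑ i, T.perComb (J i) a i) + T.outF a.aX) = T.lincomb J₀ J a := by
  simp only [compF, sideF, landsF, perComb, sidePerF, outF, idx, map_add, map_sum, map_smul,
    toW_connF, toW_returnF, toW_landF, toW_perF, toW_genF, Finset.sum_add_distrib, lincomb, L, C, R]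
  abel

section Carried

variable {T : ITM r} {J : HOInterval}

lemma mem_idx_plus {j : ℕ} : j ∈ T.idx J .plus ↔ j < T.branchCount J := Finset.mem_range

lemma mem_idx_minus {j : ℕ} : j ∈ T.idx J .minus ↔ 1 ≤ j ∧ j ≤ T.branchCount J := Finset.mem_Icc

lemma le_of_mem_idx {σ : Side} {j : ℕ} (h : j ∈ T.idx J σ) : j ≤ T.branchCount J := by
  cases σ
  · exact (mem_idx_plus.1 h).le
  · exact (mem_idx_minus.1 h).2

lemma memSigned_branchPt (hB : {z | T.IsBranchPoint J z}.Finite) {σ : Side} {j : ℕ}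
    (h : j ∈ T.idx J σ) : J.MemSigned σ (T.branchPt J j) := by
  cases σ
  · exact memSigned_branchPt_plus hB (mem_idx_plus.1 h)
  · exact memSigned_branchPt_minus hB (mem_idx_minus.1 h).1 (mem_idx_minus.1 h).2

lemma landSide_mem_idx {j : ℕ} (hj : j ≤ T.branchCount J) : j ∈ T.idx J (T.landSide J j) := by
  unfold landSide
  split_ifs with h
  · exact mem_idx_plus.2 h
  · exact mem_idx_minus.2 ⟨by have := T.branchCount_pos J; omega, hj⟩

lemma sideF_mem_carried (hJ : T.IsComponent J) (aC : ℕ → ℕ → ℝ) (aR : ℕ → ℝ) (σ : Side) :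
    T.sideF J aC aR σ ∈ T.carried J := by
  have hB := finite_isBranchPoint hJ.1
  refine sum_mem fun j hj => add_mem (sum_mem fun k hk => Submodule.smul_mem _ _ ?_)
    (Submodule.smul_mem _ _ ?_)
  · exact connF_mem_carried (memSigned_branchPt hB hj) (Finset.mem_Ico.1 hk).1
      (Finset.mem_Ico.1 hk).2
  · exact returnF_mem_carried (memSigned_branchPt hB hj)
      (hJ.returnTime_pos (memSigned_branchPt hB hj))

lemma compF_mem_carried (hJ : T.IsComponent J) (a : Coeffs n r) :
    T.compF J a ∈ T.carried J := by
  classical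
  have hB := finite_isBranchPoint hJ.1
  refine add_mem (add_mem (sideF_mem_carried hJ _ _ _) (sideF_mem_carried hJ _ _ _))
    (sum_mem fun j hj => Submodule.smul_mem _ _ ?_)
  rw [Finset.mem_filter, Finset.mem_range] at hj
  exact landF_mem_carried (memSigned_branchPt hB (landSide_mem_idx (by omega))) hj.2

lemma perF_mem_carried {σ : Side} {k : ℕ} (hk : 1 ≤ k) (h : k ≤ T.perM J σ) :
    T.perF J σ k ∈ T.carried J := by
  have he := memSigned_endpoint J σ
  have hpos : 0 < T.numLandings J σ (J.endpoint σ) := hk.trans h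
  unfold perF
  split_ifs with e
  · exact add_mem (returnF_mem_carried he (returnTime_pos_of_numLandings hpos))
      (landF_mem_carried he hpos)
  · exact connF_mem_carried he hk (lt_of_le_of_ne h e)

/-- Adding the landing vector to the last return vector pairs the sink in `J` with a source in `J`.
Each vector of a periodic interval is therefore balanced by itself. -/
lemma massOn_sources_perF {σ : Side} {k : ℕ} (hk : 1 ≤ k) (h : k ≤ T.perM J σ) :
    massOn (fun _ => True) (T.sources (T.perF J σ k)) = 0 := by
  unfold perF
  split_ifs with e
  · rw [map_add, sources_returnF_of_pos (hk.trans h), sources_landF, map_add, map_neg,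
      massOn_single, massOn_single]
    simp
  · rw [sources_connF hk (lt_of_le_of_ne h e), map_zero]

lemma perComb_mem_carried (a : Coeffs n r) (i : Fin n) : T.perComb J a i ∈ T.carried J :=
  add_mem (sum_mem fun _ hk => Submodule.smul_mem _ _
      (perF_mem_carried (Finset.mem_Icc.1 hk).1 (Finset.mem_Icc.1 hk).2))
    (sum_mem fun _ hk => Submodule.smul_mem _ _
      (perF_mem_carried (Finset.mem_Icc.1 hk).1 (Finset.mem_Icc.1 hk).2))

lemma massOn_sources_perComb (a : Coeffs n r) (i : Fin n) :
    massOn (fun _ => True) (T.sources (T.perComb J a i)) = 0 := by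
  have h : ∀ σ, massOn (fun _ => True) (T.sources (T.sidePerF J (a.aP σ i) σ)) = 0 := by
    intro σ
    rw [sidePerF, map_sum, map_sum]
    refine Finset.sum_eq_zero fun k hk => ?_
    rw [map_smul, map_smul, massOn_sources_perF (Finset.mem_Icc.1 hk).1 (Finset.mem_Icc.1 hk).2,
      smul_zero]
  rw [perComb, map_add, map_add, h, h, add_zero]

lemma disc_mem_Ioo (T : ITM r) (i : Fin (r - 1)) : 0 < T.disc i ∧ T.disc i < 1 := by
  constructor
  · rw [← T.β_zero]
    exact T.strictMono (by rw [Fin.lt_def]; simp)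
  · rw [← T.β_last]
    refine T.strictMono ?_
    rw [Fin.lt_def]
    have := i.2
    simp only [Fin.val_last]
    omega

lemma valid_disc (T : ITM r) (σ : Side) (i : Fin (r - 1)) : Valid σ (T.disc i) := by
  have := T.disc_mem_Ioo i
  cases σ
  · exact ⟨this.1.le, this.2⟩
  · exact ⟨this.1, this.2.le⟩

lemma mem_outside {b : SDisc r} :
    b ∈ T.outside ↔ T.EventuallyLands b ∧ ¬ T.SignedMemX b.1 (T.disc b.2) := by
  classical
  simp [outside]

lemma firstLanding_spec {b : SDisc r} (h : T.EventuallyLands b) :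
    0 < T.firstLanding b ∧ T.IsDisc (T.orbit b.1 (T.disc b.2) (T.firstLanding b)) :=
  Nat.sInf_mem (s := {n : ℕ | 0 < n ∧ T.IsDisc (T.orbit b.1 (T.disc b.2) n)}) h

lemma sources_genF (b : SDisc r) : T.sources (T.genF b) = 0 := by
  rw [genF, sources_seg]; abel

lemma sources_outF (aX : SDisc r → ℝ) : T.sources (T.outF aX) = 0 := by
  rw [outF, map_sum]
  refine Finset.sum_eq_zero fun b _ => ?_
  rw [map_smul, sources_genF, smul_zero]

lemma outF_fst_mem (aX : SDisc r → ℝ) :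
    (T.outF aX).1 ∈ Finsupp.supported ℝ ℝ {q : SP | Valid q.1 q.2} := by
  rw [outF, Prod.fst_sum]
  refine sum_mem fun b _ => Submodule.smul_mem _ _ ?_
  rw [mem_supported_iff_apply]
  intro q hq
  obtain ⟨t, -, rfl⟩ := seg_apply_ne_zero hq
  exact (T.valid_disc b.1 b.2).orbit T t

lemma outF_snd_mem (aX : SDisc r → ℝ) :
    (T.outF aX).2 ∈ Finsupp.supported ℝ ℝ {q : SP | T.IsDisc q.2} := by
  rw [outF, Prod.snd_sum]
  refine sum_mem fun b hb => Submodule.smul_mem _ _ (sub_mem ?_ ?_)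
  · exact Finsupp.single_mem_supported _ _ ⟨b.2, rfl⟩
  · exact Finsupp.single_mem_supported _ _ (firstLanding_spec (mem_outside.1 hb).1).2

/-- To the left of `J` none of the weight of `g` is counted, to the right all of it, and the total
is zero. -/
lemma cum_eq_zero_of_balanced {g : SP →₀ ℝ} (h : g ∈ Finsupp.supported ℝ ℝ (signed J))
    (h₀ : massOn (fun _ => True) g = 0) {σ : Side} {y : ℝ} (hy : ¬ J.MemSigned σ y) :
    cum σ y g = 0 := by
  rw [mem_supported_iff_apply] at h
  have hb : ∀ q, g q ≠ 0 → J.left ≤ q.2 ∧ q.2 ≤ J.right := by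
    rintro ⟨τ, x⟩ hq
    have := h _ hq
    cases τ
    · exact ⟨this.1, this.2.le⟩
    · exact ⟨this.1.le, this.2⟩
  cases σ
  · rcases lt_or_ge y J.left with hlt | hge
    · refine massOn_eq_zero fun q hq => ?_
      by_contra hne
      have hq : q.2 ≤ y := hq
      linarith [(hb q hne).1]
    · rw [← h₀]
      refine massOn_congr fun q hq => ⟨fun _ => trivial, fun _ => ?_⟩
      change q.2 ≤ y
      by_contra! hc
      exact hy ⟨hge, hc.trans_le (hb q hq).2⟩
  · rcases le_or_gt y J.left with hlt | hge
    · refine massOn_eq_zero fun q hq => ?_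
      by_contra hne
      have hq : q.2 < y := hq
      linarith [(hb q hne).1]
    · rw [← h₀]
      refine massOn_congr fun q hq => ⟨fun _ => trivial, fun _ => ?_⟩
      change q.2 < y
      by_contra! hc
      exact hy ⟨hge, hc.trans (hb q hq).2⟩

end Carried

/-- A component interval and maximal periodic intervals with pairwise disjoint orbits. -/
structure Config (T : ITM r) (J₀ : HOInterval) (J : Fin n → HOInterval) : Prop where
  comp : T.IsComponent J₀
  per : ∀ i, T.IsMaxPeriodic (J i)
  disj₀ : ∀ i, Disjoint (T.orbitSet J₀.toSet) (T.orbitSet (J i).toSet)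
  disj : ∀ i i', i ≠ i' → Disjoint (T.orbitSet (J i).toSet) (T.orbitSet (J i').toSet)

/-- The signed points of the given intervals. -/
def allSigned (J₀ : HOInterval) (J : Fin n → HOInterval) : Set SP :=
  {q | q ∈ signed J₀ ∨ ∃ i, q ∈ signed (J i)}

/-! ### The flow of a vanishing combination. -/

namespace Config

variable {T : ITM r} {J₀ : HOInterval} {J : Fin n → HOInterval} (hc : Config T J₀ J)
  {a : Coeffs n r}

include hc

lemma sub (i : Fin n) : (J i).toSet ⊆ T.attractor := (hc.per i).1.subset_attractor

lemma disjoint₀ (i : Fin n) : Disjoint (T.signedOrbit J₀) (T.signedOrbit (J i)) :=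
  disjoint_signedOrbit (hc.comp.1.trans T.attractor_subset) (hc.per i).1.1 (hc.disj₀ i)

lemma disjoint {i i' : Fin n} (h : i ≠ i') :
    Disjoint (T.signedOrbit (J i)) (T.signedOrbit (J i')) :=
  disjoint_signedOrbit (hc.per i).1.1 (hc.per i').1.1 (hc.disj i i' h)

lemma flow (ha : T.lincomb J₀ J a = 0) :
    Flow T (allSigned J₀ J)
      (T.compF J₀ a + (∑ i, T.perComb (J i) a i) + T.outF a.aX).1
      (T.compF J₀ a + (∑ i, T.perComb (J i) a i) + T.outF a.aX).2 := by
  rw [← T.toW_total] at ha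
  set v := T.compF J₀ a + (∑ i, T.perComb (J i) a i) + T.outF a.aX with hv
  have hmass : ∀ s, massOn (fun q => T.InPiece q.1 s q.2) v.1 = 0 :=
    fun s => congrFun (congrArg Prod.fst ha) s
  have hcons : ∀ i, massOn (fun q => T.disc i = q.2) v.2 = 0 :=
    fun i => congrFun (congrArg Prod.snd ha) i
  have hcarr : ∀ K : HOInterval, K.toSet ⊆ T.attractor → ∀ u ∈ T.carried K,
      u.1 ∈ Finsupp.supported ℝ ℝ {q : SP | Valid q.1 q.2} ∧
      u.2 ∈ Finsupp.supported ℝ ℝ {q : SP | T.IsDisc q.2} := by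
    intro K hK u hu
    refine ⟨Finsupp.supported_mono ?_ hu.1.1, Finsupp.supported_mono ?_ hu.1.2⟩
    · exact fun q hq => (signedMemX_of_signedOrbit hK hq).valid
    · exact fun q hq => hq.2
  have h₀ := hcarr J₀ hc.comp.1 _ (compF_mem_carried hc.comp a)
  have h₁ := fun i => hcarr (J i) (hc.sub i) _ (perComb_mem_carried a i)
  have hvalid : v.1 ∈ Finsupp.supported ℝ ℝ {q : SP | Valid q.1 q.2} := by
    rw [hv, Prod.fst_add, Prod.fst_add, Prod.fst_sum]
    exact add_mem (add_mem h₀.1 (sum_mem fun i _ => (h₁ i).1)) (outF_fst_mem _)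
  have hdisc : v.2 ∈ Finsupp.supported ℝ ℝ {q : SP | T.IsDisc q.2} := by
    rw [hv, Prod.snd_add, Prod.snd_add, Prod.snd_sum]
    exact add_mem (add_mem h₀.2 (sum_mem fun i _ => (h₁ i).2)) (outF_snd_mem _)
  rw [mem_supported_iff_apply] at hvalid hdisc
  refine ⟨hvalid, hmass, hdisc, hcons, ?_, ?_⟩
  · intro σ y hy
    have hsrc : T.sources v =
        T.sources (T.compF J₀ a) + ∑ i, T.sources (T.perComb (J i) a i) := by
      rw [hv, map_add, map_add, map_sum, sources_outF, add_zero]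
    -- Push-forward preserves total weight and `d` has total zero. As the periodic parts are
    -- balanced separately, the part of `J₀` must be balanced too, although its individual vectors
    -- need not be.
    have htot : massOn (fun _ => True) (T.sources v) = 0 := by
      rw [sources_apply, map_sub, map_sub, massOn_mapDomain,
        cum_eq_zero_of_disc hdisc hcons fun _ => True]
      simp
    rw [hsrc, map_add, map_sum, Finset.sum_eq_zero (fun i _ => massOn_sources_perComb a i),
      add_zero] at htot
    rw [← sources_apply, hsrc, map_add, map_sum,
      cum_eq_zero_of_balanced (compF_mem_carried hc.comp a).2 htot fun h => hy (Or.inl h),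
      zero_add]
    refine Finset.sum_eq_zero fun i _ => ?_
    exact cum_eq_zero_of_balanced (perComb_mem_carried a i).2 (massOn_sources_perComb a i)
      fun h => hy (Or.inr ⟨i, h⟩)
  · rintro y (h | ⟨i, h⟩)
    · exact hc.comp.1 h
    · exact hc.sub i h

end Config

/-! ### Discontinuities outside the attractor -/

/-- The sign of a side. -/
def sgn : Side → ℝ
  | .plus => 1
  | .minus => -1

/-- A discontinuity is the left end of one piece and the right end of another, which accounts for
the two signs. This translates statements about coefficients into statements about the step
function. -/
lemma Flow.cum_disc {T : ITM r} {U : Set SP} {w d : SP →₀ ℝ} (h : Flow T U w d) (σ : Side)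
    {x : ℝ} (hx : T.IsDisc x) : cum σ x w = sgn σ * w (σ, x) := by
  obtain ⟨i, rfl⟩ := hx
  cases σ
  · have := h.cum_left ⟨i + 1, by omega⟩
    rw [sgn, one_mul]
    exact this
  · have := h.cum_right ⟨i, by omega⟩
    rw [sgn, neg_one_mul]
    exact this

lemma sgn_mul_self (σ : Side) : sgn σ * sgn σ = 1 := by cases σ <;> simp [sgn]

lemma Flow.apply_disc {T : ITM r} {U : Set SP} {w d : SP →₀ ℝ} (h : Flow T U w d) (σ : Side)
    {x : ℝ} (hx : T.IsDisc x) : w (σ, x) = sgn σ * cum σ x w := by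
  rw [h.cum_disc σ hx, ← mul_assoc, sgn_mul_self, one_mul]

-- Each segment stops at its first discontinuity, so the only one with weight at `b` is the one
-- starting there.
open Classical in
lemma outF_apply {T : ITM r} (aX : SDisc r → ℝ) {b : SDisc r} (hb : b ∈ T.outside) :
    (T.outF aX).1 (b.1, T.disc b.2) = aX b := by
  rw [outF, Prod.fst_sum, Finsupp.finsetSum_apply, Finset.sum_eq_single b]
  · have hs := firstLanding_spec (mem_outside.1 hb).1
    rw [Prod.smul_fst, Finsupp.smul_apply, genF, seg_apply (S := {q | T.IsDisc q.2}) _ ⟨b.2, rfl⟩]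
    · simp [hs.1]
    · exact fun t ht ht' hd => Nat.notMem_of_lt_sInf ht' ⟨ht, hd⟩
  · intro b' _ hne
    rw [Prod.smul_fst, Finsupp.smul_apply, genF, seg_apply (S := {q | T.IsDisc q.2}) _ ⟨b.2, rfl⟩,
      if_neg, smul_zero]
    · rintro ⟨_, h⟩
      rw [Prod.mk.injEq] at h
      exact hne (Prod.ext h.1 (T.disc_injective h.2))
    · exact fun t ht ht' hd => Nat.notMem_of_lt_sInf ht' ⟨ht, hd⟩
  · exact fun h => absurd hb h

lemma carried_apply_eq_zero {T : ITM r} {J : HOInterval} {v : FV} (hv : v ∈ T.carried J) {q : SP}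
    (hq : q ∉ T.signedOrbit J) : v.1 q = 0 ∧ v.2 q = 0 := by
  constructor
  · by_contra hne
    exact hq (mem_supported_iff_apply.1 hv.1.1 q hne)
  · by_contra hne
    exact hq (mem_supported_iff_apply.1 hv.1.2 q hne).1

namespace Config

variable {T : ITM r} {J₀ : HOInterval} {J : Fin n → HOInterval} (hc : Config T J₀ J)
  {a : Coeffs n r}

include hc

/-- The step function vanishes off `X`, and so does the weight at `b`. The vectors of the intervals
live on orbits inside `X`, which leaves only the coefficient of `C_b` there. -/
lemma aX_eq_zero (ha : T.lincomb J₀ J a = 0) {b : SDisc r} (hb : b ∈ T.outside) :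
    a.aX b = 0 := by
  have hX := (mem_outside.1 hb).2
  have hF := hc.flow ha
  have h₁ := hF.apply_disc b.1 (x := T.disc b.2) ⟨b.2, rfl⟩
  have h₂ : cum b.1 (T.disc b.2)
      (T.compF J₀ a + (∑ i, T.perComb (J i) a i) + T.outF a.aX).1 = 0 := by
    by_contra hne
    exact hX (hF.signedMemX_of_cum_ne_zero hne)
  rw [h₂, mul_zero, Prod.fst_add, Prod.fst_add, Prod.fst_sum, Finsupp.add_apply,
    Finsupp.add_apply, Finsupp.finsetSum_apply, outF_apply _ hb,
    (carried_apply_eq_zero (compF_mem_carried hc.comp a)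
      fun h => hX (signedMemX_of_signedOrbit hc.comp.1 h)).1,
    Finset.sum_eq_zero fun i _ => (carried_apply_eq_zero (perComb_mem_carried a i)
      fun h => hX (signedMemX_of_signedOrbit (hc.sub i) h)).1] at h₁
  simpa using h₁

lemma flow_inside (ha : T.lincomb J₀ J a = 0) :
    Flow T (allSigned J₀ J) (T.compF J₀ a + ∑ i, T.perComb (J i) a i).1
      (T.compF J₀ a + ∑ i, T.perComb (J i) a i).2 := by
  have h := hc.flow ha
  have : T.outF a.aX = 0 := Finset.sum_eq_zero fun b hb => by
    rw [hc.aX_eq_zero ha hb, zero_smul]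
  rwa [this, add_zero] at h

lemma inside_apply₀ {q : SP} (hq : q ∈ T.signedOrbit J₀) :
    (T.compF J₀ a + ∑ i, T.perComb (J i) a i).1 q = (T.compF J₀ a).1 q ∧
    (T.compF J₀ a + ∑ i, T.perComb (J i) a i).2 q = (T.compF J₀ a).2 q := by
  have h := fun i => carried_apply_eq_zero (perComb_mem_carried (J := J i) (T := T) a i)
    (Set.disjoint_left.1 (hc.disjoint₀ i) hq)
  rw [Prod.fst_add, Prod.fst_sum, Prod.snd_add, Prod.snd_sum, Finsupp.add_apply,
    Finsupp.finsetSum_apply, Finsupp.add_apply, Finsupp.finsetSum_apply,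
    Finset.sum_eq_zero fun i _ => (h i).1, Finset.sum_eq_zero fun i _ => (h i).2, add_zero,
    add_zero]
  exact ⟨rfl, rfl⟩

lemma inside_apply {i : Fin n} {q : SP} (hq : q ∈ T.signedOrbit (J i)) :
    (T.compF J₀ a + ∑ i, T.perComb (J i) a i).1 q = (T.perComb (J i) a i).1 q := by
  rw [Prod.fst_add, Prod.fst_sum, Finsupp.add_apply, Finsupp.finsetSum_apply,
    (carried_apply_eq_zero (compF_mem_carried hc.comp a)
      (Set.disjoint_right.1 (hc.disjoint₀ i) hq)).1, zero_add, Finset.sum_eq_single i]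
  · intro i' _ hne
    exact (carried_apply_eq_zero (perComb_mem_carried a i')
      (Set.disjoint_left.1 (hc.disjoint hne.symm) hq)).1
  · simp

lemma inside_apply_of_not_signedMemX {q : SP} (hq : ¬ T.SignedMemX q.1 q.2) :
    (T.compF J₀ a + ∑ i, T.perComb (J i) a i).1 q = 0 ∧
    (T.compF J₀ a + ∑ i, T.perComb (J i) a i).2 q = 0 := by
  have h := fun i => carried_apply_eq_zero (perComb_mem_carried (J := J i) (T := T) a i)
    (fun h => hq (signedMemX_of_signedOrbit (hc.sub i) h))
  have h₀ := carried_apply_eq_zero (compF_mem_carried hc.comp a)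
    (fun h => hq (signedMemX_of_signedOrbit hc.comp.1 h))
  rw [Prod.fst_add, Prod.fst_sum, Prod.snd_add, Prod.snd_sum, Finsupp.add_apply,
    Finsupp.finsetSum_apply, Finsupp.add_apply, Finsupp.finsetSum_apply,
    Finset.sum_eq_zero fun i _ => (h i).1, Finset.sum_eq_zero fun i _ => (h i).2, h₀.1, h₀.2]
  simp

/-- The step function is constant along the orbit of a signed point of `J₀` until its return. -/
lemma cum_orbit₀ (ha : T.lincomb J₀ J a = 0) {σ : Side} {x : ℝ} (hx : J₀.MemSigned σ x) {t : ℕ}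
    (ht : t < T.returnTime J₀ σ x) :
    cum σ (T.orbit σ x t) (T.compF J₀ a + ∑ i, T.perComb (J i) a i).1 =
      cum σ x (T.compF J₀ a + ∑ i, T.perComb (J i) a i).1 := by
  refine (hc.flow_inside ha).cum_orbit (signedMemX_of_memSigned hc.comp.1 hx) t ?_
  rintro u hu hu' (h | ⟨i, h⟩)
  · exact not_memSigned_of_lt hu (hu'.trans_lt ht) h
  · exact Set.disjoint_left.1 (hc.disjoint₀ i) ⟨x, u, hx, rfl⟩ (signed_subset_signedOrbit _ _ h)

/-- The step function is constant along the orbit of a signed point of `J i` until its return. -/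
lemma cum_orbit (ha : T.lincomb J₀ J a = 0) {i : Fin n} {σ : Side} {x : ℝ}
    (hx : (J i).MemSigned σ x) {t : ℕ} (ht : t < T.returnTime (J i) σ x) :
    cum σ (T.orbit σ x t) (T.compF J₀ a + ∑ i, T.perComb (J i) a i).1 =
      cum σ x (T.compF J₀ a + ∑ i, T.perComb (J i) a i).1 := by
  refine (hc.flow_inside ha).cum_orbit (signedMemX_of_memSigned (hc.sub i) hx) t ?_
  rintro u hu hu' (h | ⟨i', h⟩)
  · exact Set.disjoint_left.1 (hc.disjoint₀ i) (signed_subset_signedOrbit _ _ h) ⟨x, u, hx, rfl⟩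
  · by_cases e : i' = i
    · subst e
      exact not_memSigned_of_lt hu (hu'.trans_lt ht) h
    · exact Set.disjoint_left.1 (hc.disjoint e) (signed_subset_signedOrbit _ _ h) ⟨x, u, hx, rfl⟩

end Config

end ITM

namespace ITM
variable {r n : ℕ}

/-! ### Weights of the vectors of a component interval -/

lemma seg_apply_other_side {T : ITM r} {σ τ : Side} (h : σ ≠ τ) (a x : ℝ) (l : ℕ) :
    T.seg σ a l (τ, x) = 0 := by
  by_contra hne
  obtain ⟨t, -, e⟩ := seg_apply_ne_zero hne
  exact h (congrArg Prod.fst e).symm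

lemma single_apply_other_side {σ τ : Side} (h : σ ≠ τ) (a x : ℝ) :
    (Finsupp.single (σ, a) (1 : ℝ) : SP →₀ ℝ) (τ, x) = 0 :=
  Finsupp.single_eq_of_ne fun e => h (congrArg Prod.fst e).symm

lemma landF_apply_other_side {T : ITM r} {σ τ : Side} (h : σ ≠ τ) (a x : ℝ) :
    (T.landF σ a).1 (τ, x) = 0 ∧ (T.landF σ a).2 (τ, x) = 0 := by
  refine ⟨seg_apply_other_side h _ _ _, ?_⟩
  rw [landF, Finsupp.neg_apply, single_apply_other_side h, neg_zero]

lemma connF_apply_other_side {T : ITM r} {σ τ : Side} (h : σ ≠ τ) (a x : ℝ) (k : ℕ) :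
    (T.connF σ a k).1 (τ, x) = 0 ∧ (T.connF σ a k).2 (τ, x) = 0 := by
  refine ⟨seg_apply_other_side h _ _ _, ?_⟩
  rw [connF, Finsupp.sub_apply, single_apply_other_side h, single_apply_other_side h, sub_zero]

lemma returnF_apply_other_side {T : ITM r} {J : HOInterval} {σ τ : Side} (h : σ ≠ τ) (a x : ℝ) :
    (T.returnF J σ a).1 (τ, x) = 0 ∧ (T.returnF J σ a).2 (τ, x) = 0 := by
  unfold returnF
  split_ifs
  · exact ⟨seg_apply_other_side h _ _ _, rfl⟩
  · exact ⟨seg_apply_other_side h _ _ _, single_apply_other_side h _ _⟩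

lemma perF_apply_other_side {T : ITM r} {J : HOInterval} {σ τ : Side} (h : σ ≠ τ) (x : ℝ)
    (k : ℕ) : (T.perF J σ k).1 (τ, x) = 0 := by
  unfold perF
  split_ifs
  · rw [Prod.fst_add, Finsupp.add_apply, (returnF_apply_other_side h _ _).1,
      (landF_apply_other_side h _ _).1, add_zero]
  · exact (connF_apply_other_side h _ _ _).1

lemma landPt_one_of_isDisc {T : ITM r} {J : HOInterval} {σ : Side} {a : ℝ}
    (hρ : 0 < T.returnTime J σ a) (hd : T.IsDisc a) :
    0 < T.numLandings J σ a ∧ T.landPt σ a 1 = a := by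
  obtain ⟨k, hk, hk', e⟩ := exists_landTime_eq (T := T) (J := J) (σ := σ) (a := a) hρ hd
  refine ⟨by omega, ?_⟩
  have : k = 1 := by
    by_contra hne
    have := landTime_lt_landTime (T := T) (J := J) (σ := σ) (a := a) le_rfl
      (show 1 < k by omega) hk'
    omega
  rw [landPt, ← this, e, orbit_zero]

section Eval

variable {T : ITM r} {J : HOInterval}

/-- The coefficient of the vector that starts at `β^σ(j,k)`. -/
noncomputable def coef (T : ITM r) (J : HOInterval) (aC : ℕ → ℕ → ℝ) (aR : ℕ → ℝ) (σ : Side)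
    (j k : ℕ) : ℝ := if k < T.m J σ j then aC j k else aR j

lemma sideF_fst_apply (aC : ℕ → ℕ → ℝ) (aR : ℕ → ℝ) (σ : Side) (q : SP) :
    (T.sideF J aC aR σ).1 q = ∑ j ∈ T.idx J σ,
      ((∑ k ∈ Ico 1 (T.m J σ j), aC j k * (T.connF σ (T.branchPt J j) k).1 q) +
        aR j * (T.returnF J σ (T.branchPt J j)).1 q) := by
  simp only [sideF, Prod.fst_sum, Finsupp.finsetSum_apply, Prod.fst_add, Finsupp.add_apply,
    Prod.smul_fst, Finsupp.smul_apply, smul_eq_mul]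

lemma sideF_snd_apply (aC : ℕ → ℕ → ℝ) (aR : ℕ → ℝ) (σ : Side) (q : SP) :
    (T.sideF J aC aR σ).2 q = ∑ j ∈ T.idx J σ,
      ((∑ k ∈ Ico 1 (T.m J σ j), aC j k * (T.connF σ (T.branchPt J j) k).2 q) +
        aR j * (T.returnF J σ (T.branchPt J j)).2 q) := by
  simp only [sideF, Prod.snd_sum, Finsupp.finsetSum_apply, Prod.snd_add, Finsupp.add_apply,
    Prod.smul_snd, Finsupp.smul_apply, smul_eq_mul]

lemma sideF_apply_other_side (aC : ℕ → ℕ → ℝ) (aR : ℕ → ℝ) {σ τ : Side} (h : σ ≠ τ) (x : ℝ) :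
    (T.sideF J aC aR σ).1 (τ, x) = 0 ∧ (T.sideF J aC aR σ).2 (τ, x) = 0 := by
  rw [sideF_fst_apply, sideF_snd_apply]
  constructor
  · refine Finset.sum_eq_zero fun j _ => ?_
    rw [(returnF_apply_other_side h _ _).1, mul_zero, add_zero]
    exact Finset.sum_eq_zero fun k _ => by rw [(connF_apply_other_side h _ _ _).1, mul_zero]
  · refine Finset.sum_eq_zero fun j _ => ?_
    rw [(returnF_apply_other_side h _ _).2, mul_zero, add_zero]
    exact Finset.sum_eq_zero fun k _ => by rw [(connF_apply_other_side h _ _ _).2, mul_zero]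

-- The sum selects one landing; the last landing `k₀ = m` is served by the return vector, all
-- earlier ones by connection vectors.
open Classical in
lemma sum_eq_coef (aC : ℕ → ℕ → ℝ) (aR : ℕ → ℝ) {σ : Side} {j₀ k₀ : ℕ} (hj₀ : j₀ ∈ T.idx J σ)
    (hk₀ : 1 ≤ k₀) (hk₀' : k₀ ≤ T.m J σ j₀) :
    ∑ j ∈ T.idx J σ, ((∑ k ∈ Ico 1 (T.m J σ j), aC j k * (if j = j₀ ∧ k = k₀ then 1 else 0)) +
        aR j * (if 0 < T.m J σ j ∧ j = j₀ ∧ T.m J σ j = k₀ then 1 else 0)) =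
      T.coef J aC aR σ j₀ k₀ := by
  rw [Finset.sum_eq_single j₀]
  · unfold coef
    by_cases h : k₀ < T.m J σ j₀
    · rw [if_pos h, if_neg (by omega), mul_zero, add_zero, Finset.sum_eq_single k₀]
      · simp
      · intro k _ hk
        simp [hk]
      · exact fun h' => absurd (Finset.mem_Ico.2 ⟨hk₀, h⟩) h'
    · rw [if_neg h, if_pos ⟨by omega, rfl, by omega⟩, mul_one, Finset.sum_eq_zero, zero_add]
      intro k hk
      have := (Finset.mem_Ico.1 hk).2
      rw [if_neg (by omega), mul_zero]
  · intro j _ hne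
    simp [hne]
  · exact fun h => absurd hj₀ h

variable (hJ : T.IsComponent J)
include hJ

lemma landPt_eq_iff {σ : Side} {j j₀ k k₀ : ℕ} (hj : j ∈ T.idx J σ) (hj₀ : j₀ ∈ T.idx J σ)
    (hk : 1 ≤ k) (hk' : k ≤ T.m J σ j) (hk₀ : 1 ≤ k₀) (hk₀' : k₀ ≤ T.m J σ j₀) :
    (σ, T.landPt σ (T.branchPt J j) k) = (σ, T.landPt σ (T.branchPt J j₀) k₀) ↔
      j = j₀ ∧ k = k₀ := by
  have hB := finite_isBranchPoint hJ.1
  constructor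
  · intro h
    obtain ⟨h₁, h₂⟩ := landPt_unique hJ.1 (memSigned_branchPt hB hj) (memSigned_branchPt hB hj₀)
      hk hk' hk₀ hk₀' (congrArg Prod.snd h)
    exact ⟨branchPt_inj hB (le_of_mem_idx hj) (le_of_mem_idx hj₀) h₁, h₂⟩
  · rintro ⟨rfl, rfl⟩; rfl

lemma sideF_fst_landPt (aC : ℕ → ℕ → ℝ) (aR : ℕ → ℝ) {σ : Side} {j₀ k₀ : ℕ}
    (hj₀ : j₀ ∈ T.idx J σ) (hk₀ : 1 ≤ k₀) (hk₀' : k₀ ≤ T.m J σ j₀) :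
    (T.sideF J aC aR σ).1 (σ, T.landPt σ (T.branchPt J j₀) k₀) = T.coef J aC aR σ j₀ k₀ := by
  classical
  rw [sideF_fst_apply, ← sum_eq_coef aC aR hj₀ hk₀ hk₀']
  have hd : T.IsDisc (T.landPt σ (T.branchPt J j₀) k₀) := isDisc_landPt hk₀ hk₀'
  refine Finset.sum_congr rfl fun j hj => ?_
  congr 1
  · refine Finset.sum_congr rfl fun k hk => ?_
    obtain ⟨h₁, h₂⟩ := Finset.mem_Ico.1 hk
    rw [connF_apply_disc h₁ h₂ hd]
    simp only [landPt_eq_iff hJ hj hj₀ h₁ h₂.le hk₀ hk₀']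
  · rw [returnF_apply_disc hd]
    congr 2
    refine propext (and_congr_right fun hm => ?_)
    exact landPt_eq_iff hJ hj hj₀ hm le_rfl hk₀ hk₀'

lemma sideF_snd_branchPt (aC : ℕ → ℕ → ℝ) (aR : ℕ → ℝ) {σ : Side} {j₀ : ℕ}
    (hj₀ : j₀ ∈ T.idx J σ) (hd : T.IsDisc (T.branchPt J j₀)) :
    (T.sideF J aC aR σ).2 (σ, T.branchPt J j₀) = T.coef J aC aR σ j₀ 1 := by
  classical
  have hB := finite_isBranchPoint hJ.1
  obtain ⟨hm₀, e⟩ := landPt_one_of_isDisc (hJ.returnTime_pos (memSigned_branchPt hB hj₀)) hd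
  rw [sideF_snd_apply, ← sum_eq_coef aC aR hj₀ le_rfl hm₀]
  refine Finset.sum_congr rfl fun j hj => ?_
  have hiff : ∀ k, 1 ≤ k → k ≤ T.m J σ j →
      ((σ, T.landPt σ (T.branchPt J j) k) = (σ, T.branchPt J j₀) ↔ j = j₀ ∧ k = 1) := by
    intro k hk hk'
    have := landPt_eq_iff hJ hj hj₀ hk hk' le_rfl hm₀
    rwa [e] at this
  congr 1
  · refine Finset.sum_congr rfl fun k hk => ?_
    obtain ⟨h₁, h₂⟩ := Finset.mem_Ico.1 hk
    rw [connF, Finsupp.sub_apply, Finsupp.single_apply, Finsupp.single_apply]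
    simp only [hiff k h₁ h₂.le, hiff (k + 1) (by omega) h₂]
    -- The end of a connection vector is a landing of index at least `2`, hence never a first
    -- landing.
    rw [if_neg (show ¬ (j = j₀ ∧ k + 1 = 1) by omega), sub_zero]
  · rcases Nat.eq_zero_or_pos (T.m J σ j) with h | h
    · rw [returnF, if_pos (show T.numLandings J σ (T.branchPt J j) = 0 from h),
        if_neg (by omega)]
      rfl
    · rw [returnF, if_neg (show T.numLandings J σ (T.branchPt J j) ≠ 0 from h.ne'),
        Finsupp.single_apply]
      congr 2
      exact propext ((hiff _ h le_rfl).trans (and_iff_right h).symm)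

lemma sideF_fst_signed (aC : ℕ → ℕ → ℝ) (aR : ℕ → ℝ) {σ : Side} {x : ℝ}
    (hx : J.MemSigned σ x) (hd : ¬ T.IsDisc x) :
    (∀ j ≤ T.branchCount J, T.branchPt J j ≠ x) → (T.sideF J aC aR σ).1 (σ, x) = 0 := by
  classical
  intro h
  have hB := finite_isBranchPoint hJ.1
  rw [sideF_fst_apply]
  refine Finset.sum_eq_zero fun j hj => ?_
  rw [returnF_apply_signed (hJ.returnTime_pos (memSigned_branchPt hB hj)) hx hd, if_neg, mul_zero,
    add_zero]
  · refine Finset.sum_eq_zero fun k hk => ?_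
    rw [connF_apply_signed (Finset.mem_Ico.1 hk).1 (Finset.mem_Ico.1 hk).2 hx hd, mul_zero]
  · exact fun h' => h j (le_of_mem_idx hj) (congrArg Prod.snd h'.2)

lemma sideF_fst_branchPt (aC : ℕ → ℕ → ℝ) (aR : ℕ → ℝ) {σ : Side} {j₀ : ℕ}
    (hj₀ : j₀ ∈ T.idx J σ) (hd : ¬ T.IsDisc (T.branchPt J j₀)) :
    (T.sideF J aC aR σ).1 (σ, T.branchPt J j₀) = if T.m J σ j₀ = 0 then aR j₀ else 0 := by
  classical
  have hB := finite_isBranchPoint hJ.1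
  have hx := memSigned_branchPt hB hj₀
  have hret : ∀ j ∈ T.idx J σ, (T.returnF J σ (T.branchPt J j)).1 (σ, T.branchPt J j₀) =
      if T.m J σ j = 0 ∧ (σ, T.branchPt J j) = (σ, T.branchPt J j₀) then 1 else 0 := fun j hj =>
    returnF_apply_signed (hJ.returnTime_pos (memSigned_branchPt hB hj)) hx hd
  have hconn : ∀ j, ∑ k ∈ Ico 1 (T.m J σ j),
      aC j k * (T.connF σ (T.branchPt J j) k).1 (σ, T.branchPt J j₀) = 0 := fun j =>
    Finset.sum_eq_zero fun k hk => by
      rw [connF_apply_signed (Finset.mem_Ico.1 hk).1 (Finset.mem_Ico.1 hk).2 hx hd, mul_zero]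
  rw [sideF_fst_apply, Finset.sum_eq_single j₀]
  · rw [hconn, zero_add, hret j₀ hj₀]
    simp
  · intro j hj hne
    rw [hconn, zero_add, hret j hj, if_neg, mul_zero]
    exact fun h => hne (branchPt_inj hB (le_of_mem_idx hj) (le_of_mem_idx hj₀)
      (congrArg Prod.snd h.2))
  · exact fun h => absurd hj₀ h

omit hJ in
lemma landsF_fst_apply_disc (aL : ℕ → ℝ) {q : SP} (hq : T.IsDisc q.2) :
    (T.landsF J aL).1 q = 0 := by
  classical
  simp only [landsF, Prod.fst_sum, Finsupp.finsetSum_apply, Prod.smul_fst, Finsupp.smul_apply,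
    smul_eq_mul]
  refine Finset.sum_eq_zero fun j hj => ?_
  rw [landF_apply_disc (Finset.mem_filter.1 hj).2 hq, mul_zero]

omit hJ in
lemma landsF_fst_signed (aL : ℕ → ℝ) {q : SP} (hq : q ∈ signed J) (hd : ¬ T.IsDisc q.2)
    (h : ∀ j ≤ T.branchCount J, T.branchPt J j ≠ q.2) : (T.landsF J aL).1 q = 0 := by
  classical
  simp only [landsF, Prod.fst_sum, Finsupp.finsetSum_apply, Prod.smul_fst, Finsupp.smul_apply,
    smul_eq_mul]
  refine Finset.sum_eq_zero fun j hj => ?_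
  rw [Finset.mem_filter, Finset.mem_range] at hj
  rw [landF_apply_signed hj.2 hq hd, if_neg, mul_zero]
  exact fun e => h j (by omega) (congrArg Prod.snd e)

open Classical in
lemma landsF_fst_branchPt (aL : ℕ → ℝ) {σ : Side} {j₀ : ℕ} (hj₀ : j₀ ∈ T.idx J σ)
    (hd : ¬ T.IsDisc (T.branchPt J j₀)) :
    (T.landsF J aL).1 (σ, T.branchPt J j₀) =
      if T.Lands J j₀ ∧ T.landSide J j₀ = σ then aL j₀ else 0 := by
  have hB := finite_isBranchPoint hJ.1
  have hx := memSigned_branchPt hB hj₀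
  simp only [landsF, Prod.fst_sum, Finsupp.finsetSum_apply, Prod.smul_fst, Finsupp.smul_apply,
    smul_eq_mul]
  rw [Finset.sum_filter, Finset.sum_eq_single j₀]
  · by_cases hL : T.Lands J j₀
    · rw [if_pos hL, landF_apply_signed hL hx hd]
      simp [hL]
    · rw [if_neg hL, if_neg fun h => hL h.1]
  · intro j hj hne
    rw [Finset.mem_range] at hj
    split_ifs with hL
    · rw [landF_apply_signed hL hx hd, if_neg, mul_zero]
      exact fun h => hne (branchPt_inj hB (by omega) (le_of_mem_idx hj₀) (congrArg Prod.snd h))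
    · rfl
  · intro h
    have := le_of_mem_idx hj₀
    exact absurd (Finset.mem_range.2 (by omega)) h

open Classical in
lemma landsF_snd_branchPt (aL : ℕ → ℝ) {σ : Side} {j₀ : ℕ} (hj₀ : j₀ ∈ T.idx J σ)
    (hd : T.IsDisc (T.branchPt J j₀)) :
    (T.landsF J aL).2 (σ, T.branchPt J j₀) =
      - if T.landSide J j₀ = σ then aL j₀ else 0 := by
  have hB := finite_isBranchPoint hJ.1
  obtain ⟨hm₀, e⟩ := landPt_one_of_isDisc (hJ.returnTime_pos (memSigned_branchPt hB hj₀)) hd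
  have hL₀ : T.landSide J j₀ = σ → T.Lands J j₀ := by
    rintro h
    rw [Lands, h]; exact hm₀
  simp only [landsF, Prod.snd_sum, Finsupp.finsetSum_apply, Prod.smul_snd, Finsupp.smul_apply,
    smul_eq_mul, landF, Finsupp.neg_apply, Finsupp.single_apply]
  rw [Finset.sum_filter, Finset.sum_eq_single j₀]
  · by_cases hs : T.landSide J j₀ = σ
    · rw [if_pos (hL₀ hs), if_pos hs, hs, e]
      simp
    · simp [hs]
  · intro j hj hne
    rw [Finset.mem_range] at hj
    split_ifs with hL h
    · exfalso
      have hs : T.landSide J j = σ := congrArg Prod.fst h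
      have hji : j ∈ T.idx J σ := hs ▸ landSide_mem_idx (by omega)
      have hmj : 0 < T.m J σ j := hs ▸ hL
      rw [hs, ← e] at h
      exact hne ((landPt_eq_iff hJ hji hj₀ le_rfl hmj le_rfl hm₀).1 h).1
    · simp
    · rfl
  · intro h
    have := le_of_mem_idx hj₀
    exact absurd (Finset.mem_range.2 (by omega)) h

variable (a : Coeffs n r)

omit hJ in
lemma compF_fst_apply (σ : Side) (x : ℝ) :
    (T.compF J a).1 (σ, x) =
      (T.sideF J (a.aC σ) (a.aR σ) σ).1 (σ, x) + (T.landsF J a.aL).1 (σ, x) := by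
  cases σ
  · rw [compF, Prod.fst_add, Prod.fst_add, Finsupp.add_apply, Finsupp.add_apply,
      (sideF_apply_other_side (σ := .minus) (τ := .plus) _ _ (by simp) _).1, add_zero]
  · rw [compF, Prod.fst_add, Prod.fst_add, Finsupp.add_apply, Finsupp.add_apply,
      (sideF_apply_other_side (σ := .plus) (τ := .minus) _ _ (by simp) _).1, zero_add]

omit hJ in
lemma compF_snd_apply (σ : Side) (x : ℝ) :
    (T.compF J a).2 (σ, x) =
      (T.sideF J (a.aC σ) (a.aR σ) σ).2 (σ, x) + (T.landsF J a.aL).2 (σ, x) := by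
  cases σ
  · rw [compF, Prod.snd_add, Prod.snd_add, Finsupp.add_apply, Finsupp.add_apply,
      (sideF_apply_other_side (σ := .minus) (τ := .plus) _ _ (by simp) _).2, add_zero]
  · rw [compF, Prod.snd_add, Prod.snd_add, Finsupp.add_apply, Finsupp.add_apply,
      (sideF_apply_other_side (σ := .plus) (τ := .minus) _ _ (by simp) _).2, zero_add]

lemma compF_fst_landPt {σ : Side} {j k : ℕ} (hj : j ∈ T.idx J σ) (hk : 1 ≤ k)
    (hk' : k ≤ T.m J σ j) :
    (T.compF J a).1 (σ, T.landPt σ (T.branchPt J j) k) =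
      T.coef J (a.aC σ) (a.aR σ) σ j k := by
  rw [compF_fst_apply, sideF_fst_landPt hJ _ _ hj hk hk',
    landsF_fst_apply_disc _ (isDisc_landPt hk hk'), add_zero]

lemma compF_fst_between {σ : Side} {x : ℝ} (hx : J.MemSigned σ x) (hd : ¬ T.IsDisc x)
    (h : ∀ j ≤ T.branchCount J, T.branchPt J j ≠ x) : (T.compF J a).1 (σ, x) = 0 := by
  rw [compF_fst_apply, sideF_fst_signed hJ _ _ hx hd h, landsF_fst_signed _ hx hd h, add_zero]

lemma compF_fst_branchPt_of_eq_zero {σ : Side} {j : ℕ} (hj : j ∈ T.idx J σ)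
    (hd : ¬ T.IsDisc (T.branchPt J j)) (hm : T.m J σ j = 0) :
    (T.compF J a).1 (σ, T.branchPt J j) = a.aR σ j := by
  rw [compF_fst_apply, sideF_fst_branchPt hJ _ _ hj hd, landsF_fst_branchPt hJ _ hj hd,
    if_pos hm, if_neg, add_zero]
  rintro ⟨h, h'⟩
  rw [Lands, h', hm] at h
  exact lt_irrefl _ h

open Classical in
lemma compF_fst_branchPt_of_pos {σ : Side} {j : ℕ} (hj : j ∈ T.idx J σ)
    (hd : ¬ T.IsDisc (T.branchPt J j)) (hm : 0 < T.m J σ j) :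
    (T.compF J a).1 (σ, T.branchPt J j) = if T.landSide J j = σ then a.aL j else 0 := by
  rw [compF_fst_apply, sideF_fst_branchPt hJ _ _ hj hd, landsF_fst_branchPt hJ _ hj hd,
    if_neg hm.ne', zero_add]
  refine if_congr (and_iff_right_of_imp fun h => ?_) rfl rfl
  rw [Lands, h]; exact hm

open Classical in
lemma compF_snd_branchPt {σ : Side} {j : ℕ} (hj : j ∈ T.idx J σ)
    (hd : T.IsDisc (T.branchPt J j)) :
    (T.compF J a).2 (σ, T.branchPt J j) =
      T.coef J (a.aC σ) (a.aR σ) σ j 1 - if T.landSide J j = σ then a.aL j else 0 := by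
  rw [compF_snd_apply, sideF_snd_branchPt hJ _ _ hj hd, landsF_snd_branchPt hJ _ hj hd,
    sub_eq_add_neg]

/-- Only the boundary points `a_0⁺` and `a_N⁻` may fail to land before their return. -/
lemma m_pos_of_interior {σ : Side} {j : ℕ} (h₀ : 0 < j) (h₁ : j < T.branchCount J) :
    0 < T.m J σ j := by
  have hb := (branchPt_spec (finite_isBranchPoint hJ.1) h₁).2.1 h₀
  cases σ
  · exact hb.2.2
  · exact hJ.numLandings_minus_pos hb.1 hb.2.1 hb.2.2

/-- At an interior `a_j` both sides land; at a boundary point only the side used by `landSide`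
belongs to `J`. -/
lemma m_pos_of_lands {σ : Side} {j : ℕ} (hj : j ∈ T.idx J σ) (hL : T.Lands J j) :
    0 < T.m J σ j := by
  by_cases h : T.landSide J j = σ
  · rw [← h]; exact hL
  · unfold landSide at h
    split_ifs at h with h'
    · cases σ
      · exact absurd rfl h
      · exact m_pos_of_interior hJ (mem_idx_minus.1 hj).1 h'
    · cases σ
      · exact absurd (mem_idx_plus.1 hj) h'
      · exact absurd rfl h

end Eval

/-! ### Weights of the vectors of a periodic interval -/

section PerEval

variable {T : ITM r} {J : HOInterval} (a : Coeffs n r) (i : Fin n)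

lemma perComb_apply (σ : Side) (x : ℝ) :
    (T.perComb J a i).1 (σ, x) =
      ∑ k ∈ Icc 1 (T.perM J σ), a.aP σ i k * (T.perF J σ k).1 (σ, x) := by
  have h : ∀ τ, (T.sidePerF J (a.aP τ i) τ).1 (σ, x) =
      ∑ k ∈ Icc 1 (T.perM J τ), a.aP τ i k * (T.perF J τ k).1 (σ, x) := by
    intro τ
    simp only [sidePerF, Prod.fst_sum, Finsupp.finsetSum_apply, Prod.smul_fst, Finsupp.smul_apply,
      smul_eq_mul]
  have h₀ : ∀ τ, τ ≠ σ → (T.sidePerF J (a.aP τ i) τ).1 (σ, x) = 0 := by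
    intro τ hτ
    rw [h]
    exact Finset.sum_eq_zero fun k _ => by rw [perF_apply_other_side hτ, mul_zero]
  rw [← h, perComb, Prod.fst_add, Finsupp.add_apply]
  cases σ
  · rw [h₀ .minus (by simp), add_zero]
  · rw [h₀ .plus (by simp), zero_add]

open Classical in
lemma perF_apply_disc {σ : Side} {k : ℕ} (hk : 1 ≤ k) (h : k ≤ T.perM J σ) {q : SP}
    (hq : T.IsDisc q.2) :
    (T.perF J σ k).1 q = if (σ, T.landPt σ (J.endpoint σ) k) = q then 1 else 0 := by
  have hpos : 0 < T.numLandings J σ (J.endpoint σ) := hk.trans h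
  unfold perF
  split_ifs with e h' h'
  · rw [Prod.fst_add, Finsupp.add_apply, returnF_apply_disc hq, landF_apply_disc hpos hq, add_zero,
      if_pos ⟨hpos, by rw [← h', e]; rfl⟩]
  · rw [Prod.fst_add, Finsupp.add_apply, returnF_apply_disc hq, landF_apply_disc hpos hq, add_zero,
      if_neg]
    rintro ⟨_, h''⟩
    exact h' (by rw [← h'', e]; rfl)
  · rw [connF_apply_disc hk (lt_of_le_of_ne h e) hq, if_pos h']
  · rw [connF_apply_disc hk (lt_of_le_of_ne h e) hq, if_neg h']

lemma perComb_apply_landPt (hJ : J.toSet ⊆ T.attractor) {σ : Side} {k : ℕ} (hk : 1 ≤ k)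
    (hk' : k ≤ T.perM J σ) :
    (T.perComb J a i).1 (σ, T.landPt σ (J.endpoint σ) k) = a.aP σ i k := by
  classical
  have he := memSigned_endpoint J σ
  have hd : T.IsDisc (T.landPt σ (J.endpoint σ) k) := isDisc_landPt hk hk'
  rw [perComb_apply, Finset.sum_eq_single k]
  · rw [perF_apply_disc hk hk' hd, if_pos rfl, mul_one]
  · intro l hl hne
    obtain ⟨h₁, h₂⟩ := Finset.mem_Icc.1 hl
    rw [perF_apply_disc h₁ h₂ hd, if_neg, mul_zero]
    exact fun h => hne (landPt_unique hJ he he h₁ h₂ hk hk' (congrArg Prod.snd h)).2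
  · exact fun h => absurd (Finset.mem_Icc.2 ⟨hk, hk'⟩) h

lemma perComb_apply_interior (hJ : T.IsPeriodicInterval J) {σ : Side} {x : ℝ} (hl : J.left < x)
    (hr : x < J.right) : (T.perComb J a i).1 (σ, x) = 0 := by
  classical
  have hd := hJ.not_isDisc hl hr
  have hx : J.MemSigned σ x := by
    cases σ
    · exact ⟨hl.le, hr⟩
    · exact ⟨hl, hr.le⟩
  have hne : J.endpoint σ ≠ x := by
    cases σ
    · exact hl.ne
    · exact hr.ne'
  have hne' : (σ, J.endpoint σ) ≠ (σ, x) := fun h => hne (congrArg Prod.snd h)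
  rw [perComb_apply]
  refine Finset.sum_eq_zero fun k hk => ?_
  obtain ⟨h₁, h₂⟩ := Finset.mem_Icc.1 hk
  have hpos : 0 < T.numLandings J σ (J.endpoint σ) := h₁.trans h₂
  unfold perF
  split_ifs with e
  · rw [Prod.fst_add, Finsupp.add_apply,
      returnF_apply_signed (returnTime_pos_of_numLandings hpos) hx hd, landF_apply_signed hpos hx hd,
      if_neg fun h => hne' h.2, if_neg hne']
    simp
  · rw [connF_apply_signed h₁ (lt_of_le_of_ne h₂ e) hx hd, mul_zero]

end PerEval

end ITM

namespace ITM
variable {r n : ℕ}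

/-! ### Relations between the coefficients -/

namespace Config

variable {T : ITM r} {J₀ : HOInterval} {J : Fin n → HOInterval} (hc : Config T J₀ J)
  {a : Coeffs n r} (ha : T.lincomb J₀ J a = 0)

/-- The value at the germ `x^σ` of the step function given by the weights. -/
noncomputable def val (T : ITM r) (J₀ : HOInterval) (J : Fin n → HOInterval) (a : Coeffs n r)
    (σ : Side) (x : ℝ) : ℝ := cum σ x (T.compF J₀ a + ∑ i, T.perComb (J i) a i).1

include hc ha

/-- The step function is constant along the orbit until the return, and at each landing it reads off
the coefficient up to sign. The right-hand side does not involve `k`, so the coefficients along one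
orbit agree. -/
lemma coef_eq {σ : Side} {j k : ℕ} (hj : j ∈ T.idx J₀ σ) (hk : 1 ≤ k) (hk' : k ≤ T.m J₀ σ j) :
    T.coef J₀ (a.aC σ) (a.aR σ) σ j k = sgn σ * val T J₀ J a σ (T.branchPt J₀ j) := by
  have hx := memSigned_branchPt (finite_isBranchPoint hc.comp.1) hj
  have h := (hc.flow_inside ha).apply_disc σ (isDisc_landPt hk hk')
  rw [(hc.inside_apply₀ ⟨_, _, hx, rfl⟩).1, compF_fst_landPt hc.comp a hj hk hk'] at h
  rw [h, val, ← hc.cum_orbit₀ ha hx (landTime_lt hk hk'), landPt]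

/-- The excluded germs are `a_0⁻` and `a_N⁺`, which lie outside `X` because `J₀` is a maximal
interval of `X`. -/
lemma val_eq_zero_of_not_mem_idx {σ : Side} {j : ℕ} (hj : j ≤ T.branchCount J₀)
    (h : j ∉ T.idx J₀ σ) : ¬ T.SignedMemX σ (T.branchPt J₀ j) ∧
      val T J₀ J a σ (T.branchPt J₀ j) = 0 := by
  have hX : ¬ T.SignedMemX σ (T.branchPt J₀ j) := by
    cases σ
    · rw [mem_idx_plus] at h
      obtain rfl : j = T.branchCount J₀ := by omega
      rw [branchPt_last (finite_isBranchPoint hc.comp.1)]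
      exact hc.comp.not_signedMemX_right
    · rw [mem_idx_minus] at h
      obtain rfl : j = 0 := by omega
      exact hc.comp.not_signedMemX_left
  refine ⟨hX, ?_⟩
  by_contra hne
  exact hX ((hc.flow_inside ha).signedMemX_of_cum_ne_zero hne)

-- Strictly between consecutive branch points there is neither a discontinuity nor the start of a
-- vector, hence no weight.
omit ha in
lemma val_succ {j : ℕ} (hj : j < T.branchCount J₀) :
    val T J₀ J a .plus (T.branchPt J₀ j) = val T J₀ J a .minus (T.branchPt J₀ (j + 1)) := by
  have hB := finite_isBranchPoint hc.comp.1
  refine cum_eq_of_no_weight _ (branchPt_lt_succ hB hj) fun σ z h₁ h₂ => ?_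
  have hl : J₀.left < z := (branchPt_spec hB hj).2.2.1.trans_lt h₁
  have hr : z < J₀.right := h₂.trans_le (branchPt_le_right hB hj)
  have hd : ¬ T.IsDisc z := by
    intro hd
    refine not_isBranchPoint_between hB hj h₁ h₂ ⟨hl, hr, numLandings_pos_iff.2 ⟨0, ?_, hd⟩⟩
    exact hc.comp.returnTime_pos (σ := .plus) ⟨hl.le, hr⟩
  have hz : J₀.MemSigned σ z := by
    cases σ
    · exact ⟨hl.le, hr⟩
    · exact ⟨hl, hr.le⟩
  rw [(hc.inside_apply₀ (signed_subset_signedOrbit T J₀ hz)).1,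
    compF_fst_between hc.comp a hz hd]
  rintro l hl' rfl
  rcases lt_trichotomy l j with h | rfl | h
  · exact absurd (branchPt_lt hB h hj.le) h₁.not_gt
  · exact lt_irrefl _ h₁
  · rcases (Nat.succ_le_of_lt h).lt_or_eq with h' | h'
    · exact absurd (branchPt_lt hB h' hl') h₂.not_gt
    · rw [← h'] at h₂
      exact lt_irrefl _ h₂

omit hc ha in
lemma jump (x : ℝ) : val T J₀ J a .plus x - val T J₀ J a .minus x =
    (T.compF J₀ a + ∑ i, T.perComb (J i) a i).1 (.plus, x) +
      (T.compF J₀ a + ∑ i, T.perComb (J i) a i).1 (.minus, x) := cum_jump _ x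

omit ha in
lemma not_isDisc_of_m_eq_zero {σ : Side} {j : ℕ} (hj : j ∈ T.idx J₀ σ) (hm : T.m J₀ σ j = 0) :
    ¬ T.IsDisc (T.branchPt J₀ j) := fun hd =>
  (landPt_one_of_isDisc (hc.comp.returnTime_pos
    (memSigned_branchPt (finite_isBranchPoint hc.comp.1) hj)) hd).1.ne' hm

/-- With a landing this is the case `k = m` of `coef_eq`. Without one, `a_j^σ` is `a_0⁺` or `a_N⁻`,
its weight is the coefficient itself, and the opposite germ lies outside `X`; so the jump of the
step function gives the value. -/
lemma aR_eq {σ : Side} {j : ℕ} (hj : j ∈ T.idx J₀ σ) :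
    a.aR σ j = sgn σ * val T J₀ J a σ (T.branchPt J₀ j) := by
  rcases Nat.eq_zero_or_pos (T.m J₀ σ j) with hm | hm
  · have hB := finite_isBranchPoint hc.comp.1
    have hd := hc.not_isDisc_of_m_eq_zero hj hm
    have hw := (hc.inside_apply₀ (a := a)
      (signed_subset_signedOrbit T J₀
        (show (σ, T.branchPt J₀ j) ∈ signed J₀ from memSigned_branchPt hB hj))).1
    rw [compF_fst_branchPt_of_eq_zero hc.comp a hj hd hm] at hw
    have hJ := jump (T := T) (J₀ := J₀) (J := J) (a := a) (T.branchPt J₀ j)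
    have hle := le_of_mem_idx hj
    -- If both sides belonged to `J₀`, the point would be interior and would land.
    have hbd : ∀ τ, τ ≠ σ → j ∉ T.idx J₀ τ := by
      intro τ hτ h
      refine (m_pos_of_interior hc.comp (σ := σ) (j := j) ?_ ?_).ne' hm
      · cases σ <;> cases τ <;> simp_all [mem_idx_plus, mem_idx_minus] <;> omega
      · cases σ <;> cases τ <;> simp_all [mem_idx_plus, mem_idx_minus]
    cases σ
    · obtain ⟨h₁, h₂⟩ := hc.val_eq_zero_of_not_mem_idx ha hle (hbd .minus (by simp))
      rw [h₂, hw, (hc.inside_apply_of_not_signedMemX (a := a) h₁).1] at hJ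
      rw [sgn]; linarith
    · obtain ⟨h₁, h₂⟩ := hc.val_eq_zero_of_not_mem_idx ha hle (hbd .plus (by simp))
      rw [h₂, hw, (hc.inside_apply_of_not_signedMemX (a := a) h₁).1] at hJ
      rw [sgn]; linarith
  · rw [← hc.coef_eq ha hj hm le_rfl, coef, if_neg (lt_irrefl _)]

lemma aC_eq {σ : Side} {j k : ℕ} (hj : j ∈ T.idx J₀ σ) (hk : 1 ≤ k) (hk' : k < T.m J₀ σ j) :
    a.aC σ j k = sgn σ * val T J₀ J a σ (T.branchPt J₀ j) := by
  rw [← hc.coef_eq ha hj hk hk'.le, coef, if_pos hk']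

lemma headCoeff_eq {σ : Side} {j : ℕ} (hj : j ∈ T.idx J₀ σ) :
    T.headCoeff J₀ a σ j = sgn σ * val T J₀ J a σ (T.branchPt J₀ j) := by
  unfold headCoeff
  split_ifs with h
  · exact hc.aC_eq ha hj le_rfl h
  · exact hc.aR_eq ha hj

/-- If `a_j` is a discontinuity, it lands at time `0` and `L_j` visits nothing; the relation then
comes from the cancellation of the weights `d` at `a_j⁺` and `a_j⁻`. Otherwise the coefficient of
`L_j` is the whole weight at `a_j`, that is, the jump. -/
lemma aL_eq {j : ℕ} (hj : j ≤ T.branchCount J₀) (hL : T.Lands J₀ j) :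
    a.aL j = val T J₀ J a .plus (T.branchPt J₀ j) - val T J₀ J a .minus (T.branchPt J₀ j) := by
  classical
  have hB := finite_isBranchPoint hc.comp.1
  have hside : ∀ σ, j ∉ T.idx J₀ σ → T.landSide J₀ j ≠ σ := by
    rintro σ h rfl
    exact h (landSide_mem_idx hj)
  have hsum : (if T.landSide J₀ j = .plus then a.aL j else 0) +
      (if T.landSide J₀ j = .minus then a.aL j else 0) = a.aL j := by
    cases T.landSide J₀ j <;> simp
  by_cases hd : T.IsDisc (T.branchPt J₀ j)
  · have key : ∀ σ, (T.compF J₀ a + ∑ i, T.perComb (J i) a i).2 (σ, T.branchPt J₀ j) =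
        sgn σ * val T J₀ J a σ (T.branchPt J₀ j) -
          if T.landSide J₀ j = σ then a.aL j else 0 := by
      intro σ
      by_cases h : j ∈ T.idx J₀ σ
      · have hx := memSigned_branchPt hB h
        rw [(hc.inside_apply₀ (signed_subset_signedOrbit T J₀ hx)).2,
          compF_snd_branchPt hc.comp a h hd, hc.coef_eq ha h le_rfl (m_pos_of_lands hc.comp h hL)]
      · obtain ⟨h₁, h₂⟩ := hc.val_eq_zero_of_not_mem_idx ha hj h
        rw [(hc.inside_apply_of_not_signedMemX h₁).2, h₂, if_neg (hside σ h), mul_zero, sub_zero]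
    obtain ⟨i, hi⟩ := hd
    have hcons := (hc.flow_inside ha).cons i
    rw [massOn_split _ (fun q => q.1 = Side.plus), massOn_eq_apply (q₀ := (.plus, T.branchPt J₀ j)),
      massOn_eq_apply (q₀ := (.minus, T.branchPt J₀ j)), key, key, sgn, sgn] at hcons
    · linarith
    · exact ⟨hi, by simp⟩
    · rintro ⟨σ, x⟩ ⟨h₁, h₂⟩ _
      cases σ
      · exact absurd rfl h₂
      · exact Prod.ext rfl (h₁.symm.trans hi)
    · exact ⟨hi, rfl⟩
    · rintro ⟨σ, x⟩ ⟨h₁, h₂⟩ _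
      exact Prod.ext h₂ (h₁.symm.trans hi)
  · have key : ∀ σ, (T.compF J₀ a + ∑ i, T.perComb (J i) a i).1 (σ, T.branchPt J₀ j) =
        if T.landSide J₀ j = σ then a.aL j else 0 := by
      intro σ
      by_cases h : j ∈ T.idx J₀ σ
      · have hx := memSigned_branchPt hB h
        rw [(hc.inside_apply₀ (signed_subset_signedOrbit T J₀ hx)).1,
          compF_fst_branchPt_of_pos hc.comp a h hd (m_pos_of_lands hc.comp h hL)]
      · obtain ⟨h₁, h₂⟩ := hc.val_eq_zero_of_not_mem_idx ha hj h
        rw [(hc.inside_apply_of_not_signedMemX h₁).1, if_neg (hside σ h)]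
    rw [jump, key, key, hsum]

lemma aP_eq {i : Fin n} {σ : Side} {k : ℕ} (hk : 1 ≤ k) (hk' : k ≤ T.perM (J i) σ) :
    a.aP σ i k = sgn σ * val T J₀ J a σ ((J i).endpoint σ) := by
  have hx := memSigned_endpoint (J i) σ
  have h := (hc.flow_inside ha).apply_disc σ
    (isDisc_landPt (T := T) (J := J i) (σ := σ) (a := (J i).endpoint σ) hk hk')
  rw [hc.inside_apply (i := i) ⟨_, _, hx, rfl⟩, perComb_apply_landPt a i (hc.sub i) hk hk'] at h
  rw [h, val, ← hc.cum_orbit ha hx (landTime_lt hk hk'), landPt]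

omit ha in
lemma val_endpoint (i : Fin n) :
    val T J₀ J a .plus (J i).left = val T J₀ J a .minus (J i).right := by
  refine cum_eq_of_no_weight _ (J i).left_lt_right fun σ z h₁ h₂ => ?_
  have hz : (J i).MemSigned σ z := by
    cases σ
    · exact ⟨h₁.le, h₂⟩
    · exact ⟨h₁, h₂.le⟩
  rw [hc.inside_apply (signed_subset_signedOrbit T (J i) hz),
    perComb_apply_interior a i (hc.per i).1 h₁ h₂]

/-- By maximality the orbit of the right end passes through `1⁻`, where the step function is minus
the weight. That weight is zero since the minus side of `J i` contributes no vectors. -/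
lemma val_right_eq_zero {i : Fin n} (h : T.perM (J i) .minus = 0) :
    val T J₀ J a .minus (J i).right = 0 := by
  have hx : (J i).MemSigned .minus (J i).right := memSigned_endpoint (J i) .minus
  obtain ⟨t, ht, h₁⟩ := (hc.per i).exists_orbit_eq_one h
  have e := hc.cum_orbit ha hx ht
  rw [h₁] at e
  have hw : (T.compF J₀ a + ∑ i, T.perComb (J i) a i).1 (.minus, 1) = 0 := by
    rw [hc.inside_apply (i := i) ⟨_, t, hx, h₁⟩, perComb_apply, h]
    simp
  obtain ⟨s, hs⟩ := T.exists_inPiece (σ := .minus) (x := 1) ⟨one_pos, le_rfl⟩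
  have hs' : T.β s.succ = 1 := le_antisymm (T.β_le_one _) hs.2
  have h₂ := (hc.flow_inside ha).cum_right s
  rw [hs', hw, neg_zero, e] at h₂
  exact h₂

/-- The relations between the coefficients of a vanishing linear combination. -/
theorem relations :
    (∀ i, ∃ c : ℝ,
        (∀ k ∈ Finset.Icc 1 (T.perM (J i) .plus), a.aP .plus i k = c) ∧
        (∀ k ∈ Finset.Icc 1 (T.perM (J i) .minus), a.aP .minus i k = -c)) ∧
      (∀ j < T.branchCount J₀, ∃ c : ℝ,
        (∀ k ∈ Finset.Ico 1 (T.m J₀ .plus j), a.aC .plus j k = c) ∧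
        a.aR .plus j = c ∧
        (∀ k ∈ Finset.Ico 1 (T.m J₀ .minus (j + 1)), a.aC .minus (j + 1) k = -c) ∧
        a.aR .minus (j + 1) = -c) ∧
      (T.Lands J₀ 0 → a.aL 0 = T.headCoeff J₀ a .plus 0) ∧
      (T.Lands J₀ (T.branchCount J₀) →
        a.aL (T.branchCount J₀) = T.headCoeff J₀ a .minus (T.branchCount J₀)) ∧
      (∀ j, 0 < j → j < T.branchCount J₀ →
        a.aL j = T.headCoeff J₀ a .plus j + T.headCoeff J₀ a .minus j) ∧
      (∀ b ∈ T.outside, a.aX b = 0) := by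
  have hN := T.branchCount_pos J₀
  refine ⟨fun i => ⟨val T J₀ J a .plus (J i).left, fun k hk => ?_, fun k hk => ?_⟩,
    fun j hj => ⟨val T J₀ J a .plus (T.branchPt J₀ j), fun k hk => ?_, ?_, fun k hk => ?_, ?_⟩,
    fun hL => ?_, fun hL => ?_, fun j h₀ hj => ?_, fun b hb => hc.aX_eq_zero ha hb⟩
  · obtain ⟨h₁, h₂⟩ := Finset.mem_Icc.1 hk
    rw [hc.aP_eq ha h₁ h₂, sgn, one_mul]; rfl
  · obtain ⟨h₁, h₂⟩ := Finset.mem_Icc.1 hk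
    rw [hc.aP_eq ha h₁ h₂, sgn, neg_one_mul, hc.val_endpoint]; rfl
  · obtain ⟨h₁, h₂⟩ := Finset.mem_Ico.1 hk
    rw [hc.aC_eq ha (mem_idx_plus.2 hj) h₁ h₂, sgn, one_mul]
  · rw [hc.aR_eq ha (mem_idx_plus.2 hj), sgn, one_mul]
  · obtain ⟨h₁, h₂⟩ := Finset.mem_Ico.1 hk
    rw [hc.aC_eq ha (mem_idx_minus.2 ⟨by omega, hj⟩) h₁ h₂, sgn, neg_one_mul, hc.val_succ hj]
  · rw [hc.aR_eq ha (mem_idx_minus.2 ⟨by omega, hj⟩), sgn, neg_one_mul, hc.val_succ hj]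
  · rw [hc.aL_eq ha hN.le hL, hc.headCoeff_eq ha (mem_idx_plus.2 hN), sgn, one_mul,
      (hc.val_eq_zero_of_not_mem_idx (σ := .minus) ha hN.le
        (by simp [mem_idx_minus])).2, sub_zero]
  · rw [hc.aL_eq ha le_rfl hL, hc.headCoeff_eq ha (mem_idx_minus.2 ⟨hN, le_rfl⟩), sgn, neg_one_mul,
      (hc.val_eq_zero_of_not_mem_idx (σ := .plus) ha le_rfl
        (by simp [mem_idx_plus])).2, zero_sub]
  · have hL : T.Lands J₀ j := m_pos_of_interior hc.comp h₀ hj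
    rw [hc.aL_eq ha hj.le hL, hc.headCoeff_eq ha (mem_idx_plus.2 hj),
      hc.headCoeff_eq ha (mem_idx_minus.2 ⟨h₀, hj.le⟩), sgn, sgn]
    ring

end Config

/-! ### Linear independence -/

open Classical in
/-- The coefficients of a linear combination of the independent subfamily. -/
noncomputable def subCoeffs {T : ITM r} {J₀ : HOInterval} {J : Fin n → HOInterval}
    (l : SubIndex T J₀ J → ℝ) : Coeffs n r where
  aL j := if h : j ≤ T.branchCount J₀ ∧ T.Lands J₀ j then l (.landing j h.1 h.2) else 0
  aR σ j := match σ with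
    | .plus => if h : j < T.branchCount J₀ then l (.ret j h) else 0
    | .minus => 0
  aC σ j k := match σ with
    | .plus => if h : j < T.branchCount J₀ ∧ 1 ≤ k ∧ k < T.m J₀ .plus j then
        l (.connPlus j k h.1 h.2) else 0
    | .minus => if h : (1 ≤ j ∧ j ≤ T.branchCount J₀) ∧ 1 ≤ k ∧ k < T.m J₀ .minus j then
        l (.connMinus j k h.1 h.2) else 0
  aP σ i k := match σ with
    | .plus => if h : 1 ≤ k ∧ k ≤ T.perM (J i) .plus then l (.perPlus i k h) else 0
    | .minus => if h : 1 ≤ k ∧ k < T.perM (J i) .minus then l (.perMinus i k h) else 0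
  aX b := if h : b ∈ T.outside then l (.out b h) else 0

section SubCoeffs

variable {T : ITM r} {J₀ : HOInterval} {J : Fin n → HOInterval}

lemma lincomb_subCoeffs_add (l l' : SubIndex T J₀ J → ℝ) :
    T.lincomb J₀ J (subCoeffs (l + l')) =
      T.lincomb J₀ J (subCoeffs l) + T.lincomb J₀ J (subCoeffs l') := by
  have hdite : ∀ (p : Prop) [Decidable p] (x y : p → ℝ),
      (if h : p then x h + y h else 0) = (if h : p then x h else 0) + (if h : p then y h else 0) := by
    intro p _ x y
    split_ifs <;> simp
  simp only [lincomb, subCoeffs, Pi.add_apply, hdite, add_smul, Finset.sum_add_distrib, zero_smul,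
    add_zero]
  abel

lemma lincomb_subCoeffs_zero : T.lincomb J₀ J (subCoeffs (0 : SubIndex T J₀ J → ℝ)) = 0 := by
  simp [lincomb, subCoeffs]

open Classical in
lemma lincomb_subCoeffs_single (x : SubIndex T J₀ J) (c : ℝ) :
    T.lincomb J₀ J (subCoeffs (Pi.single x c)) = c • T.subfamily J₀ J x := by
  cases x with
  | landing j hj h =>
    simp only [lincomb, subCoeffs, Pi.single_apply, subfamily, reduceCtorEq, if_false, dite_eq_ite,
      ite_self, zero_smul, Finset.sum_const_zero, add_zero, zero_add, SubIndex.landing.injEq]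
    rw [Finset.sum_eq_single j]
    · simp [hj, h]
    · intro l _ hne
      simp [hne]
    · intro h'
      exact absurd (Finset.mem_filter.2 ⟨Finset.mem_range.2 (by omega), h⟩) h'
  | ret j hj =>
    simp only [lincomb, subCoeffs, Pi.single_apply, subfamily, reduceCtorEq, if_false, dite_eq_ite,
      ite_self, zero_smul, Finset.sum_const_zero, add_zero, zero_add, SubIndex.ret.injEq]
    rw [Finset.sum_eq_single j]
    · simp [hj]
    · intro l _ hne
      simp [hne]
    · exact fun h' => absurd (Finset.mem_range.2 hj) h'
  | connPlus j k hj hk =>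
    simp only [lincomb, subCoeffs, Pi.single_apply, subfamily, reduceCtorEq, if_false, dite_eq_ite,
      ite_self, zero_smul, Finset.sum_const_zero, add_zero, zero_add, SubIndex.connPlus.injEq]
    rw [Finset.sum_eq_single j, Finset.sum_eq_single k]
    · simp [hj, hk]
    · intro l _ hne
      simp [hne]
    · exact fun h' => absurd (Finset.mem_Ico.2 hk) h'
    · intro l _ hne
      simp [hne]
    · exact fun h' => absurd (Finset.mem_range.2 hj) h'
  | connMinus j k hj hk =>
    simp only [lincomb, subCoeffs, Pi.single_apply, subfamily, reduceCtorEq, if_false, dite_eq_ite,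
      ite_self, zero_smul, Finset.sum_const_zero, add_zero, zero_add, SubIndex.connMinus.injEq]
    rw [Finset.sum_eq_single j, Finset.sum_eq_single k]
    · simp [hj, hk]
    · intro l _ hne
      simp [hne]
    · exact fun h' => absurd (Finset.mem_Ico.2 hk) h'
    · intro l _ hne
      simp [hne]
    · exact fun h' => absurd (Finset.mem_Icc.2 hj) h'
  | perPlus i k hk =>
    simp only [lincomb, subCoeffs, Pi.single_apply, subfamily, reduceCtorEq, if_false, dite_eq_ite,
      ite_self, zero_smul, Finset.sum_const_zero, add_zero, SubIndex.perPlus.injEq]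
    rw [Finset.sum_eq_single i, Finset.sum_eq_single k]
    · simp [hk]
    · intro l _ hne
      simp [hne]
    · exact fun h' => absurd (Finset.mem_Icc.2 hk) h'
    · intro l _ hne
      simp [hne]
    · exact fun h' => absurd (Finset.mem_univ i) h'
  | perMinus i k hk =>
    simp only [lincomb, subCoeffs, Pi.single_apply, subfamily, reduceCtorEq, if_false, dite_eq_ite,
      ite_self, zero_smul, Finset.sum_const_zero, add_zero, zero_add, SubIndex.perMinus.injEq]
    rw [Finset.sum_eq_single i, Finset.sum_eq_single k]
    · simp [hk]
    · intro l _ hne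
      simp [hne]
    · exact fun h' => absurd (Finset.mem_Icc.2 ⟨hk.1, hk.2.le⟩) h'
    · intro l _ hne
      simp [hne]
    · exact fun h' => absurd (Finset.mem_univ i) h'
  | out b hb =>
    simp only [lincomb, subCoeffs, Pi.single_apply, subfamily, reduceCtorEq, if_false, dite_eq_ite,
      ite_self, zero_smul, Finset.sum_const_zero, add_zero, zero_add, SubIndex.out.injEq]
    rw [Finset.sum_eq_single b]
    · simp [hb]
    · intro l _ hne
      simp [hne]
    · exact fun h' => absurd hb h'

lemma lincomb_subCoeffs (l : SubIndex T J₀ J →₀ ℝ) :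
    T.lincomb J₀ J (subCoeffs l) = Finsupp.linearCombination ℝ (T.subfamily J₀ J) l := by
  classical
  induction l using Finsupp.induction_linear with
  | zero => rw [Finsupp.coe_zero, lincomb_subCoeffs_zero, map_zero]
  | add f g hf hg => rw [Finsupp.coe_add, lincomb_subCoeffs_add, hf, hg, map_add]
  | single x c =>
    rw [Finsupp.single_eq_pi_single, lincomb_subCoeffs_single, Finsupp.linearCombination_single]

/-- The vectors `R_j⁻` and the last `C^{i,-}` are omitted, so their coefficients are zero. These
already determine the step function at all the relevant germs: `val_succ` and `val_endpoint` carry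
the zeros from the minus sides to the plus sides. -/
theorem Config.linearIndependent (hc : Config T J₀ J) :
    LinearIndependent ℝ (T.subfamily J₀ J) := by
  classical
  rw [linearIndependent_iff]
  intro l hl
  rw [← lincomb_subCoeffs] at hl
  set a : Coeffs n r := subCoeffs l with ha
  have hminus : ∀ j ≤ T.branchCount J₀, val T J₀ J a .minus (T.branchPt J₀ j) = 0 := by
    intro j hj
    by_cases h : j ∈ T.idx J₀ .minus
    · have h₁ : (0 : ℝ) = _ := hc.aR_eq hl h
      rw [sgn] at h₁
      linarith
    · exact (hc.val_eq_zero_of_not_mem_idx hl hj h).2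
  have hplus : ∀ j ≤ T.branchCount J₀, val T J₀ J a .plus (T.branchPt J₀ j) = 0 := by
    intro j hj
    by_cases h : j ∈ T.idx J₀ .plus
    · have h₁ := mem_idx_plus.1 h
      rw [hc.val_succ h₁, hminus _ h₁]
    · exact (hc.val_eq_zero_of_not_mem_idx hl hj h).2
  have hright : ∀ i, val T J₀ J a .minus (J i).right = 0 := by
    intro i
    -- If there is no landing on the minus side, nothing was omitted there and the vanishing comes
    -- from the passage through `1⁻`.
    rcases Nat.eq_zero_or_pos (T.perM (J i) .minus) with h | h
    · exact hc.val_right_eq_zero hl h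
    · have h₁ := hc.aP_eq hl h le_rfl
      -- The index `k = m` is absent on the minus side, so the coefficient takes its default value.
      have h₂ : a.aP .minus i (T.perM (J i) .minus) = 0 := dif_neg fun h => lt_irrefl _ h.2
      rw [h₂, sgn] at h₁
      have h₃ : val T J₀ J a .minus ((J i).endpoint .minus) = 0 := by linarith
      exact h₃
  have hleft : ∀ i, val T J₀ J a .plus (J i).left = 0 := fun i => by
    rw [hc.val_endpoint, hright]
  ext x
  rw [Finsupp.coe_zero, Pi.zero_apply]
  cases x with
  | landing j hj h =>
    have e : a.aL j = l (.landing j hj h) := dif_pos ⟨hj, h⟩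
    rw [← e, hc.aL_eq hl hj h, hplus j hj, hminus j hj, sub_zero]
  | ret j hj =>
    have e : a.aR .plus j = l (.ret j hj) := dif_pos hj
    rw [← e, hc.aR_eq hl (mem_idx_plus.2 hj), hplus j hj.le, mul_zero]
  | connPlus j k hj hk =>
    have e : a.aC .plus j k = l (.connPlus j k hj hk) := dif_pos ⟨hj, hk⟩
    rw [← e, hc.aC_eq hl (mem_idx_plus.2 hj) hk.1 hk.2, hplus j hj.le, mul_zero]
  | connMinus j k hj hk =>
    have e : a.aC .minus j k = l (.connMinus j k hj hk) := dif_pos ⟨hj, hk⟩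
    rw [← e, hc.aC_eq hl (mem_idx_minus.2 hj) hk.1 hk.2, hminus j hj.2, mul_zero]
  | perPlus i k hk =>
    have e : a.aP .plus i k = l (.perPlus i k hk) := dif_pos hk
    rw [← e, hc.aP_eq hl hk.1 hk.2]
    exact mul_eq_zero_of_right _ (hleft i)
  | perMinus i k hk =>
    have e : a.aP .minus i k = l (.perMinus i k hk) := dif_pos hk
    rw [← e, hc.aP_eq hl hk.1 hk.2.le]
    exact mul_eq_zero_of_right _ (hright i)
  | out b hb =>
    have e : a.aX b = l (.out b hb) := dif_pos hb
    rw [← e, hc.aX_eq_zero hl hb]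

end SubCoeffs

end ITM

theorem mainTheorem5 {r n : ℕ} (T : ITM r) (J₀ : HOInterval) (J : Fin n → HOInterval)
    (hJ₀ : T.IsComponent J₀)
    (hJ : ∀ i, T.IsMaxPeriodic (J i))
    (hdisj₀ : ∀ i, Disjoint (T.orbitSet J₀.toSet) (T.orbitSet (J i).toSet))
    (hdisj : ∀ i i', i ≠ i' → Disjoint (T.orbitSet (J i).toSet) (T.orbitSet (J i').toSet)) :
    (∀ a : ITM.Coeffs n r, T.lincomb J₀ J a = 0 →
      (∀ i, ∃ c : ℝ,
        (∀ k ∈ Finset.Icc 1 (T.perM (J i) .plus), a.aP .plus i k = c) ∧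
        (∀ k ∈ Finset.Icc 1 (T.perM (J i) .minus), a.aP .minus i k = -c)) ∧
      (∀ j < T.branchCount J₀, ∃ c : ℝ,
        (∀ k ∈ Finset.Ico 1 (T.m J₀ .plus j), a.aC .plus j k = c) ∧
        a.aR .plus j = c ∧
        (∀ k ∈ Finset.Ico 1 (T.m J₀ .minus (j + 1)), a.aC .minus (j + 1) k = -c) ∧
        a.aR .minus (j + 1) = -c) ∧
      (T.Lands J₀ 0 → a.aL 0 = T.headCoeff J₀ a .plus 0) ∧
      (T.Lands J₀ (T.branchCount J₀) →
        a.aL (T.branchCount J₀) = T.headCoeff J₀ a .minus (T.branchCount J₀)) ∧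
      (∀ j, 0 < j → j < T.branchCount J₀ →
        a.aL j = T.headCoeff J₀ a .plus j + T.headCoeff J₀ a .minus j) ∧
      (∀ b ∈ T.outside, a.aX b = 0)) ∧
    LinearIndependent ℝ (T.subfamily J₀ J) := by
  have hc : ITM.Config T J₀ J := ⟨hJ₀, hJ, hdisj₀, hdisj⟩
  exact ⟨fun a ha => hc.relations ha, hc.linearIndependent⟩
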